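/- Write $2\mathrm{Cat}$ (resp. $\mathrm{DblCat}$) for the category of small strict 2-categories and strict 2-functors (resp. small strict double categories and strict double functors). **The 2-categories $\mathcal O^{\sim}_2[n]$ and $\mathcal O^{\simeq}_2[n]$.** For $n\ge 0$ let $\mathcal O_2[n]$ be the 2-truncated oriental: its objects are $0,\dots,n$, its 1-cells from $a$ to $b$ are the subsets of $\{0,\dots,n\}$ with minimum $a$ and maximum $b$, composed by union, and there is exactly one 2-cell $S\Rightarrow T$ between parallel 1-cells if $S\subseteq T$ and none otherwise. Let $\mathcal O^{\sim}_2[n]$ be the pushout of 2-categories obtained from $\mathcal O_2[n]$ by gluing a free-living invertible 2-cell, along the free-living 2-cell, on each generating 2-cell $\{a,c\}\Rightarrow\{a,b,c\}$, $a<b<c$. Let $\mathcal O^{\simeq}_2[n]$ be the pushout of 2-categories obtained from $\mathcal O^{\sim}_2[n]$ by gluing a free-living adjoint equivalence, along the free-living 1-cell included as its left adjoint, on each generating 1-cell $\{a,b\}$, $a<b$. Both are cosimplicial 2-categories, i.e. functors $\Delta\to 2\mathrm{Cat}$ in $[n]$: a monotone map sends $S$ to its image, and the glued adjoint equivalence on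 $\{a,b\}$ to the one on the image of $\{a,b\}$, or to an identity adjoint equivalence if that image is a single point. **Tensor products of 2-categories.** For 2-categories $\mathcal B,\mathcal D$ let $[\mathcal B,\mathcal D]_{\mathrm{ps}}$ (resp. $[\mathcal B,\mathcal D]_{\mathrm{ic}}$) be the 2-category of 2-functors, pseudonatural transformations (resp. icons) and modifications. Here a lax natural transformation $\alpha\colon F\Rightarrow G$ has 2-cells $\alpha_b\circ Ff\Rightarrow Gf\circ\alpha_a$ for $f\colon a\to b$; it is pseudonatural if these are invertible, and an icon if all the 1-cells $\alpha_a$ are identities. The tensor products $\otimes_{\mathrm{ps}}$ and $\otimes_{\mathrm{ic}}$ are defined by natural bijections $2\mathrm{Cat}(\mathcal A\otimes_{x}\mathcal B,\mathcal D)\cong 2\mathrm{Cat}(\mathcal A,[\mathcal B,\mathcal D]_{x})$ for $x\in\{\mathrm{ps},\mathrm{ic}\}$. **Double categories.** Let $\llbracket\mathbb A,\mathbb B\rrbracket$ be the double category of double functors $\mathbb A\to\mathbb B$, horizontal pseudonatural transformations, vertical pseudonatural transformations and modifications, and let $\otimes^{\mathrm{dbl}}_{\mathrm{ps}}$ be the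 corresponding tensor product, so that $\mathrm{DblCat}(\mathbb X\otimes^{\mathrm{dbl}}_{\mathrm{ps}}\mathbb A,\mathbb B)\cong\mathrm{DblCat}(\mathbb X,\llbracket\mathbb A,\mathbb B\rrbracket)$ naturally. Let $\mathbb H,\mathbb V\colon 2\mathrm{Cat}\to\mathrm{DblCat}$ be the horizontal and the vertical embedding, which regard a 2-category as a double category with only identity vertical (resp. horizontal) morphisms: the horizontal (resp. vertical) morphisms are the 1-cells, and the squares are the 2-cells, from the top to the bottom (resp. from the right side to the left side). Let $L\colon\mathrm{DblCat}\to 2\mathrm{Cat}$ be the left adjoint of $\mathbb H$. Let $\mathbb C\colon\mathrm{Set}^{(\Delta\times\Delta\times\Delta)^{\mathrm{op}}}\to\mathrm{DblCat}$ be the colimit-preserving extension along the Yoneda embedding $([i],[j],[k])\mapsto\Delta[i,j,k]$ of the functor $$([i],[j],[k])\longmapsto \mathbb V\mathcal O^{\sim}_2[j]\otimes^{\mathrm{dbl}}_{\mathrm{ps}}\bigl(\mathbb H\mathcal O^{\sim}_2[i]\otimes^{\mathrm{dbl}}_{\mathrm{ps}}\mathbb H\mathcal O^{\simeq}_2[k]\bigr).$$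 **Proposition.** For all $i,j,k\ge 0$ there is an isomorphism of 2-categories $$L\,\mathbb C\,\Delta[i,j,k]\;\cong\;\mathcal O^{\sim}_2[j]\otimes_{\mathrm{ic}}\bigl(\mathcal O^{\sim}_2[i]\otimes_{\mathrm{ps}}\mathcal O^{\simeq}_2[k]\bigr),$$ natural in $([i],[j],[k])\in\Delta\times\Delta\times\Delta$. -/

import Mathlib

open CategoryTheory Opposite

universe u v w

/-- A category structure with type of objects `O` and type of morphisms `M`. Composition is
written in diagrammatic order, and is encoded as a total function of which only the values at
composable pairs matter: they are the only ones constrained by the axioms, and the only ones that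
functors have to preserve. -/
structure CatOn (O : Type u) (M : Type v) where
  src : M → O
  tgt : M → O
  id : O → M
  comp : M → M → M
  src_id : ∀ a, src (id a) = a
  tgt_id : ∀ a, tgt (id a) = a
  src_comp : ∀ f g, tgt f = src g → src (comp f g) = src f
  tgt_comp : ∀ f g, tgt f = src g → tgt (comp f g) = tgt g
  id_comp : ∀ f, comp (id (src f)) f = f
  comp_id : ∀ f, comp f (id (tgt f)) = f
  assoc : ∀ f g h, tgt f = src g → tgt g = src h → comp (comp f g) h = comp f (comp g h)

namespace CatOn

/-- Invertibility of a morphism. -/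
def IsInv {O : Type u} {M : Type v} (C : CatOn O M) (f : M) : Prop :=
  ∃ g, C.src g = C.tgt f ∧ C.tgt g = C.src f ∧
    C.comp f g = C.id (C.src f) ∧ C.comp g f = C.id (C.tgt f)

/-- Functoriality of a pair of maps (on objects and on morphisms). -/
structure IsFun {O : Type u} {M : Type v} {O' : Type w} {M' : Type*} (C : CatOn O M)
    (C' : CatOn O' M') (F₀ : O → O') (F₁ : M → M') : Prop where
  src : ∀ f, C'.src (F₁ f) = F₀ (C.src f)
  tgt : ∀ f, C'.tgt (F₁ f) = F₀ (C.tgt f)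
  id : ∀ a, F₁ (C.id a) = C'.id (F₀ a)
  comp : ∀ f g, C.tgt f = C.src g → F₁ (C.comp f g) = C'.comp (F₁ f) (F₁ g)

/-- The discrete category on a type. -/
def disc (O : Type u) : CatOn O O where
  src a := a
  tgt a := a
  id a := a
  comp a _ := a
  src_id _ := rfl
  tgt_id _ := rfl
  src_comp _ _ _ := rfl
  tgt_comp _ _ h := h
  id_comp _ := rfl
  comp_id _ := rfl
  assoc _ _ _ _ _ := rfl

open Classical in
/-- A category structure from a composition that is only defined on composable pairs. -/
noncomputable def ofPartial {O : Type u} {M : Type v} (src tgt : M → O) (id : O → M)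
    (comp : ∀ f g, tgt f = src g → M)
    (src_id : ∀ a, src (id a) = a) (tgt_id : ∀ a, tgt (id a) = a)
    (src_comp : ∀ f g h, src (comp f g h) = src f) (tgt_comp : ∀ f g h, tgt (comp f g h) = tgt g)
    (id_comp : ∀ f h, comp (id (src f)) f h = f) (comp_id : ∀ f h, comp f (id (tgt f)) h = f)
    (assoc : ∀ f g h p q p' q', comp (comp f g p) h q = comp f (comp g h p') q') : CatOn O M where
  src := src
  tgt := tgt
  id := id
  comp f g := if h : tgt f = src g then comp f g h else f
  src_id := src_id
  tgt_id := tgt_id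
  src_comp f g h := by simp [h, src_comp]
  tgt_comp f g h := by simp [h, tgt_comp]
  id_comp f := by simp [tgt_id, id_comp]
  comp_id f := by simp [src_id, comp_id]
  assoc f g h p q := by
    have h1 : tgt (comp f g p) = src h := by rw [tgt_comp, q]
    have h2 : tgt f = src (comp g h q) := by rw [src_comp, p]
    simp only [dif_pos p, dif_pos q, dif_pos h1, dif_pos h2]
    exact assoc _ _ _ _ _ _ _

end CatOn

/-- A (strict) 2-category: objects, 1-cells and 2-cells, with a category structure on objects and
1-cells (`one`), and the horizontal (`hor`) and vertical (`ver`) category structures on 2-cells. -/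
structure TwoCat where
  Ob : Type u
  Hom : Type u
  Cell : Type u
  one : CatOn Ob Hom
  hor : CatOn Ob Cell
  ver : CatOn Hom Cell
  isFun_src : hor.IsFun one (fun a => a) ver.src
  isFun_tgt : hor.IsFun one (fun a => a) ver.tgt
  isFun_id : one.IsFun hor (fun a => a) ver.id
  interchange : ∀ α β γ δ, ver.tgt α = ver.src β → ver.tgt γ = ver.src δ →
    hor.tgt α = hor.src γ → hor.tgt β = hor.src δ →
    hor.comp (ver.comp α β) (ver.comp γ δ) = ver.comp (hor.comp α γ) (hor.comp β δ)

/-- A (strict) 2-functor. -/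
@[ext]
structure TwoFunctor (A B : TwoCat.{u}) where
  ob : A.Ob → B.Ob
  hom : A.Hom → B.Hom
  cell : A.Cell → B.Cell
  isFun_one : A.one.IsFun B.one ob hom
  isFun_hor : A.hor.IsFun B.hor ob cell
  isFun_ver : A.ver.IsFun B.ver hom cell

/-- A (strict) double category: objects, horizontal and vertical morphisms, and squares.
The square with top `f`, bottom `g`, left side `u` and right side `v` is composed horizontally
(along vertical morphisms) by `sqh` and vertically (along horizontal morphisms) by `sqv`: its top
and bottom are its `sqv.src` and `sqv.tgt`, its left and right side its `sqh.src` and `sqh.tgt`. -/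
structure DblCat where
  Ob : Type u
  Hor : Type u
  Ver : Type u
  Sq : Type u
  hor : CatOn Ob Hor
  ver : CatOn Ob Ver
  sqh : CatOn Ver Sq
  sqv : CatOn Hor Sq
  isFun_top : sqh.IsFun hor ver.src sqv.src
  isFun_bot : sqh.IsFun hor ver.tgt sqv.tgt
  isFun_idh : hor.IsFun sqh ver.id sqv.id
  isFun_left : sqv.IsFun ver hor.src sqh.src
  isFun_right : sqv.IsFun ver hor.tgt sqh.tgt
  isFun_idv : ver.IsFun sqv hor.id sqh.id
  interchange : ∀ α β γ δ, sqv.tgt α = sqv.src β → sqv.tgt γ = sqv.src δ →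
    sqh.tgt α = sqh.src γ → sqh.tgt β = sqh.src δ →
    sqh.comp (sqv.comp α β) (sqv.comp γ δ) = sqv.comp (sqh.comp α γ) (sqh.comp β δ)

/-- A (strict) double functor. -/
@[ext]
structure DblFunctor (A B : DblCat.{u}) where
  ob : A.Ob → B.Ob
  horm : A.Hor → B.Hor
  verm : A.Ver → B.Ver
  sq : A.Sq → B.Sq
  isFun_hor : A.hor.IsFun B.hor ob horm
  isFun_ver : A.ver.IsFun B.ver ob verm
  isFun_sqh : A.sqh.IsFun B.sqh verm sq
  isFun_sqv : A.sqv.IsFun B.sqv horm sq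

theorem CatOn.IsFun.refl {O : Type u} {M : Type v} (C : CatOn O M) :
    C.IsFun C (fun x => x) (fun x => x) :=
  ⟨fun _ => rfl, fun _ => rfl, fun _ => rfl, fun _ _ _ => rfl⟩

theorem CatOn.IsFun.trans {O M O' M' O'' M'' : Type*} {C : CatOn O M} {C' : CatOn O' M'}
    {C'' : CatOn O'' M''} {F₀ : O → O'} {F₁ : M → M'} {G₀ : O' → O''} {G₁ : M' → M''}
    (hF : C.IsFun C' F₀ F₁) (hG : C'.IsFun C'' G₀ G₁) :
    C.IsFun C'' (fun x => G₀ (F₀ x)) (fun x => G₁ (F₁ x)) where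
  src f := by rw [hG.src, hF.src]
  tgt f := by rw [hG.tgt, hF.tgt]
  id a := by rw [hF.id, hG.id]
  comp f g h := by rw [hF.comp f g h, hG.comp _ _ (by rw [hF.tgt, hF.src, h])]

instance : Category TwoCat.{u} where
  Hom := TwoFunctor
  id A := ⟨fun x => x, fun x => x, fun x => x, .refl _, .refl _, .refl _⟩
  comp F G := ⟨fun x => G.ob (F.ob x), fun x => G.hom (F.hom x), fun x => G.cell (F.cell x),
    F.isFun_one.trans G.isFun_one, F.isFun_hor.trans G.isFun_hor, F.isFun_ver.trans G.isFun_ver⟩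

instance : Category DblCat.{u} where
  Hom := DblFunctor
  id A := ⟨fun x => x, fun x => x, fun x => x, fun x => x, .refl _, .refl _, .refl _, .refl _⟩
  comp F G := ⟨fun x => G.ob (F.ob x), fun x => G.horm (F.horm x), fun x => G.verm (F.verm x),
    fun x => G.sq (F.sq x), F.isFun_hor.trans G.isFun_hor, F.isFun_ver.trans G.isFun_ver,
    F.isFun_sqh.trans G.isFun_sqh, F.isFun_sqv.trans G.isFun_sqv⟩

/-- Transposition of double categories, which swaps the horizontal and the vertical direction. -/
@[reducible] def DblCat.tr (A : DblCat.{u}) : DblCat.{u} where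
  Ob := A.Ob
  Hor := A.Ver
  Ver := A.Hor
  Sq := A.Sq
  hor := A.ver
  ver := A.hor
  sqh := A.sqv
  sqv := A.sqh
  isFun_top := A.isFun_left
  isFun_bot := A.isFun_right
  isFun_idh := A.isFun_idv
  isFun_left := A.isFun_top
  isFun_right := A.isFun_bot
  isFun_idv := A.isFun_idh
  interchange α β γ δ h₁ h₂ h₃ h₄ := (A.interchange α γ β δ h₃ h₄ h₁ h₂).symm

/-- Transposition of double functors. -/
def DblFunctor.tr {A B : DblCat.{u}} (F : A ⟶ B) : A.tr ⟶ B.tr :=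
  ⟨F.ob, F.verm, F.horm, F.sq, F.isFun_ver, F.isFun_hor, F.isFun_sqv, F.isFun_sqh⟩

/-- The transposition functor. -/
def DblCat.transpose : DblCat.{u} ⥤ DblCat.{u} where
  obj A := A.tr
  map F := F.tr

/-- The horizontal double category of a 2-category: its horizontal morphisms are the 1-cells,
its vertical morphisms are identities, and its squares are the 2-cells, from top to bottom. -/
def TwoCat.toHor (A : TwoCat.{u}) : DblCat.{u} where
  Ob := A.Ob
  Hor := A.Hom
  Ver := A.Ob
  Sq := A.Cell
  hor := A.one
  ver := .disc A.Ob
  sqh := A.hor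
  sqv := A.ver
  isFun_top := A.isFun_src
  isFun_bot := A.isFun_tgt
  isFun_idh := A.isFun_id
  isFun_left := ⟨fun α => (A.isFun_src.src α).symm,
    fun α => (A.isFun_tgt.src α).symm, fun a => A.isFun_id.src a, fun α β h => by
      have h1 := A.isFun_src.src (A.ver.comp α β)
      rw [A.ver.src_comp _ _ h, A.isFun_src.src] at h1
      exact h1.symm⟩
  isFun_right := ⟨fun α => (A.isFun_src.tgt α).symm,
    fun α => (A.isFun_tgt.tgt α).symm, fun a => A.isFun_id.tgt a, fun α β h => by
      have h1 := A.isFun_src.tgt (A.ver.comp α β)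
      rw [A.ver.src_comp _ _ h, A.isFun_src.tgt] at h1
      exact h1.symm⟩
  isFun_idv := ⟨fun a => (A.isFun_src.id a), fun a => (A.isFun_tgt.id a),
    fun a => (A.isFun_id.id a).symm, fun a b h => by
      obtain rfl : a = b := h
      have := A.ver.id_comp (A.hor.id a)
      rw [A.isFun_src.id, A.isFun_id.id] at this
      exact this.symm⟩
  interchange := A.interchange

/-- The horizontal embedding of 2-categories into double categories. -/
def horEmb : TwoCat.{u} ⥤ DblCat.{u} where
  obj A := A.toHor
  map F := ⟨F.ob, F.hom, F.ob, F.cell, F.isFun_one,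
    ⟨fun _ => rfl, fun _ => rfl, fun _ => rfl, fun _ _ _ => rfl⟩, F.isFun_hor, F.isFun_ver⟩

/-- A category whose objects have underlying sets of cells, on which its morphisms are determined.
`Emb` is a class of families of morphisms with a common source (which are in particular jointly
injective on cells); morphisms lift along jointly injective families, and any family of sets of cells
indexed by `X` lies in the image of an object generated by `X`. This is used to prove that the
universal 2-categories and double categories below exist. -/
class CellCategory (K : Type 1) [Category.{0} K] where
  cell : K → Type
  cmap : ∀ {A B : K}, (A ⟶ B) → cell A → cell B
  cmap_id : ∀ (A : K) (x : cell A), cmap (𝟙 A) x = x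
  cmap_comp : ∀ {A B C : K} (f : A ⟶ B) (g : B ⟶ C) (x : cell A), cmap (f ≫ g) x = cmap g (cmap f x)
  hom_ext : ∀ {A B : K} (f g : A ⟶ B), (∀ x, cmap f x = cmap g x) → f = g
  Emb : ∀ {S : Type 1} {E : K} {D : S → K}, (∀ s, E ⟶ D s) → Prop
  inj_of_emb : ∀ {S : Type 1} {E : K} {D : S → K} (p : ∀ s, E ⟶ D s), Emb p →
    ∀ x y, (∀ s, cmap (p s) x = cmap (p s) y) → x = y
  lift : ∀ {S : Type 1} {A E : K} {D : S → K} (p : ∀ s, E ⟶ D s),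
    (∀ x y, (∀ s, cmap (p s) x = cmap (p s) y) → x = y) → ∀ (h : ∀ s, A ⟶ D s)
    (k : cell A → cell E), (∀ s x, cmap (p s) (k x) = cmap (h s) x) →
    ∃ F : A ⟶ E, ∀ x, cmap F x = k x
  gen : ∀ (X : Type) {S : Type 1} {D : S → K} (g : ∀ s, X → cell (D s)),
    ∃ (E : K) (e : X → cell E) (p : ∀ s, E ⟶ D s), Emb p ∧ (∀ s x, cmap (p s) (e x) = g s x) ∧
      ∀ (B : K) (F G : E ⟶ B), (∀ x, cmap F (e x) = cmap G (e x)) → F = G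

namespace CellCategory

variable {K : Type 1} [Category.{0} K] [CellCategory K] {K' : Type 1} [Category.{0} K']
  [CellCategory K']

/-- Functors whose elements are determined by families of cells, subject to conditions that are
reflected by `Emb`. -/
def IsGood (R : K ⥤ Type) : Prop :=
  ∃ (X : Type) (c : ∀ D, R.obj D → X → cell D),
    (∀ (A B : K) (f : A ⟶ B) (r : R.obj A) x, c B (R.map f r) x = cmap f (c A r x)) ∧
    (∀ D (r r' : R.obj D), (∀ x, c D r x = c D r' x) → r = r') ∧
    ∀ {S : Type 1} {E : K} {D : S → K} (p : ∀ s, E ⟶ D s), Emb p →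
      ∀ (r : ∀ s, R.obj (D s)) (e : X → cell E), (∀ s x, cmap (p s) (e x) = c _ (r s) x) →
      ∃ r' : R.obj E, ∀ s, R.map (p s) r' = r s

theorem IsGood.isCorepresentable {R : K ⥤ Type} (hR : IsGood R) : R.IsCorepresentable := by
  obtain ⟨X, c, nat, inj, lft⟩ := hR
  obtain ⟨E, e, p, hp, he, hgen⟩ := gen X (S := Σ D, R.obj D) (D := Sigma.fst)
    (fun s => c s.1 s.2)
  obtain ⟨r, hr⟩ := lft p hp (fun s => s.2) e he
  have hc : ∀ x, c E r x = e x := fun x => inj_of_emb p hp _ _ fun s => by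
    rw [← nat, hr, he]
  exact ⟨E, ⟨{
    homEquiv := fun {D} =>
      { toFun := fun f => R.map f r
        invFun := fun d => p ⟨D, d⟩
        left_inv := fun f => hgen _ _ _ fun x => by
          rw [he, nat, hc]
        right_inv := fun d => hr ⟨D, d⟩ }
    homEquiv_comp := fun f g => by simp }⟩⟩

/-- The functor of cells. -/
def cells (K : Type 1) [Category.{0} K] [CellCategory K] : K ⥤ Type where
  obj := cell
  map f := ↾(cmap f)
  map_id A := by ext x; exact cmap_id A x
  map_comp f g := by ext x; exact cmap_comp f g x

theorem isGood_cells : IsGood (cells K) :=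
  ⟨Unit, fun _ x _ => x, fun _ _ _ _ _ => rfl, fun _ _ _ h => h (), fun _ _ _ e h =>
    ⟨e (), fun s => h s ()⟩⟩

theorem IsGood.hom {G : K ⥤ K'} (hG : IsGood (G ⋙ cells K')) (A : K') :
    IsGood (G ⋙ coyoneda.obj (op A)) := by
  obtain ⟨X, c, nat, inj, lft⟩ := hG
  refine ⟨cell A × X, fun D F x => c D (cmap F x.1) x.2, fun D D' f F x => ?_, fun D F F' h => ?_,
    fun {S E D} p hp h e he => ?_⟩
  · have := nat _ _ f (cmap F x.1) x.2
    refine Eq.trans ?_ this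
    exact congrArg (fun t => c D' t x.2) (cmap_comp _ _ _)
  · exact hom_ext _ _ fun a => inj _ _ _ fun x => h (a, x)
  · have h1 := fun a => lft p hp (fun s => cmap (h s) a) (fun x => e (a, x)) (fun s x => he s _)
    choose k hk using h1
    have hinj : ∀ x y, (∀ s, cmap (G.map (p s)) x = cmap (G.map (p s)) y) → x = y := by
      intro x y hxy
      refine inj _ _ _ fun z => inj_of_emb p hp _ _ fun s => ?_
      refine (nat _ _ (p s) x z).symm.trans (Eq.trans ?_ (nat _ _ (p s) y z))
      exact congrArg (fun t => c (D s) t z) (hxy s)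
    obtain ⟨F, hF⟩ := lift (fun s => G.map (p s)) hinj h k (fun s a => hk a s)
    refine ⟨F, fun s => hom_ext _ _ fun a => ?_⟩
    refine (cmap_comp _ _ _).trans ?_
    rw [hF]
    exact hk a s

theorem IsGood.isRightAdjoint {G : K ⥤ K'} (hG : IsGood (G ⋙ cells K')) : G.IsRightAdjoint :=
  Functor.isRightAdjoint_of_leftAdjointObjIsDefined_eq_top (by
    ext A; simpa [Functor.leftAdjointObjIsDefined_iff] using (hG.hom A).isCorepresentable)

theorem isGood_hom (A : K) : IsGood (coyoneda.obj (op A)) :=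
  IsGood.hom (G := 𝟭 K) isGood_cells A

open Limits in
instance : HasColimitsOfSize.{0, 0} K where
  has_colimits_of_shape J _ := ⟨fun F => by
    suffices h : IsGood F.cocones by
      have := h.isCorepresentable
      exact HasColimit.mk ⟨_, IsColimit.ofCorepresentableBy F.cocones.corepresentableBy⟩
    refine ⟨Σ j, cell (F.obj j), fun D r x => cmap (r.app x.1) x.2, fun A B f r x => ?_,
      fun D r r' h => ?_, fun {S E D} p hp r e he => ?_⟩
    · exact cmap_comp _ _ _
    · refine NatTrans.ext (funext fun j => ?_)
      exact hom_ext _ _ fun x => h ⟨j, x⟩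
    · have inj := inj_of_emb p hp
      choose k hk using fun j => lift p inj (fun s => (r s).app j) (fun x => e ⟨j, x⟩)
        (fun s x => he s _)
      refine ⟨⟨k, fun i j f => hom_ext _ _ fun x => inj _ _ fun s => ?_⟩, fun s => ?_⟩
      · have h1 := congrArg (fun t => cmap t x) ((r s).naturality f)
        have h2 : cmap (k i ≫ p s) x = cmap ((r s).app i ≫ 𝟙 _) x := by
          rw [cmap_comp, hk, Category.comp_id]
          exact he s ⟨i, x⟩
        refine Eq.trans ?_ (h1.trans h2.symm |>.trans ?_)
        · rw [cmap_comp, cmap_comp, hk]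
          exact he s ⟨j, _⟩
        · rw [cmap_comp]
          exact congrArg (fun t => cmap (p s) (cmap t x)) (Category.comp_id (k i)).symm
      · refine NatTrans.ext (funext fun j => ?_)
        refine hom_ext _ _ fun x => ?_
        refine (cmap_comp _ _ _).trans ?_
        rw [hk]
        exact he s ⟨j, x⟩⟩

end CellCategory

namespace CatOn

/-- Injective families of maps whose image is closed under the category operations. -/
structure Closed {S O' M' : Type*} {O M : S → Type*} (C : ∀ s, CatOn (O s) (M s))
    (j₀ : O' → ∀ s, O s) (j₁ : M' → ∀ s, M s) : Prop where
  inj₀ : ∀ a b, (∀ s, j₀ a s = j₀ b s) → a = b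
  inj₁ : ∀ f g, (∀ s, j₁ f s = j₁ g s) → f = g
  src : ∀ f, ∃ a, ∀ s, j₀ a s = (C s).src (j₁ f s)
  tgt : ∀ f, ∃ a, ∀ s, j₀ a s = (C s).tgt (j₁ f s)
  id : ∀ a, ∃ f, ∀ s, j₁ f s = (C s).id (j₀ a s)
  comp : ∀ f g, (∀ s, (C s).tgt (j₁ f s) = (C s).src (j₁ g s)) →
    ∃ h, ∀ s, j₁ h s = (C s).comp (j₁ f s) (j₁ g s)

theorem Closed.exists_comp {S : Type*} {O' : Type u} {M' : Type v} {O M : S → Type*}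
    {C : ∀ s, CatOn (O s) (M s)} {j₀ : O' → ∀ s, O s} {j₁ : M' → ∀ s, M s} (H : Closed C j₀ j₁) (f g : M') : ∃ h,
    (∀ s, (C s).tgt (j₁ f s) = (C s).src (j₁ g s)) → ∀ s, j₁ h s = (C s).comp (j₁ f s) (j₁ g s) := by
  by_cases h : ∀ s, (C s).tgt (j₁ f s) = (C s).src (j₁ g s)
  · obtain ⟨k, hk⟩ := H.comp f g h
    exact ⟨k, fun _ => hk⟩
  · exact ⟨f, fun h' => (h h').elim⟩

section

variable {S : Type*} {O' : Type u} {M' : Type v} {O M : S → Type*} {C : ∀ s, CatOn (O s) (M s)}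
  {j₀ : O' → ∀ s, O s} {j₁ : M' → ∀ s, M s} (H : Closed C j₀ j₁)

theorem Closed.composable {f g : M'} (h : (H.tgt f).choose = (H.src g).choose) (s : S) :
    (C s).tgt (j₁ f s) = (C s).src (j₁ g s) := by
  rw [← (H.tgt f).choose_spec, ← (H.src g).choose_spec, h]

/-- The induced category structure. -/
noncomputable def Closed.cat : CatOn O' M' where
  src f := (H.src f).choose
  tgt f := (H.tgt f).choose
  id a := (H.id a).choose
  comp f g := (H.exists_comp f g).choose
  src_id a := H.inj₀ _ _ fun s => by
    rw [(H.src _).choose_spec, (H.id _).choose_spec, (C s).src_id]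
  tgt_id a := H.inj₀ _ _ fun s => by
    rw [(H.tgt _).choose_spec, (H.id _).choose_spec, (C s).tgt_id]
  src_comp f g h := H.inj₀ _ _ fun s => by
    have h' := H.composable h
    rw [(H.src _).choose_spec, (H.exists_comp f g).choose_spec h', (C s).src_comp _ _ (h' s),
      (H.src _).choose_spec]
  tgt_comp f g h := H.inj₀ _ _ fun s => by
    have h' := H.composable h
    rw [(H.tgt _).choose_spec, (H.exists_comp f g).choose_spec h', (C s).tgt_comp _ _ (h' s),
      (H.tgt _).choose_spec]
  id_comp f := H.inj₁ _ _ fun s => by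
    rw [(H.exists_comp _ f).choose_spec, (H.id _).choose_spec, (H.src _).choose_spec,
      (C s).id_comp]
    intro s
    rw [(H.id _).choose_spec, (H.src _).choose_spec, (C s).tgt_id]
  comp_id f := H.inj₁ _ _ fun s => by
    rw [(H.exists_comp f _).choose_spec, (H.id _).choose_spec, (H.tgt _).choose_spec,
      (C s).comp_id]
    intro s
    rw [(H.id _).choose_spec, (H.tgt _).choose_spec, (C s).src_id]
  assoc f g h p q := H.inj₁ _ _ fun s => by
    have p' := H.composable p
    have q' := H.composable q
    rw [(H.exists_comp _ h).choose_spec, (H.exists_comp f g).choose_spec p',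
      (H.exists_comp f _).choose_spec, (H.exists_comp g h).choose_spec q',
      (C s).assoc _ _ _ (p' s) (q' s)]
    · intro s
      rw [(H.exists_comp g h).choose_spec q', (C s).src_comp _ _ (q' s), p']
    · intro s
      rw [(H.exists_comp f g).choose_spec p', (C s).tgt_comp _ _ (p' s), q']

theorem Closed.isFun (s : S) : H.cat.IsFun (C s) (fun a => j₀ a s) (fun f => j₁ f s) where
  src f := ((H.src f).choose_spec s).symm
  tgt f := ((H.tgt f).choose_spec s).symm
  id a := (H.id a).choose_spec s
  comp f g h := (H.exists_comp f g).choose_spec (H.composable h) s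

end

theorem IsFun.of_inj {S : Type*} {O₁ M₁ O₂ M₂ : Type*} {P₁ Q₁ P₂ Q₂ : S → Type*}
    {A : CatOn O₁ M₁} {B : CatOn O₂ M₂} {C : ∀ s, CatOn (P₁ s) (Q₁ s)}
    {D : ∀ s, CatOn (P₂ s) (Q₂ s)} {F₀ : O₁ → O₂} {F₁ : M₁ → M₂}
    {p₀ : ∀ s, O₁ → P₁ s} {p₁ : ∀ s, M₁ → Q₁ s} {q₀ : ∀ s, O₂ → P₂ s} {q₁ : ∀ s, M₂ → Q₂ s}
    {G₀ : ∀ s, P₁ s → P₂ s} {G₁ : ∀ s, Q₁ s → Q₂ s}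
    (hp : ∀ s, A.IsFun (C s) (p₀ s) (p₁ s)) (hq : ∀ s, B.IsFun (D s) (q₀ s) (q₁ s))
    (hG : ∀ s, (C s).IsFun (D s) (G₀ s) (G₁ s))
    (i₀ : ∀ a b, (∀ s, q₀ s a = q₀ s b) → a = b) (i₁ : ∀ a b, (∀ s, q₁ s a = q₁ s b) → a = b)
    (c₀ : ∀ s a, q₀ s (F₀ a) = G₀ s (p₀ s a)) (c₁ : ∀ s a, q₁ s (F₁ a) = G₁ s (p₁ s a)) :
    A.IsFun B F₀ F₁ := by
  have hs : ∀ f, B.src (F₁ f) = F₀ (A.src f) := fun f => i₀ _ _ fun s => by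
    rw [← (hq s).src, c₁, (hG s).src, (hp s).src, c₀]
  have ht : ∀ f, B.tgt (F₁ f) = F₀ (A.tgt f) := fun f => i₀ _ _ fun s => by
    rw [← (hq s).tgt, c₁, (hG s).tgt, (hp s).tgt, c₀]
  refine ⟨hs, ht, fun a => i₁ _ _ fun s => ?_, fun f g h => i₁ _ _ fun s => ?_⟩
  · rw [c₁, (hp s).id, (hG s).id, (hq s).id, c₀]
  · rw [c₁, (hp s).comp _ _ h, (hG s).comp, (hq s).comp, c₁, c₁]
    · rw [hs, ht, h]
    · rw [(hp s).tgt, (hp s).src, h]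

end CatOn

namespace DblCat

/-- Terms for squares. -/
inductive Tm (X : Type) : Type
  | gen (x : X)
  | top (t : Tm X)
  | bot (t : Tm X)
  | left (t : Tm X)
  | right (t : Tm X)
  | hcomp (t t' : Tm X)
  | vcomp (t t' : Tm X)
  | hinv (t : Tm X)
  | vinv (t : Tm X)

open Classical in
/-- Interpretation of terms. -/
noncomputable def Tm.eval {X : Type} {S : Type 1} {D : S → DblCat.{0}} (g : ∀ s, X → (D s).Sq) :
    Tm X → ∀ s, (D s).Sq
  | gen x => fun s => g s x
  | top t => fun s => (D s).sqv.id ((D s).sqv.src (t.eval g s))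
  | bot t => fun s => (D s).sqv.id ((D s).sqv.tgt (t.eval g s))
  | left t => fun s => (D s).sqh.id ((D s).sqh.src (t.eval g s))
  | right t => fun s => (D s).sqh.id ((D s).sqh.tgt (t.eval g s))
  | hcomp t t' => if ∀ s, (D s).sqh.tgt (t.eval g s) = (D s).sqh.src (t'.eval g s)
      then fun s => (D s).sqh.comp (t.eval g s) (t'.eval g s) else t.eval g
  | vcomp t t' => if ∀ s, (D s).sqv.tgt (t.eval g s) = (D s).sqv.src (t'.eval g s)
      then fun s => (D s).sqv.comp (t.eval g s) (t'.eval g s) else t.eval g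
  | hinv t => if h : ∀ s, (D s).sqh.IsInv (t.eval g s) then fun s => (h s).choose else t.eval g
  | vinv t => if h : ∀ s, (D s).sqv.IsInv (t.eval g s) then fun s => (h s).choose else t.eval g

section

variable {X : Type} {S : Type 1} {D : S → DblCat.{0}} (g : ∀ s, X → (D s).Sq)

/-- A small copy of the image of a map. -/
def Im {T : Type} {Y : S → Type} (f : T → ∀ s, Y s) : Type := Shrink.{0} (Set.range f)

/-- The inclusion of the image. -/
noncomputable def Im.val {T : Type} {Y : S → Type} {f : T → ∀ s, Y s} (x : Im f) : ∀ s, Y s :=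
  ((equivShrink _).symm x).1

theorem Im.inj {T : Type} {Y : S → Type} {f : T → ∀ s, Y s} (x y : Im f)
    (h : ∀ s, x.val s = y.val s) : x = y :=
  (equivShrink _).symm.injective (Subtype.ext (funext h))

theorem Im.exists_rep {T : Type} {Y : S → Type} {f : T → ∀ s, Y s} (x : Im f) :
    ∃ t, ∀ s, x.val s = f t s := by
  obtain ⟨t, ht⟩ := ((equivShrink _).symm x).2
  exact ⟨t, fun s => (congrFun ht s).symm⟩

theorem Im.exists_val {T : Type} {Y : S → Type} (f : T → ∀ s, Y s) (t : T) :
    ∃ x : Im f, ∀ s, x.val s = f t s :=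
  ⟨equivShrink _ ⟨f t, t, rfl⟩, fun s => by simp [Im.val]⟩

/-- The four sorts of cells of the generated double category. -/
abbrev GSq := Im (Tm.eval g)
/-- See `GSq`. -/
abbrev GHor := Im fun (t : Tm X) s => (D s).sqv.src (t.eval g s)
/-- See `GSq`. -/
abbrev GVer := Im fun (t : Tm X) s => (D s).sqh.src (t.eval g s)
/-- See `GSq`. -/
abbrev GOb := Im fun (t : Tm X) s => (D s).hor.src ((D s).sqv.src (t.eval g s))

theorem corner (A : DblCat.{u}) (x : A.Sq) :
    A.ver.src (A.sqh.src x) = A.hor.src (A.sqv.src x) := (A.isFun_left.src x)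

theorem closed_hor : CatOn.Closed (fun s => (D s).hor) (Im.val : GOb g → _)
    (Im.val : GHor g → _) where
  inj₀ := Im.inj
  inj₁ := Im.inj
  src f := by
    obtain ⟨t, ht⟩ := f.exists_rep
    obtain ⟨a, ha⟩ := Im.exists_val (fun (t : Tm X) s => (D s).hor.src ((D s).sqv.src (t.eval g s))) t
    exact ⟨a, fun s => by rw [ha, ht]⟩
  tgt f := by
    obtain ⟨t, ht⟩ := f.exists_rep
    obtain ⟨a, ha⟩ := Im.exists_val (fun (t : Tm X) s => (D s).hor.src ((D s).sqv.src (t.eval g s)))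
      t.right
    refine ⟨a, fun s => ?_⟩
    rw [ha, ht, ← corner]
    simp only [Tm.eval, CatOn.src_id]
    rw [(D s).isFun_right.src]
  id a := by
    obtain ⟨t, ht⟩ := a.exists_rep
    obtain ⟨a, ha⟩ := Im.exists_val (fun (t : Tm X) s => (D s).sqv.src (t.eval g s)) t.left
    refine ⟨a, fun s => ?_⟩
    rw [ha, ht, ← corner]
    simp [Tm.eval, (D s).isFun_idv.src]
  comp f f' h := by
    obtain ⟨t, ht⟩ := f.exists_rep
    obtain ⟨t', ht'⟩ := f'.exists_rep
    obtain ⟨a, ha⟩ := Im.exists_val (fun (t : Tm X) s => (D s).sqv.src (t.eval g s))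
      (t.top.hcomp t'.top)
    refine ⟨a, fun s => ?_⟩
    rw [ha, ht, ht']
    have h' : ∀ s, (D s).sqh.tgt (t.top.eval g s) = (D s).sqh.src (t'.top.eval g s) := fun s => by
      have := h s
      rw [ht, ht'] at this
      simp only [Tm.eval]
      rw [(D s).isFun_idh.tgt, (D s).isFun_idh.src, this]
    rw [Tm.eval, if_pos h', (D s).isFun_top.comp _ _ (h' s)]
    simp only [Tm.eval, CatOn.src_id]

theorem closed_ver : CatOn.Closed (fun s => (D s).ver) (Im.val : GOb g → _)
    (Im.val : GVer g → _) where
  inj₀ := Im.inj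
  inj₁ := Im.inj
  src f := by
    obtain ⟨t, ht⟩ := f.exists_rep
    obtain ⟨a, ha⟩ := Im.exists_val (fun (t : Tm X) s => (D s).hor.src ((D s).sqv.src (t.eval g s))) t
    exact ⟨a, fun s => by rw [ha, ht, corner]⟩
  tgt f := by
    obtain ⟨t, ht⟩ := f.exists_rep
    obtain ⟨a, ha⟩ := Im.exists_val (fun (t : Tm X) s => (D s).hor.src ((D s).sqv.src (t.eval g s)))
      t.bot
    refine ⟨a, fun s => ?_⟩
    rw [ha, ht, (D s).isFun_left.tgt]
    simp [Tm.eval, CatOn.src_id]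
  id a := by
    obtain ⟨t, ht⟩ := a.exists_rep
    obtain ⟨a, ha⟩ := Im.exists_val (fun (t : Tm X) s => (D s).sqh.src (t.eval g s)) t.top
    refine ⟨a, fun s => ?_⟩
    rw [ha, ht]
    simp [Tm.eval, (D s).isFun_idh.src]
  comp f f' h := by
    obtain ⟨t, ht⟩ := f.exists_rep
    obtain ⟨t', ht'⟩ := f'.exists_rep
    obtain ⟨a, ha⟩ := Im.exists_val (fun (t : Tm X) s => (D s).sqh.src (t.eval g s))
      (t.left.vcomp t'.left)
    refine ⟨a, fun s => ?_⟩
    rw [ha, ht, ht']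
    have h' : ∀ s, (D s).sqv.tgt (t.left.eval g s) = (D s).sqv.src (t'.left.eval g s) := fun s => by
      have := h s
      rw [ht, ht'] at this
      simp only [Tm.eval]
      rw [(D s).isFun_idv.tgt, (D s).isFun_idv.src, this]
    rw [Tm.eval, if_pos h', (D s).isFun_left.comp _ _ (h' s)]
    simp only [Tm.eval, CatOn.src_id]

theorem closed_sqh : CatOn.Closed (fun s => (D s).sqh) (Im.val : GVer g → _)
    (Im.val : GSq g → _) where
  inj₀ := Im.inj
  inj₁ := Im.inj
  src f := by
    obtain ⟨t, ht⟩ := f.exists_rep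
    obtain ⟨a, ha⟩ := Im.exists_val (fun (t : Tm X) s => (D s).sqh.src (t.eval g s)) t
    exact ⟨a, fun s => by rw [ha, ht]⟩
  tgt f := by
    obtain ⟨t, ht⟩ := f.exists_rep
    obtain ⟨a, ha⟩ := Im.exists_val (fun (t : Tm X) s => (D s).sqh.src (t.eval g s)) t.right
    exact ⟨a, fun s => by rw [ha, ht]; simp [Tm.eval, CatOn.src_id]⟩
  id a := by
    obtain ⟨t, ht⟩ := a.exists_rep
    obtain ⟨a, ha⟩ := Im.exists_val (Tm.eval g) t.left
    exact ⟨a, fun s => by rw [ha, ht]; simp [Tm.eval]⟩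
  comp f f' h := by
    obtain ⟨t, ht⟩ := f.exists_rep
    obtain ⟨t', ht'⟩ := f'.exists_rep
    obtain ⟨a, ha⟩ := Im.exists_val (Tm.eval g) (t.hcomp t')
    simp only [ht, ht'] at h
    exact ⟨a, fun s => by rw [ha, ht, ht', Tm.eval, if_pos h]⟩

theorem closed_sqv : CatOn.Closed (fun s => (D s).sqv) (Im.val : GHor g → _)
    (Im.val : GSq g → _) where
  inj₀ := Im.inj
  inj₁ := Im.inj
  src f := by
    obtain ⟨t, ht⟩ := f.exists_rep
    obtain ⟨a, ha⟩ := Im.exists_val (fun (t : Tm X) s => (D s).sqv.src (t.eval g s)) t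
    exact ⟨a, fun s => by rw [ha, ht]⟩
  tgt f := by
    obtain ⟨t, ht⟩ := f.exists_rep
    obtain ⟨a, ha⟩ := Im.exists_val (fun (t : Tm X) s => (D s).sqv.src (t.eval g s)) t.bot
    exact ⟨a, fun s => by rw [ha, ht]; simp [Tm.eval, CatOn.src_id]⟩
  id a := by
    obtain ⟨t, ht⟩ := a.exists_rep
    obtain ⟨a, ha⟩ := Im.exists_val (Tm.eval g) t.top
    exact ⟨a, fun s => by rw [ha, ht]; simp [Tm.eval]⟩
  comp f f' h := by
    obtain ⟨t, ht⟩ := f.exists_rep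
    obtain ⟨t', ht'⟩ := f'.exists_rep
    obtain ⟨a, ha⟩ := Im.exists_val (Tm.eval g) (t.vcomp t')
    simp only [ht, ht'] at h
    exact ⟨a, fun s => by rw [ha, ht, ht', Tm.eval, if_pos h]⟩

theorem gen_top : (closed_sqh g).cat.IsFun (closed_hor g).cat (closed_ver g).cat.src (closed_sqv g).cat.src :=
  .of_inj (closed_sqh g).isFun (closed_hor g).isFun (fun s => (D s).isFun_top) Im.inj Im.inj
    (fun s a => Eq.symm (((closed_ver g).isFun s).src a)) (fun s a => Eq.symm (((closed_sqv g).isFun s).src a))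

theorem gen_bot : (closed_sqh g).cat.IsFun (closed_hor g).cat (closed_ver g).cat.tgt (closed_sqv g).cat.tgt :=
  .of_inj (closed_sqh g).isFun (closed_hor g).isFun (fun s => (D s).isFun_bot) Im.inj Im.inj
    (fun s a => Eq.symm (((closed_ver g).isFun s).tgt a)) (fun s a => Eq.symm (((closed_sqv g).isFun s).tgt a))

theorem gen_idh : (closed_hor g).cat.IsFun (closed_sqh g).cat (closed_ver g).cat.id (closed_sqv g).cat.id :=
  .of_inj (closed_hor g).isFun (closed_sqh g).isFun (fun s => (D s).isFun_idh) Im.inj Im.inj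
    (fun s a => (((closed_ver g).isFun s).id a)) (fun s a => (((closed_sqv g).isFun s).id a))

theorem gen_left : (closed_sqv g).cat.IsFun (closed_ver g).cat (closed_hor g).cat.src (closed_sqh g).cat.src :=
  .of_inj (closed_sqv g).isFun (closed_ver g).isFun (fun s => (D s).isFun_left) Im.inj Im.inj
    (fun s a => Eq.symm (((closed_hor g).isFun s).src a)) (fun s a => Eq.symm (((closed_sqh g).isFun s).src a))

theorem gen_right : (closed_sqv g).cat.IsFun (closed_ver g).cat (closed_hor g).cat.tgt (closed_sqh g).cat.tgt :=
  .of_inj (closed_sqv g).isFun (closed_ver g).isFun (fun s => (D s).isFun_right) Im.inj Im.inj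
    (fun s a => Eq.symm (((closed_hor g).isFun s).tgt a)) (fun s a => Eq.symm (((closed_sqh g).isFun s).tgt a))

theorem gen_idv : (closed_ver g).cat.IsFun (closed_sqv g).cat (closed_hor g).cat.id (closed_sqh g).cat.id :=
  .of_inj (closed_ver g).isFun (closed_sqv g).isFun (fun s => (D s).isFun_idv) Im.inj Im.inj
    (fun s a => (((closed_hor g).isFun s).id a)) (fun s a => (((closed_sqh g).isFun s).id a))

/-- The double category generated by a family of squares in a product of double categories. -/
noncomputable def generated : DblCat.{0} where
  Ob := GOb g
  Hor := GHor g
  Ver := GVer g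
  Sq := GSq g
  hor := (closed_hor g).cat
  ver := (closed_ver g).cat
  sqh := (closed_sqh g).cat
  sqv := (closed_sqv g).cat
  isFun_top := gen_top g
  isFun_bot := gen_bot g
  isFun_idh := gen_idh g
  isFun_left := gen_left g
  isFun_right := gen_right g
  isFun_idv := gen_idv g
  interchange α β γ δ h₁ h₂ h₃ h₄ := Im.inj _ _ fun s => by
    have Fh := (closed_sqh g).isFun s
    have Fv := (closed_sqv g).isFun s
    have e₁ := Fh.comp ((closed_sqv g).cat.comp α β) ((closed_sqv g).cat.comp γ δ) (by
      rw [(gen_right g).comp _ _ h₁, (gen_left g).comp _ _ h₂, h₃, h₄])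
    have e₂ := Fv.comp ((closed_sqh g).cat.comp α γ) ((closed_sqh g).cat.comp β δ) (by
      rw [(gen_bot g).comp _ _ h₃, (gen_top g).comp _ _ h₄, h₁, h₂])
    rw [Fv.comp _ _ h₁, Fv.comp _ _ h₂] at e₁
    rw [Fh.comp _ _ h₃, Fh.comp _ _ h₄] at e₂
    refine e₁.trans (Eq.trans ?_ e₂.symm)
    apply (D s).interchange
    · rw [Fv.tgt, Fv.src, h₁]
    · rw [Fv.tgt, Fv.src, h₂]
    · rw [Fh.tgt, Fh.src, h₃]
    · rw [Fh.tgt, Fh.src, h₄]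

/-- The projections. -/
noncomputable def proj (s : S) : generated g ⟶ D s :=
  ⟨fun a => a.val s, fun a => a.val s, fun a => a.val s, fun a => a.val s, (closed_hor g).isFun s,
    (closed_ver g).isFun s, (closed_sqh g).isFun s, (closed_sqv g).isFun s⟩

end

theorem hom_ext {A B : DblCat.{u}} (F G : A ⟶ B) (h : ∀ x, F.sq x = G.sq x) : F = G := by
  have hh : ∀ x, F.horm x = G.horm x := fun x => by
    rw [← A.sqv.src_id x, ← F.isFun_sqv.src, ← G.isFun_sqv.src, h]
  have hv : ∀ x, F.verm x = G.verm x := fun x => by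
    rw [← A.sqh.src_id x, ← F.isFun_sqh.src, ← G.isFun_sqh.src, h]
  have ho : ∀ x, F.ob x = G.ob x := fun x => by
    rw [← A.hor.src_id x, ← F.isFun_hor.src, ← G.isFun_hor.src, hh]
  exact DblFunctor.ext (funext ho) (funext hh) (funext hv) (funext h)

/-- Joint injectivity, and joint reflection of invertible squares (in both directions). -/
structure Emb {S : Type w} {E : DblCat.{u}} {D : S → DblCat.{u}} (p : ∀ s, E ⟶ D s) : Prop where
  inj : ∀ x y, (∀ s, (p s).sq x = (p s).sq y) → x = y
  hinv : ∀ x, (∀ s, (D s).sqh.IsInv ((p s).sq x)) → E.sqh.IsInv x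
  vinv : ∀ x, (∀ s, (D s).sqv.IsInv ((p s).sq x)) → E.sqv.IsInv x

end DblCat

theorem CatOn.inv_unique {O : Type u} {M : Type v} {C : CatOn O M} {f g g' : M}
    (h₂ : C.comp g f = C.id (C.tgt f)) (h₃ : C.src g' = C.tgt f)
    (h₄ : C.comp f g' = C.id (C.src f)) (h₅ : C.tgt g = C.src f) : g = g' := by
  rw [← C.comp_id g, h₅, ← h₄, ← C.assoc _ _ _ h₅ h₃.symm, h₂, ← h₃, C.id_comp]

theorem CatOn.IsFun.isInv {O M O' M' : Type*} {C : CatOn O M} {C' : CatOn O' M'} {F₀ : O → O'}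
    {F₁ : M → M'} (F : C.IsFun C' F₀ F₁) {f : M} (h : C.IsInv f) : C'.IsInv (F₁ f) := by
  obtain ⟨g, h₁, h₂, h₃, h₄⟩ := h
  refine ⟨F₁ g, by rw [F.src, F.tgt, h₁], by rw [F.tgt, F.src, h₂], ?_, ?_⟩
  · rw [← F.comp _ _ h₁.symm, h₃, F.id, F.src]
  · rw [← F.comp _ _ h₂, h₄, F.id, F.tgt]

/-- Reflection of invertibility along jointly injective families that contain the inverses. -/
theorem CatOn.isInv_of_inj {S : Type*} {O' M' : Type*} {O M : S → Type*} {C : CatOn O' M'}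
    {D : ∀ s, CatOn (O s) (M s)} {j₀ : ∀ s, O' → O s} {j₁ : ∀ s, M' → M s}
    (hj : ∀ s, C.IsFun (D s) (j₀ s) (j₁ s)) (i₀ : ∀ a b, (∀ s, j₀ s a = j₀ s b) → a = b)
    (i₁ : ∀ a b, (∀ s, j₁ s a = j₁ s b) → a = b) (f g : M')
    (h : ∀ s, (D s).src (j₁ s g) = (D s).tgt (j₁ s f) ∧ (D s).tgt (j₁ s g) = (D s).src (j₁ s f) ∧
      (D s).comp (j₁ s f) (j₁ s g) = (D s).id ((D s).src (j₁ s f)) ∧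
      (D s).comp (j₁ s g) (j₁ s f) = (D s).id ((D s).tgt (j₁ s f))) :
    C.src g = C.tgt f ∧ C.tgt g = C.src f ∧
      C.comp f g = C.id (C.src f) ∧ C.comp g f = C.id (C.tgt f) := by
  have h₁ : C.src g = C.tgt f := i₀ _ _ fun s => by
    rw [← (hj s).src, ← (hj s).tgt, (h s).1]
  have h₂ : C.tgt g = C.src f := i₀ _ _ fun s => by
    rw [← (hj s).src, ← (hj s).tgt, (h s).2.1]
  refine ⟨h₁, h₂, i₁ _ _ fun s => ?_, i₁ _ _ fun s => ?_⟩
  · rw [(hj s).comp _ _ h₁.symm, (hj s).id, ← (hj s).src, (h s).2.2.1]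
  · rw [(hj s).comp _ _ h₂, (hj s).id, ← (hj s).tgt, (h s).2.2.2]

namespace DblCat

theorem generated_inv {X : Type} {S : Type 1} {D : S → DblCat.{0}} (g : ∀ s, X → (D s).Sq)
    (x : (generated g).Sq) :
    (∀ h : (∀ s, (D s).sqh.IsInv ((proj g s).sq x)), ∃ y, (∀ s, (proj g s).sq y = (h s).choose)) ∧
    (∀ h : (∀ s, (D s).sqv.IsInv ((proj g s).sq x)), ∃ y, (∀ s, (proj g s).sq y = (h s).choose)) := by
  obtain ⟨t, ht⟩ := Im.exists_rep x
  constructor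
  all_goals
    intro h
    have ht' : (fun s => (proj g s).sq x) = t.eval g := funext ht
  · obtain ⟨y, hy⟩ := Im.exists_val (Tm.eval g) t.hinv
    refine ⟨y, fun s => (hy s).trans ?_⟩
    have h' : ∀ s, (D s).sqh.IsInv (t.eval g s) := fun s => ht s ▸ h s
    simp only [Tm.eval, dif_pos h']
    have : (proj g s).sq x = t.eval g s := ht s
    simp only [this]
  · obtain ⟨y, hy⟩ := Im.exists_val (Tm.eval g) t.vinv
    refine ⟨y, fun s => (hy s).trans ?_⟩
    have h' : ∀ s, (D s).sqv.IsInv (t.eval g s) := fun s => ht s ▸ h s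
    simp only [Tm.eval, dif_pos h']
    have : (proj g s).sq x = t.eval g s := ht s
    simp only [this]

theorem generated_emb {X : Type} {S : Type 1} {D : S → DblCat.{0}} (g : ∀ s, X → (D s).Sq) :
    Emb (proj g) where
  inj := Im.inj
  hinv x h := by
    obtain ⟨y, hy⟩ := (generated_inv g x).1 h
    refine ⟨y, CatOn.isInv_of_inj (fun s => (proj g s).isFun_sqh) Im.inj Im.inj _ _ fun s => ?_⟩
    rw [hy]
    exact (h s).choose_spec
  vinv x h := by
    obtain ⟨y, hy⟩ := (generated_inv g x).2 h
    refine ⟨y, CatOn.isInv_of_inj (fun s => (proj g s).isFun_sqv) Im.inj Im.inj _ _ fun s => ?_⟩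
    rw [hy]
    exact (h s).choose_spec

theorem generated_ext {X : Type} {S : Type 1} {D : S → DblCat.{0}} (g : ∀ s, X → (D s).Sq)
    {B : DblCat.{0}} (F G : generated g ⟶ B)
    (h : ∀ (y : (generated g).Sq) (x : X), (∀ s, (proj g s).sq y = g s x) → F.sq y = G.sq y) :
    F = G := by
  suffices H : ∀ (t : Tm X) (y : (generated g).Sq), (∀ s, (proj g s).sq y = t.eval g s) →
      F.sq y = G.sq y by
    refine hom_ext _ _ fun y => ?_
    obtain ⟨t, ht⟩ := Im.exists_rep y
    exact H t y ht
  have emb := generated_emb g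
  have rep : ∀ t : Tm X, ∃ y : (generated g).Sq, ∀ s, (proj g s).sq y = t.eval g s :=
    fun t => Im.exists_val (Tm.eval g) t
  intro t
  induction t with
  | gen x => exact fun y hy => h y x hy
  | top t ih =>
    intro y hy
    obtain ⟨z, hz⟩ := rep t
    have : y = (generated g).sqv.id ((generated g).sqv.src z) := emb.inj _ _ fun s => by
      rw [hy, (proj g s).isFun_sqv.id, ← (proj g s).isFun_sqv.src, hz]; rfl
    rw [this, F.isFun_sqv.id, G.isFun_sqv.id, ← F.isFun_sqv.src, ← G.isFun_sqv.src, ih z hz]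
  | bot t ih =>
    intro y hy
    obtain ⟨z, hz⟩ := rep t
    have : y = (generated g).sqv.id ((generated g).sqv.tgt z) := emb.inj _ _ fun s => by
      rw [hy, (proj g s).isFun_sqv.id, ← (proj g s).isFun_sqv.tgt, hz]; rfl
    rw [this, F.isFun_sqv.id, G.isFun_sqv.id, ← F.isFun_sqv.tgt, ← G.isFun_sqv.tgt, ih z hz]
  | left t ih =>
    intro y hy
    obtain ⟨z, hz⟩ := rep t
    have : y = (generated g).sqh.id ((generated g).sqh.src z) := emb.inj _ _ fun s => by
      rw [hy, (proj g s).isFun_sqh.id, ← (proj g s).isFun_sqh.src, hz]; rfl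
    rw [this, F.isFun_sqh.id, G.isFun_sqh.id, ← F.isFun_sqh.src, ← G.isFun_sqh.src, ih z hz]
  | right t ih =>
    intro y hy
    obtain ⟨z, hz⟩ := rep t
    have : y = (generated g).sqh.id ((generated g).sqh.tgt z) := emb.inj _ _ fun s => by
      rw [hy, (proj g s).isFun_sqh.id, ← (proj g s).isFun_sqh.tgt, hz]; rfl
    rw [this, F.isFun_sqh.id, G.isFun_sqh.id, ← F.isFun_sqh.tgt, ← G.isFun_sqh.tgt, ih z hz]
  | hcomp t t' ih ih' =>
    intro y hy
    obtain ⟨z, hz⟩ := rep t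
    obtain ⟨z', hz'⟩ := rep t'
    by_cases h' : ∀ s, (D s).sqh.tgt (t.eval g s) = (D s).sqh.src (t'.eval g s)
    · have hc : (generated g).sqh.tgt z = (generated g).sqh.src z' := by
        refine Im.inj _ _ fun s => ?_
        refine ((proj g s).isFun_sqh.tgt z).symm.trans (Eq.trans ?_ ((proj g s).isFun_sqh.src z'))
        rw [hz, hz', h']
      have : y = (generated g).sqh.comp z z' := emb.inj _ _ fun s => by
        rw [hy, (proj g s).isFun_sqh.comp _ _ hc, hz, hz', Tm.eval, if_pos h']
      rw [this, F.isFun_sqh.comp _ _ hc, G.isFun_sqh.comp _ _ hc, ih z hz, ih' z' hz']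
    · exact ih y fun s => by rw [hy, Tm.eval, if_neg h']
  | vcomp t t' ih ih' =>
    intro y hy
    obtain ⟨z, hz⟩ := rep t
    obtain ⟨z', hz'⟩ := rep t'
    by_cases h' : ∀ s, (D s).sqv.tgt (t.eval g s) = (D s).sqv.src (t'.eval g s)
    · have hc : (generated g).sqv.tgt z = (generated g).sqv.src z' := by
        refine Im.inj _ _ fun s => ?_
        refine ((proj g s).isFun_sqv.tgt z).symm.trans (Eq.trans ?_ ((proj g s).isFun_sqv.src z'))
        rw [hz, hz', h']
      have : y = (generated g).sqv.comp z z' := emb.inj _ _ fun s => by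
        rw [hy, (proj g s).isFun_sqv.comp _ _ hc, hz, hz', Tm.eval, if_pos h']
      rw [this, F.isFun_sqv.comp _ _ hc, G.isFun_sqv.comp _ _ hc, ih z hz, ih' z' hz']
    · exact ih y fun s => by rw [hy, Tm.eval, if_neg h']
  | hinv t ih =>
    intro y hy
    obtain ⟨z, hz⟩ := rep t
    by_cases h' : ∀ s, (D s).sqh.IsInv (t.eval g s)
    · obtain ⟨h₁, h₂, h₃, h₄⟩ := CatOn.isInv_of_inj (C := (generated g).sqh)
        (fun s => (proj g s).isFun_sqh) Im.inj Im.inj z y fun s => by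
          rw [hy, hz, Tm.eval, dif_pos h']; exact (h' s).choose_spec
      have e := ih z hz
      refine CatOn.inv_unique (C := B.sqh) (f := F.sq z) ?_ ?_ ?_ ?_
      · rw [← F.isFun_sqh.comp _ _ h₂, h₄, F.isFun_sqh.id, F.isFun_sqh.tgt]
      · rw [e, G.isFun_sqh.src, G.isFun_sqh.tgt, h₁]
      · rw [e, ← G.isFun_sqh.comp _ _ h₁.symm, h₃, G.isFun_sqh.id, G.isFun_sqh.src]
      · rw [F.isFun_sqh.src, F.isFun_sqh.tgt, h₂]
    · exact ih y fun s => by rw [hy, Tm.eval, dif_neg h']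
  | vinv t ih =>
    intro y hy
    obtain ⟨z, hz⟩ := rep t
    by_cases h' : ∀ s, (D s).sqv.IsInv (t.eval g s)
    · obtain ⟨h₁, h₂, h₃, h₄⟩ := CatOn.isInv_of_inj (C := (generated g).sqv)
        (fun s => (proj g s).isFun_sqv) Im.inj Im.inj z y fun s => by
          rw [hy, hz, Tm.eval, dif_pos h']; exact (h' s).choose_spec
      have e := ih z hz
      refine CatOn.inv_unique (C := B.sqv) (f := F.sq z) ?_ ?_ ?_ ?_
      · rw [← F.isFun_sqv.comp _ _ h₂, h₄, F.isFun_sqv.id, F.isFun_sqv.tgt]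
      · rw [e, G.isFun_sqv.src, G.isFun_sqv.tgt, h₁]
      · rw [e, ← G.isFun_sqv.comp _ _ h₁.symm, h₃, G.isFun_sqv.id, G.isFun_sqv.src]
      · rw [F.isFun_sqv.src, F.isFun_sqv.tgt, h₂]
    · exact ih y fun s => by rw [hy, Tm.eval, dif_neg h']

end DblCat

namespace DblCat

theorem inj_cells {S : Type w} {E : DblCat.{u}} {D : S → DblCat.{u}} {p : ∀ s, E ⟶ D s}
    (inj : ∀ x y, (∀ s, (p s).sq x = (p s).sq y) → x = y) :
    (∀ x y, (∀ s, (p s).horm x = (p s).horm y) → x = y) ∧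
    (∀ x y, (∀ s, (p s).verm x = (p s).verm y) → x = y) ∧
    (∀ x y, (∀ s, (p s).ob x = (p s).ob y) → x = y) := by
  have h₁ : ∀ x y, (∀ s, (p s).horm x = (p s).horm y) → x = y := fun x y h => by
    rw [← E.sqv.src_id x, ← E.sqv.src_id y,
      inj (E.sqv.id x) (E.sqv.id y) fun s => by simp [(p s).isFun_sqv.id, h]]
  refine ⟨h₁, fun x y h => ?_, fun x y h => ?_⟩
  · rw [← E.sqh.src_id x, ← E.sqh.src_id y,
      inj (E.sqh.id x) (E.sqh.id y) fun s => by simp [(p s).isFun_sqh.id, h]]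
  · rw [← E.hor.src_id x, ← E.hor.src_id y,
      h₁ (E.hor.id x) (E.hor.id y) fun s => by simp [(p s).isFun_hor.id, h]]

theorem exists_lift {S : Type w} {A E : DblCat.{u}} {D : S → DblCat.{u}} (p : ∀ s, E ⟶ D s)
    (inj : ∀ x y, (∀ s, (p s).sq x = (p s).sq y) → x = y) (h : ∀ s, A ⟶ D s)
    (k : A.Sq → E.Sq) (hk : ∀ s x, (p s).sq (k x) = (h s).sq x) :
    ∃ F : A ⟶ E, ∀ x, F.sq x = k x := by
  obtain ⟨ih, iv, io⟩ := inj_cells inj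
  have hh : ∀ s x, (p s).horm (E.sqv.src (k (A.sqv.id x))) = (h s).horm x := fun s x => by
    rw [← (p s).isFun_sqv.src, hk, (h s).isFun_sqv.src, A.sqv.src_id]
  have hv : ∀ s x, (p s).verm (E.sqh.src (k (A.sqh.id x))) = (h s).verm x := fun s x => by
    rw [← (p s).isFun_sqh.src, hk, (h s).isFun_sqh.src, A.sqh.src_id]
  have ho : ∀ s x, (p s).ob (E.hor.src (E.sqv.src (k (A.sqv.id (A.hor.id x))))) = (h s).ob x :=
    fun s x => by rw [← (p s).isFun_hor.src, hh, (h s).isFun_hor.src, A.hor.src_id]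
  exact ⟨⟨_, _, _, k,
    .of_inj (fun s => (h s).isFun_hor) (fun s => (p s).isFun_hor) (fun s => .refl _) io ih ho hh,
    .of_inj (fun s => (h s).isFun_ver) (fun s => (p s).isFun_ver) (fun s => .refl _) io iv ho hv,
    .of_inj (fun s => (h s).isFun_sqh) (fun s => (p s).isFun_sqh) (fun s => .refl _) iv inj hv hk,
    .of_inj (fun s => (h s).isFun_sqv) (fun s => (p s).isFun_sqv) (fun s => .refl _) ih inj hh hk⟩,
    fun _ => rfl⟩

instance : CellCategory DblCat.{0} where
  cell A := A.Sq
  cmap F := F.sq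
  cmap_id _ _ := rfl
  cmap_comp _ _ _ := rfl
  hom_ext := hom_ext
  Emb := Emb
  inj_of_emb _ h := h.inj
  lift := exists_lift
  gen X S D g := by
    choose e he using fun x => Im.exists_val (Tm.eval g) (.gen x)
    refine ⟨generated g, e, proj g, generated_emb g, fun s x => he x s, fun B F G h => ?_⟩
    refine generated_ext g F G fun y x hy => ?_
    rw [show y = e x from Im.inj _ _ fun s => (hy s).trans (he x s).symm]
    exact h x

/-- The 2-category given by a double category with only identity vertical morphisms. -/
def toTwo (E : DblCat.{u}) (hE : ∀ v, E.ver.id (E.ver.src v) = v) : TwoCat.{u} :=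
  have inj : ∀ {v w}, E.ver.src v = E.ver.src w → v = w := fun {v w} h => by rw [← hE v, h, hE]
  have st : ∀ v, E.ver.tgt v = E.ver.src v := fun v => by
    conv_lhs => rw [← hE v]
    rw [E.ver.tgt_id]
  { Ob := E.Ob
    Hom := E.Hor
    Cell := E.Sq
    one := E.hor
    hor :=
      { src := fun x => E.ver.src (E.sqh.src x)
        tgt := fun x => E.ver.src (E.sqh.tgt x)
        id := fun a => E.sqh.id (E.ver.id a)
        comp := E.sqh.comp
        src_id := fun a => by rw [E.sqh.src_id, E.ver.src_id]
        tgt_id := fun a => by rw [E.sqh.tgt_id, E.ver.src_id]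
        src_comp := fun f g h => by rw [E.sqh.src_comp _ _ (inj h)]
        tgt_comp := fun f g h => by rw [E.sqh.tgt_comp _ _ (inj h)]
        id_comp := fun f => by rw [hE, E.sqh.id_comp]
        comp_id := fun f => by rw [hE, E.sqh.comp_id]
        assoc := fun f g h p q => E.sqh.assoc _ _ _ (inj p) (inj q) }
    ver := E.sqv
    isFun_src := ⟨E.isFun_top.src, E.isFun_top.tgt,
      fun a => (E.isFun_top.id _).trans (congrArg _ (E.ver.src_id a)),
      fun f g h => E.isFun_top.comp _ _ (inj h)⟩
    isFun_tgt := ⟨fun x => (E.isFun_bot.src x).trans (st _),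
      fun x => (E.isFun_bot.tgt x).trans (st _),
      fun a => (E.isFun_bot.id _).trans (congrArg _ (E.ver.tgt_id a)),
      fun f g h => E.isFun_bot.comp _ _ (inj h)⟩
    isFun_id := ⟨fun f => (congrArg _ (E.isFun_idh.src f)).trans (E.ver.src_id _),
      fun f => (congrArg _ (E.isFun_idh.tgt f)).trans (E.ver.src_id _), E.isFun_idh.id,
      E.isFun_idh.comp⟩
    interchange := fun α β γ δ h₁ h₂ h₃ h₄ => E.interchange α β γ δ h₁ h₂ (inj h₃) (inj h₄) }

end DblCat

namespace TwoCat

theorem hom_ext {A B : TwoCat.{u}} (F G : A ⟶ B) (h : ∀ x, F.cell x = G.cell x) : F = G := by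
  have hh : ∀ x, F.hom x = G.hom x := fun x => by
    rw [← A.ver.src_id x, ← F.isFun_ver.src, ← G.isFun_ver.src, h]
  have ho : ∀ x, F.ob x = G.ob x := fun x => by
    rw [← A.one.src_id x, ← F.isFun_one.src, ← G.isFun_one.src, hh]
  exact TwoFunctor.ext (funext ho) (funext hh) (funext h)

/-- Joint injectivity, and joint reflection of invertible 2-cells. -/
structure Emb {S : Type w} {E : TwoCat.{u}} {D : S → TwoCat.{u}} (p : ∀ s, E ⟶ D s) : Prop where
  inj : ∀ x y, (∀ s, (p s).cell x = (p s).cell y) → x = y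
  inv : ∀ x, (∀ s, (D s).ver.IsInv ((p s).cell x)) → E.ver.IsInv x

theorem inj_cells {S : Type w} {E : TwoCat.{u}} {D : S → TwoCat.{u}} {p : ∀ s, E ⟶ D s}
    (inj : ∀ x y, (∀ s, (p s).cell x = (p s).cell y) → x = y) :
    (∀ x y, (∀ s, (p s).hom x = (p s).hom y) → x = y) ∧
    (∀ x y, (∀ s, (p s).ob x = (p s).ob y) → x = y) :=
  have h := DblCat.inj_cells (p := fun s => horEmb.map (p s)) inj
  ⟨h.1, h.2.2⟩

theorem exists_lift {S : Type w} {A E : TwoCat.{u}} {D : S → TwoCat.{u}} (p : ∀ s, E ⟶ D s)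
    (inj : ∀ x y, (∀ s, (p s).cell x = (p s).cell y) → x = y) (h : ∀ s, A ⟶ D s)
    (k : A.Cell → E.Cell) (hk : ∀ s x, (p s).cell (k x) = (h s).cell x) :
    ∃ F : A ⟶ E, ∀ x, F.cell x = k x := by
  obtain ⟨ih, io⟩ := inj_cells inj
  have hh : ∀ s x, (p s).hom (E.ver.src (k (A.ver.id x))) = (h s).hom x := fun s x => by
    rw [← (p s).isFun_ver.src, hk, (h s).isFun_ver.src, A.ver.src_id]
  have ho : ∀ s x, (p s).ob (E.one.src (E.ver.src (k (A.ver.id (A.one.id x))))) = (h s).ob x :=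
    fun s x => by rw [← (p s).isFun_one.src, hh, (h s).isFun_one.src, A.one.src_id]
  exact ⟨⟨_, _, k,
    .of_inj (fun s => (h s).isFun_one) (fun s => (p s).isFun_one) (fun s => .refl _) io ih ho hh,
    .of_inj (fun s => (h s).isFun_hor) (fun s => (p s).isFun_hor) (fun s => .refl _) io inj ho hk,
    .of_inj (fun s => (h s).isFun_ver) (fun s => (p s).isFun_ver) (fun s => .refl _) ih inj hh hk⟩,
    fun _ => rfl⟩

instance : CellCategory TwoCat.{0} where
  cell A := A.Cell
  cmap F := F.cell
  cmap_id _ _ := rfl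
  cmap_comp _ _ _ := rfl
  hom_ext := hom_ext
  Emb := Emb
  inj_of_emb _ h := h.inj
  lift := exists_lift
  gen X S D g := by
    let g' : ∀ s, X → (D s).toHor.Sq := g
    have emb := DblCat.generated_emb g'
    have hE : ∀ v, (DblCat.generated g').ver.id ((DblCat.generated g').ver.src v) = v := fun v =>
      (DblCat.inj_cells emb.inj).2.1 _ _ fun s => by
        rw [(DblCat.proj g' s).isFun_ver.id, ← (DblCat.proj g' s).isFun_ver.src]; rfl
    choose e he using fun x => DblCat.Im.exists_val (DblCat.Tm.eval g') (.gen x)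
    refine ⟨(DblCat.generated g').toTwo hE, e, fun s => ⟨(DblCat.proj g' s).ob,
      (DblCat.proj g' s).horm, (DblCat.proj g' s).sq, (DblCat.proj g' s).isFun_hor,
      ⟨fun f => ?_, fun f => ?_, fun a => ?_, fun f f' h => ?_⟩, (DblCat.proj g' s).isFun_sqv⟩,
      ⟨emb.inj, emb.vinv⟩, fun s x => he x s, fun B F G h => ?_⟩
    · exact ((DblCat.proj g' s).isFun_sqh.src f).trans
        ((DblCat.proj g' s).isFun_ver.src ((DblCat.generated g').sqh.src f))
    · exact ((DblCat.proj g' s).isFun_sqh.tgt f).trans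
        ((DblCat.proj g' s).isFun_ver.src ((DblCat.generated g').sqh.tgt f))
    · exact ((DblCat.proj g' s).isFun_sqh.id _).trans
        (congrArg _ ((DblCat.proj g' s).isFun_ver.id a))
    · exact (DblCat.proj g' s).isFun_sqh.comp f f' (by
        rw [← hE ((DblCat.generated g').sqh.tgt f), ← hE ((DblCat.generated g').sqh.src f')]
        exact congrArg _ h)
    · let lft : ((DblCat.generated g').toTwo hE ⟶ B) → (DblCat.generated g' ⟶ B.toHor) := fun F =>
        ⟨F.ob, F.hom, fun v => F.ob ((DblCat.generated g').ver.src v), F.cell, F.isFun_one,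
          ⟨fun _ => rfl, fun v => congrArg F.ob ?_, fun a => congrArg F.ob ?_, fun v v' h' => ?_⟩,
          ⟨F.isFun_hor.src, F.isFun_hor.tgt, fun v => ?_, fun f f' h' => ?_⟩,
          F.isFun_ver⟩
      · refine hom_ext _ _ fun y => congrArg (fun t => DblFunctor.sq t y) (?_ : lft F = lft G)
        refine DblCat.generated_ext g' _ _ fun y x hy => ?_
        rw [show y = e x from DblCat.Im.inj _ _ fun s => (hy s).trans (he x s).symm]
        exact h x
      · conv_rhs => rw [← hE v]
        exact ((DblCat.generated g').ver.tgt_id _).symm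
      · rw [(DblCat.generated g').ver.src_id]
      · rw [(DblCat.generated g').ver.src_comp _ _ h']; rfl
      · refine Eq.trans ?_ (F.isFun_hor.id _)
        exact congrArg (fun t => F.cell ((DblCat.generated g').sqh.id t)) (hE v).symm
      · exact F.isFun_hor.comp f f' (congrArg (DblCat.generated g').ver.src h')

end TwoCat

attribute [simp] CatOn.src_id CatOn.tgt_id CatOn.src_comp CatOn.tgt_comp CatOn.id_comp CatOn.comp_id

namespace DblCat

variable (B : DblCat.{u})

@[simp] theorem top_src (x) : B.hor.src (B.sqv.src x) = B.ver.src (B.sqh.src x) := B.isFun_top.src x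
@[simp] theorem top_tgt (x) : B.hor.tgt (B.sqv.src x) = B.ver.src (B.sqh.tgt x) := B.isFun_top.tgt x
@[simp] theorem top_id (x) : B.sqv.src (B.sqh.id x) = B.hor.id (B.ver.src x) := B.isFun_top.id x
@[simp] theorem top_comp (x y) (h : B.sqh.tgt x = B.sqh.src y) :
    B.sqv.src (B.sqh.comp x y) = B.hor.comp (B.sqv.src x) (B.sqv.src y) := B.isFun_top.comp x y h
@[simp] theorem bot_src (x) : B.hor.src (B.sqv.tgt x) = B.ver.tgt (B.sqh.src x) := B.isFun_bot.src x
@[simp] theorem bot_tgt (x) : B.hor.tgt (B.sqv.tgt x) = B.ver.tgt (B.sqh.tgt x) := B.isFun_bot.tgt x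
@[simp] theorem bot_id (x) : B.sqv.tgt (B.sqh.id x) = B.hor.id (B.ver.tgt x) := B.isFun_bot.id x
@[simp] theorem bot_comp (x y) (h : B.sqh.tgt x = B.sqh.src y) :
    B.sqv.tgt (B.sqh.comp x y) = B.hor.comp (B.sqv.tgt x) (B.sqv.tgt y) := B.isFun_bot.comp x y h
@[simp] theorem idh_src (x) : B.sqh.src (B.sqv.id x) = B.ver.id (B.hor.src x) := B.isFun_idh.src x
@[simp] theorem idh_tgt (x) : B.sqh.tgt (B.sqv.id x) = B.ver.id (B.hor.tgt x) := B.isFun_idh.tgt x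
@[simp] theorem idh_id (x) : B.sqv.id (B.hor.id x) = B.sqh.id (B.ver.id x) := B.isFun_idh.id x
@[simp] theorem idh_comp (x y) (h : B.hor.tgt x = B.hor.src y) :
    B.sqv.id (B.hor.comp x y) = B.sqh.comp (B.sqv.id x) (B.sqv.id y) := B.isFun_idh.comp x y h
@[simp] theorem left_id (x) : B.sqh.src (B.sqv.id x) = B.ver.id (B.hor.src x) := B.isFun_left.id x
@[simp] theorem left_comp (x y) (h : B.sqv.tgt x = B.sqv.src y) :
    B.sqh.src (B.sqv.comp x y) = B.ver.comp (B.sqh.src x) (B.sqh.src y) := B.isFun_left.comp x y h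
@[simp] theorem right_id (x) : B.sqh.tgt (B.sqv.id x) = B.ver.id (B.hor.tgt x) := B.isFun_right.id x
@[simp] theorem right_comp (x y) (h : B.sqv.tgt x = B.sqv.src y) :
    B.sqh.tgt (B.sqv.comp x y) = B.ver.comp (B.sqh.tgt x) (B.sqh.tgt y) := B.isFun_right.comp x y h
@[simp] theorem idv_src (x) : B.sqv.src (B.sqh.id x) = B.hor.id (B.ver.src x) := B.isFun_idv.src x
@[simp] theorem idv_tgt (x) : B.sqv.tgt (B.sqh.id x) = B.hor.id (B.ver.tgt x) := B.isFun_idv.tgt x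
@[simp] theorem idv_comp (x y) (h : B.ver.tgt x = B.ver.src y) :
    B.sqh.id (B.ver.comp x y) = B.sqv.comp (B.sqh.id x) (B.sqh.id y) := B.isFun_idv.comp x y h

end DblCat

namespace DblFunctor

variable {A B : DblCat.{u}} (F : A ⟶ B)

@[simp] theorem hor_src (x) : B.hor.src (DblFunctor.horm F x) = DblFunctor.ob F (A.hor.src x) := F.isFun_hor.src x
@[simp] theorem hor_tgt (x) : B.hor.tgt (DblFunctor.horm F x) = DblFunctor.ob F (A.hor.tgt x) := F.isFun_hor.tgt x
@[simp] theorem hor_id (x) : DblFunctor.horm F (A.hor.id x) = B.hor.id (DblFunctor.ob F x) := F.isFun_hor.id x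
@[simp] theorem hor_comp (x y) (h : A.hor.tgt x = A.hor.src y) :
    DblFunctor.horm F (A.hor.comp x y) = B.hor.comp (DblFunctor.horm F x) (DblFunctor.horm F y) := F.isFun_hor.comp x y h
@[simp] theorem ver_src (x) : B.ver.src (DblFunctor.verm F x) = DblFunctor.ob F (A.ver.src x) := F.isFun_ver.src x
@[simp] theorem ver_tgt (x) : B.ver.tgt (DblFunctor.verm F x) = DblFunctor.ob F (A.ver.tgt x) := F.isFun_ver.tgt x
@[simp] theorem ver_id (x) : DblFunctor.verm F (A.ver.id x) = B.ver.id (DblFunctor.ob F x) := F.isFun_ver.id x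
@[simp] theorem ver_comp (x y) (h : A.ver.tgt x = A.ver.src y) :
    DblFunctor.verm F (A.ver.comp x y) = B.ver.comp (DblFunctor.verm F x) (DblFunctor.verm F y) := F.isFun_ver.comp x y h
@[simp] theorem sqh_src (x) : B.sqh.src (DblFunctor.sq F x) = DblFunctor.verm F (A.sqh.src x) := F.isFun_sqh.src x
@[simp] theorem sqh_tgt (x) : B.sqh.tgt (DblFunctor.sq F x) = DblFunctor.verm F (A.sqh.tgt x) := F.isFun_sqh.tgt x
@[simp] theorem sqh_id (x) : DblFunctor.sq F (A.sqh.id x) = B.sqh.id (DblFunctor.verm F x) := F.isFun_sqh.id x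
@[simp] theorem sqh_comp (x y) (h : A.sqh.tgt x = A.sqh.src y) :
    DblFunctor.sq F (A.sqh.comp x y) = B.sqh.comp (DblFunctor.sq F x) (DblFunctor.sq F y) := F.isFun_sqh.comp x y h
@[simp] theorem sqv_src (x) : B.sqv.src (DblFunctor.sq F x) = DblFunctor.horm F (A.sqv.src x) := F.isFun_sqv.src x
@[simp] theorem sqv_tgt (x) : B.sqv.tgt (DblFunctor.sq F x) = DblFunctor.horm F (A.sqv.tgt x) := F.isFun_sqv.tgt x
@[simp] theorem sqv_id (x) : DblFunctor.sq F (A.sqv.id x) = B.sqv.id (DblFunctor.horm F x) := F.isFun_sqv.id x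
@[simp] theorem sqv_comp (x y) (h : A.sqv.tgt x = A.sqv.src y) :
    DblFunctor.sq F (A.sqv.comp x y) = B.sqv.comp (DblFunctor.sq F x) (DblFunctor.sq F y) := F.isFun_sqv.comp x y h

end DblFunctor

/-- A horizontal pseudonatural transformation between double functors. -/
@[ext]
structure HorTrans (A B : DblCat.{u}) where
  dom : A ⟶ B
  cod : A ⟶ B
  app : A.Ob → B.Hor
  appV : A.Ver → B.Sq
  nat : A.Hor → B.Sq
  app_src : ∀ a, B.hor.src (app a) = dom.ob a
  app_tgt : ∀ a, B.hor.tgt (app a) = cod.ob a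
  isFun_appV : A.ver.IsFun B.sqv app appV
  appV_left : ∀ u, B.sqh.src (appV u) = dom.verm u
  appV_right : ∀ u, B.sqh.tgt (appV u) = cod.verm u
  nat_top : ∀ h, B.sqv.src (nat h) = B.hor.comp (dom.horm h) (app (A.hor.tgt h))
  nat_bot : ∀ h, B.sqv.tgt (nat h) = B.hor.comp (app (A.hor.src h)) (cod.horm h)
  nat_left : ∀ h, B.sqh.src (nat h) = B.ver.id (dom.ob (A.hor.src h))
  nat_right : ∀ h, B.sqh.tgt (nat h) = B.ver.id (cod.ob (A.hor.tgt h))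
  nat_inv : ∀ h, B.sqv.IsInv (nat h)
  nat_id : ∀ a, nat (A.hor.id a) = B.sqv.id (app a)
  nat_comp : ∀ h k, A.hor.tgt h = A.hor.src k → nat (A.hor.comp h k) =
    B.sqv.comp (B.sqh.comp (B.sqv.id (dom.horm h)) (nat k))
      (B.sqh.comp (nat h) (B.sqv.id (cod.horm k)))
  natural : ∀ x,
    B.sqv.comp (B.sqh.comp (dom.sq x) (appV (A.sqh.tgt x))) (nat (A.sqv.tgt x)) =
      B.sqv.comp (nat (A.sqv.src x)) (B.sqh.comp (appV (A.sqh.src x)) (cod.sq x))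

attribute [simp] HorTrans.app_src HorTrans.app_tgt HorTrans.appV_left HorTrans.appV_right
  HorTrans.nat_top HorTrans.nat_bot HorTrans.nat_left HorTrans.nat_right HorTrans.nat_id

namespace HorTrans

variable {A B : DblCat.{u}} (x y : HorTrans A B)

@[simp] theorem appV_top (u) : B.sqv.src (x.appV u) = x.app (A.ver.src u) := x.isFun_appV.src u
@[simp] theorem appV_bot (u) : B.sqv.tgt (x.appV u) = x.app (A.ver.tgt u) := x.isFun_appV.tgt u
@[simp] theorem appV_id (a) : x.appV (A.ver.id a) = B.sqv.id (x.app a) := x.isFun_appV.id a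

@[simp] theorem _root_.CatOn.id_id {O M : Type*} (C : CatOn O M) (a) : C.comp (C.id a) (C.id a) = C.id a := by
  simpa using C.id_comp (C.id a)

theorem _root_.DblCat.wl_comp (B : DblCat.{u}) (f : B.Hor) (a b : B.Sq) (h : B.sqv.tgt a = B.sqv.src b)
    (h₁ : B.sqh.src a = B.ver.id (B.hor.tgt f)) (h₂ : B.sqh.src b = B.ver.id (B.hor.tgt f)) :
    B.sqh.comp (B.sqv.id f) (B.sqv.comp a b) =
      B.sqv.comp (B.sqh.comp (B.sqv.id f) a) (B.sqh.comp (B.sqv.id f) b) := by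
  rw [← B.interchange _ _ _ _ (by simp) h (by simp [h₁]) (by simp [h₂]), B.sqv.id_id]

theorem _root_.DblCat.wr_comp (B : DblCat.{u}) (f : B.Hor) (a b : B.Sq) (h : B.sqv.tgt a = B.sqv.src b)
    (h₁ : B.sqh.tgt a = B.ver.id (B.hor.src f)) (h₂ : B.sqh.tgt b = B.ver.id (B.hor.src f)) :
    B.sqh.comp (B.sqv.comp a b) (B.sqv.id f) =
      B.sqv.comp (B.sqh.comp a (B.sqv.id f)) (B.sqh.comp b (B.sqv.id f)) := by
  rw [← B.interchange _ _ _ _ h (by simp) (by simp [h₁]) (by simp [h₂]), B.sqv.id_id]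

/-- Both ways of decomposing the horizontal composite of two squares with trivial sides. -/
theorem _root_.DblCat.exch (B : DblCat.{u}) (a b : B.Sq) {o} (h₁ : B.sqh.tgt a = B.ver.id o)
    (h₂ : B.sqh.src b = B.ver.id o) :
    B.sqv.comp (B.sqh.comp a (B.sqv.id (B.sqv.src b))) (B.sqh.comp (B.sqv.id (B.sqv.tgt a)) b) =
    B.sqv.comp (B.sqh.comp (B.sqv.id (B.sqv.src a)) b) (B.sqh.comp a (B.sqv.id (B.sqv.tgt b))) := by
  rw [← B.interchange _ _ _ _ (by simp) (by simp) (by simp [h₁, h₂]) (by simp [h₁, h₂]),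
    ← B.interchange _ _ _ _ (by simp) (by simp) (by simp [h₁, h₂]) (by simp [h₁, h₂])]
  simp

theorem _root_.CatOn.assoc4 {O M : Type*} (C : CatOn O M) (p q r s q' r' : M)
    (h : C.comp q r = C.comp q' r') (h₁ : C.tgt p = C.src q) (h₂ : C.tgt q = C.src r)
    (h₃ : C.tgt r = C.src s) (h₁' : C.tgt p = C.src q') (h₂' : C.tgt q' = C.src r')
    (h₃' : C.tgt r' = C.src s) :
    C.comp (C.comp p q) (C.comp r s) = C.comp (C.comp p q') (C.comp r' s) := by
  rw [C.assoc p q _ h₁ (by simp [*]), C.assoc p q' _ h₁' (by simp [*]), ← C.assoc q r s h₂ h₃,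
    ← C.assoc q' r' s h₂' h₃', h]

@[simp] theorem _root_.CatOn.comp_id_of {O M : Type*} (C : CatOn O M) (f : M) (a : O)
    (h : C.tgt f = a) : C.comp f (C.id a) = f := by rw [← h, C.comp_id]

@[simp] theorem _root_.CatOn.id_comp_of {O M : Type*} (C : CatOn O M) (f : M) (a : O)
    (h : C.src f = a) : C.comp (C.id a) f = f := by rw [← h, C.id_comp]

theorem _root_.CatOn.assoc_swap {O M : Type*} (C : CatOn O M) {p q r s t w m : M}
    (h : C.comp p q = C.comp s m) (h' : C.comp m r = C.comp t w) (h₁ : C.tgt p = C.src q)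
    (h₂ : C.tgt q = C.src r) (h₃ : C.tgt s = C.src m) (h₄ : C.tgt m = C.src r)
    (h₅ : C.tgt s = C.src t) (h₆ : C.tgt t = C.src w) :
    C.comp p (C.comp q r) = C.comp (C.comp s t) w := by
  rw [← C.assoc _ _ _ h₁ h₂, h, C.assoc _ _ _ h₃ h₄, h', C.assoc _ _ _ h₅ h₆]

theorem _root_.CatOn.isInv_id {O M : Type*} (C : CatOn O M) (a : O) : C.IsInv (C.id a) :=
  ⟨C.id a, by simp, by simp, by simp, by simp⟩

theorem _root_.CatOn.IsInv.comp {O M : Type*} {C : CatOn O M} {f g : M} (hf : C.IsInv f)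
    (hg : C.IsInv g) (h : C.tgt f = C.src g) : C.IsInv (C.comp f g) := by
  obtain ⟨f', h₁, h₂, h₃, h₄⟩ := hf
  obtain ⟨g', k₁, k₂, k₃, k₄⟩ := hg
  have e : C.tgt g' = C.src f' := by rw [k₂, h₁, h]
  refine ⟨C.comp g' f', by simp [*], by simp [*], ?_, ?_⟩
  · rw [C.assoc _ _ _ h (by simp [*]), ← C.assoc g g' f' k₁.symm e, k₃,
      C.id_comp_of f' _ (by rw [h₁, h]), h₃, C.src_comp _ _ h]
  · rw [C.assoc _ _ _ e (by simp [*]), ← C.assoc f' f g h₂ h, h₄,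
      C.id_comp_of g _ h.symm, k₄, C.tgt_comp _ _ h]

theorem _root_.DblCat.isInv_hcomp (B : DblCat.{u}) {a b : B.Sq} (ha : B.sqv.IsInv a)
    (hb : B.sqv.IsInv b) (o : B.Ob) (h₁ : B.sqh.tgt a = B.ver.id o)
    (h₂ : B.sqh.src b = B.ver.id o) : B.sqv.IsInv (B.sqh.comp a b) := by
  obtain ⟨a', i₁, i₂, i₃, i₄⟩ := ha
  obtain ⟨b', k₁, k₂, k₃, k₄⟩ := hb
  have ea : B.sqh.tgt a' = B.ver.id o := by
    have h := B.right_comp a a' i₁.symm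
    have h₃ : B.ver.src (B.sqh.tgt a') = o := by
      rw [← DblCat.top_tgt, i₁, DblCat.bot_tgt, h₁, CatOn.tgt_id]
    rw [i₃, h₁, CatOn.id_comp_of _ _ _ h₃, DblCat.idh_tgt, DblCat.top_tgt, h₁,
      CatOn.src_id] at h
    exact h.symm
  have eb : B.sqh.src b' = B.ver.id o := by
    have h := B.left_comp b b' k₁.symm
    have h₃ : B.ver.src (B.sqh.src b') = o := by
      rw [← DblCat.top_src, k₁, DblCat.bot_src, h₂, CatOn.tgt_id]
    rw [k₃, h₂, CatOn.id_comp_of _ _ _ h₃, DblCat.idh_src, DblCat.top_src, h₂,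
      CatOn.src_id] at h
    exact h.symm
  refine ⟨B.sqh.comp a' b', ?_, ?_, ?_, ?_⟩
  · simp [*]
  · simp [*]
  · rw [← B.interchange _ _ _ _ i₁.symm k₁.symm (by simp [*]) (by simp [*]), i₃, k₃]
    simp [*]
  · rw [← B.interchange _ _ _ _ i₂ k₂ (by simp [*]) (by simp [*]), i₄, k₄]
    simp [*]

/-- The identity transformation. -/
def idt (F : A ⟶ B) : HorTrans A B where
  dom := F
  cod := F
  app a := B.hor.id (F.ob a)
  appV u := B.sqh.id (F.verm u)
  nat h := B.sqv.id (F.horm h)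
  app_src a := by simp
  app_tgt a := by simp
  isFun_appV := F.isFun_ver.trans B.isFun_idv
  appV_left u := by simp
  appV_right u := by simp
  nat_top h := by simp
  nat_bot h := by simp
  nat_left h := by simp
  nat_right h := by simp
  nat_inv h := CatOn.isInv_id _ _
  nat_id a := by simp
  nat_comp h k e := by rw [← B.idh_comp _ _ (by simp [e])]; simp [e, -DblCat.idh_comp]
  natural x := by simp

/-- Composition of transformations. -/
def comp (e : x.cod = y.dom) : HorTrans A B where
  dom := x.dom
  cod := y.cod
  app a := B.hor.comp (x.app a) (y.app a)
  appV u := B.sqh.comp (x.appV u) (y.appV u)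
  nat h := B.sqv.comp (B.sqh.comp (x.nat h) (B.sqv.id (y.app (A.hor.tgt h))))
    (B.sqh.comp (B.sqv.id (x.app (A.hor.src h))) (y.nat h))
  app_src a := by simp [e]
  app_tgt a := by simp [e]
  isFun_appV := ⟨fun u => by simp [e], fun u => by simp [e], fun a => by simp [e], fun u v h => by
    rw [x.isFun_appV.comp _ _ h, y.isFun_appV.comp _ _ h]
    apply B.interchange <;> simp [e, h]⟩
  appV_left u := by simp [e]
  appV_right u := by simp [e]
  nat_top h := by simp [e, CatOn.assoc]
  nat_bot h := by simp [e, CatOn.assoc]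
  nat_left h := by simp [e, CatOn.assoc]
  nat_right h := by simp [e, CatOn.assoc]
  nat_inv h := by
    refine CatOn.IsInv.comp (B.isInv_hcomp (x.nat_inv h) (CatOn.isInv_id _ _)
      (x.cod.ob (A.hor.tgt h)) ?_ ?_) (B.isInv_hcomp (CatOn.isInv_id _ _) (y.nat_inv h)
      (x.cod.ob (A.hor.src h)) ?_ ?_) ?_ <;> simp [e, CatOn.assoc]
  nat_id a := by rw [x.nat_id, y.nat_id, A.hor.src_id, A.hor.tgt_id, ← B.idh_comp _ _ (by simp [e]), CatOn.id_id]
  nat_comp h k H := by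
    simp [e, CatOn.assoc, nat_comp, H, DblCat.wl_comp, DblCat.wr_comp]
    have := B.exch (x.nat h) (y.nat k) (o := x.cod.ob (A.hor.tgt h)) (by simp) (by simp [e, H])
    apply CatOn.assoc4
    · simpa [e, H, CatOn.assoc] using this
    all_goals simp [e, H, CatOn.assoc]
  natural s := by
    have hx := x.natural s
    have hy := y.natural s
    have e₁ := B.interchange (B.sqh.comp (x.dom.sq s) (x.appV (A.sqh.tgt s))) (x.nat (A.sqv.tgt s))
      (y.appV (A.sqh.tgt s)) (B.sqv.id (y.app (A.ver.tgt (A.sqh.tgt s)))) (by simp)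
      (by simp) (by simp [e]) (by simp [e])
    have e₂ := B.interchange (x.nat (A.sqv.src s)) (B.sqh.comp (x.appV (A.sqh.src s)) (x.cod.sq s))
      (B.sqv.id (y.app (A.ver.src (A.sqh.tgt s)))) (y.appV (A.sqh.tgt s)) (by simp)
      (by simp) (by simp [e]) (by simp [e])
    have e₃ := B.interchange (x.appV (A.sqh.src s)) (B.sqv.id (x.app (A.ver.tgt (A.sqh.src s))))
      (B.sqh.comp (y.dom.sq s) (y.appV (A.sqh.tgt s))) (y.nat (A.sqv.tgt s)) (by simp)
      (by simp) (by simp [e]) (by simp [e])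
    have e₄ := B.interchange (B.sqv.id (x.app (A.ver.src (A.sqh.src s)))) (x.appV (A.sqh.src s))
      (y.nat (A.sqv.src s)) (B.sqh.comp (y.appV (A.sqh.src s)) (y.cod.sq s)) (by simp)
      (by simp) (by simp [e]) (by simp [e])
    rw [hx] at e₁
    rw [hy] at e₃
    simp [e, CatOn.assoc] at e₁ e₂ e₃ e₄ ⊢
    refine CatOn.assoc_swap _ (e₁.symm.trans e₂) (e₃.symm.trans e₄) ?_ ?_ ?_ ?_ ?_ ?_ <;>
      simp [e, CatOn.assoc]

end HorTrans

theorem DblCat.id_hcomp_id (B : DblCat.{u}) (f g : B.Hor) (h : B.hor.tgt f = B.hor.src g) :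
    B.sqh.comp (B.sqv.id f) (B.sqv.id g) = B.sqv.id (B.hor.comp f g) := (B.idh_comp f g h).symm

theorem DblCat.id_vcomp_id (B : DblCat.{u}) (f g : B.Ver) (h : B.ver.tgt f = B.ver.src g) :
    B.sqv.comp (B.sqh.id f) (B.sqh.id g) = B.sqh.id (B.ver.comp f g) := (B.idv_comp f g h).symm

namespace HorTrans

variable {A B : DblCat.{u}}

theorem id_comp' (F : A ⟶ B) (x : HorTrans A B) (e : (idt F).cod = x.dom) :
    (idt F).comp x e = x := by
  obtain rfl : F = x.dom := e
  refine HorTrans.ext rfl rfl ?_ ?_ ?_ <;> funext a <;>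
    simp [HorTrans.comp, HorTrans.idt, DblCat.id_hcomp_id, -DblCat.idh_comp]

theorem comp_id' (F : A ⟶ B) (x : HorTrans A B) (e : x.cod = (idt F).dom) :
    x.comp (idt F) e = x := by
  obtain rfl : x.cod = F := e
  refine HorTrans.ext rfl rfl ?_ ?_ ?_ <;> funext a <;>
    simp [HorTrans.comp, HorTrans.idt, DblCat.id_hcomp_id, -DblCat.idh_comp]

theorem assoc' (x y z : HorTrans A B) (e : x.cod = y.dom) (e₁ : y.cod = z.dom) (h h') :
    (x.comp y e).comp z h = x.comp (y.comp z e₁) h' := by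
  refine HorTrans.ext rfl rfl ?_ ?_ ?_ <;> funext a
  · simp [HorTrans.comp, CatOn.assoc, e, e₁]
  · simp [HorTrans.comp, CatOn.assoc, e, e₁]
  · simp [HorTrans.comp, CatOn.assoc, e, e₁, DblCat.wl_comp, DblCat.wr_comp]
    apply CatOn.assoc <;> simp [e, e₁, CatOn.assoc]

end HorTrans

/-- Double functors and horizontal pseudonatural transformations form a category. -/
noncomputable def HorTrans.cat (A B : DblCat.{u}) : CatOn (A ⟶ B) (HorTrans A B) :=
  CatOn.ofPartial HorTrans.dom HorTrans.cod HorTrans.idt (fun x y e => x.comp y e)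
    (fun _ => rfl) (fun _ => rfl) (fun _ _ _ => rfl) (fun _ _ _ => rfl)
    (fun x e => x.id_comp' _ e) (fun x e => x.comp_id' _ e)
    (fun x y z e e' h h' => x.assoc' y z _ _ _ _)

namespace HorTrans

variable {A B : DblCat.{u}} (x : HorTrans A.tr B.tr)

@[simp] theorem vapp_src (a) : B.ver.src (x.app a) = x.dom.ob a := x.app_src a
@[simp] theorem vapp_tgt (a) : B.ver.tgt (x.app a) = x.cod.ob a := x.app_tgt a
@[simp] theorem vappV_left (h) : B.sqv.src (x.appV h) = x.dom.verm h := x.appV_left h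
@[simp] theorem vappV_right (h) : B.sqv.tgt (x.appV h) = x.cod.verm h := x.appV_right h
@[simp] theorem vappV_top (h) : B.sqh.src (x.appV h) = x.app (A.hor.src h) := x.appV_top h
@[simp] theorem vappV_bot (h) : B.sqh.tgt (x.appV h) = x.app (A.hor.tgt h) := x.appV_bot h
@[simp] theorem vappV_id (a) : x.appV (A.hor.id a) = B.sqh.id (x.app a) := x.appV_id a
@[simp] theorem vnat_top (u) : B.sqh.src (x.nat u) =
    B.ver.comp (x.dom.horm u) (x.app (A.ver.tgt u)) := x.nat_top u
@[simp] theorem vnat_bot (u) : B.sqh.tgt (x.nat u) =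
    B.ver.comp (x.app (A.ver.src u)) (x.cod.horm u) := x.nat_bot u
@[simp] theorem vnat_left (u) : B.sqv.src (x.nat u) = B.hor.id (x.dom.ob (A.ver.src u)) :=
  x.nat_left u
@[simp] theorem vnat_right (u) : B.sqv.tgt (x.nat u) = B.hor.id (x.cod.ob (A.ver.tgt u)) :=
  x.nat_right u

end HorTrans

namespace DblFunctor

variable {A B : DblCat.{u}} (F : A ⟶ B) (G : A.tr ⟶ B.tr)

@[simp] theorem vhor_src (x) : B.ver.src (DblFunctor.horm G x) = DblFunctor.ob G (A.ver.src x) :=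
  G.isFun_hor.src x
@[simp] theorem vhor_tgt (x) : B.ver.tgt (DblFunctor.horm G x) = DblFunctor.ob G (A.ver.tgt x) :=
  G.isFun_hor.tgt x
@[simp] theorem vver_src (x) : B.hor.src (DblFunctor.verm G x) = DblFunctor.ob G (A.hor.src x) :=
  G.isFun_ver.src x
@[simp] theorem vver_tgt (x) : B.hor.tgt (DblFunctor.verm G x) = DblFunctor.ob G (A.hor.tgt x) :=
  G.isFun_ver.tgt x
@[simp] theorem tr_ob (a) : F.tr.ob a = DblFunctor.ob F a := rfl
@[simp] theorem tr_horm (a) : F.tr.horm a = DblFunctor.verm F a := rfl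
@[simp] theorem tr_verm (a) : F.tr.verm a = DblFunctor.horm F a := rfl
@[simp] theorem tr_sq (a) : F.tr.sq a = DblFunctor.sq F a := rfl
@[simp] theorem vtr_ob (a) : @DblFunctor.ob A B (DblFunctor.tr G) a = DblFunctor.ob G a := rfl
@[simp] theorem vtr_horm (a) : @DblFunctor.horm A B (DblFunctor.tr G) a = DblFunctor.verm G a := rfl
@[simp] theorem vtr_verm (a) : @DblFunctor.verm A B (DblFunctor.tr G) a = DblFunctor.horm G a := rfl
@[simp] theorem vtr_sq (a) : @DblFunctor.sq A B (DblFunctor.tr G) a = DblFunctor.sq G a := rfl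

end DblFunctor

/-- A modification (a square in the double category of double functors), with horizontal
pseudonatural transformations `top` and `bot` and vertical ones `left` and `right`. -/
@[ext]
structure DblMod (A B : DblCat.{u}) where
  top : HorTrans A B
  bot : HorTrans A B
  left : HorTrans A.tr B.tr
  right : HorTrans A.tr B.tr
  app : A.Ob → B.Sq
  left_dom : left.dom = top.dom.tr
  left_cod : left.cod = bot.dom.tr
  right_dom : right.dom = top.cod.tr
  right_cod : right.cod = bot.cod.tr
  app_top : ∀ a, B.sqv.src (app a) = top.app a
  app_bot : ∀ a, B.sqv.tgt (app a) = bot.app a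
  app_left : ∀ a, B.sqh.src (app a) = left.app a
  app_right : ∀ a, B.sqh.tgt (app a) = right.app a
  natural_hor : ∀ h : A.Hor,
    B.sqv.comp (B.sqh.comp (left.appV h) (app (A.hor.tgt h))) (bot.nat h) =
      B.sqv.comp (top.nat h) (B.sqh.comp (app (A.hor.src h)) (right.appV h))
  natural_ver : ∀ u : A.Ver,
    B.sqh.comp (B.sqv.comp (top.appV u) (app (A.ver.tgt u))) (right.nat u) =
      B.sqh.comp (left.nat u) (B.sqv.comp (app (A.ver.src u)) (bot.appV u))

namespace DblMod

variable {A B : DblCat.{u}}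

attribute [simp] DblMod.left_dom DblMod.left_cod DblMod.right_dom DblMod.right_cod
  DblMod.app_top DblMod.app_bot DblMod.app_left DblMod.app_right

/-- Transposition of modifications. -/
def tr (m : DblMod A B) : DblMod A.tr B.tr where
  top := m.left
  bot := m.right
  left := m.top
  right := m.bot
  app := m.app
  left_dom := by rw [m.left_dom]; rfl
  left_cod := by rw [m.right_dom]; rfl
  right_dom := by rw [m.left_cod]; rfl
  right_cod := by rw [m.right_cod]; rfl
  app_top := m.app_left
  app_bot := m.app_right
  app_left := m.app_top
  app_right := m.app_bot
  natural_hor := m.natural_ver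
  natural_ver := m.natural_hor

/-- The horizontal identity of a vertical transformation. -/
def idh (x : HorTrans A.tr B.tr) : DblMod A B where
  top := .idt x.dom.tr
  bot := .idt x.cod.tr
  left := x
  right := x
  app a := B.sqh.id (x.app a)
  left_dom := rfl
  left_cod := rfl
  right_dom := rfl
  right_cod := rfl
  app_top a := (B.idv_src _).trans (congrArg B.hor.id (x.app_src a))
  app_bot a := (B.idv_tgt _).trans (congrArg B.hor.id (x.app_tgt a))
  app_left a := B.sqh.src_id _
  app_right a := B.sqh.tgt_id _
  natural_hor h := by
    simp [HorTrans.idt]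
  natural_ver u := by
    simp [HorTrans.idt, DblCat.id_vcomp_id, -DblCat.idv_comp]

theorem top_cod_eq {m n : DblMod A B} (e : m.right = n.left) : m.top.cod = n.top.dom :=
  congrArg DblFunctor.tr (m.right_dom.symm.trans ((congrArg HorTrans.dom e).trans n.left_dom))

theorem bot_cod_eq {m n : DblMod A B} (e : m.right = n.left) : m.bot.cod = n.bot.dom :=
  congrArg DblFunctor.tr (m.right_cod.symm.trans ((congrArg HorTrans.cod e).trans n.left_cod))

/-- The horizontal composite of modifications. -/
def hcomp (m n : DblMod A B) (e : m.right = n.left) : DblMod A B where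
  top := m.top.comp n.top (top_cod_eq e)
  bot := m.bot.comp n.bot (bot_cod_eq e)
  left := m.left
  right := n.right
  app a := B.sqh.comp (m.app a) (n.app a)
  left_dom := m.left_dom
  left_cod := m.left_cod
  right_dom := n.right_dom
  right_cod := n.right_cod
  app_top a := by simp [e, HorTrans.comp]
  app_bot a := by simp [e, HorTrans.comp]
  app_left a := by simp [e]
  app_right a := by simp [e]
  natural_hor h := by
    have hm := m.natural_hor h
    have hn := n.natural_hor h
    have e₁ := top_cod_eq e
    have e₂ := bot_cod_eq e
    have i₁ := B.interchange (B.sqh.comp (m.left.appV h) (m.app (A.hor.tgt h))) (m.bot.nat h)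
      (n.app (A.hor.tgt h)) (B.sqv.id (n.bot.app (A.hor.tgt h)))
    have i₂ := B.interchange (m.top.nat h) (B.sqh.comp (m.app (A.hor.src h)) (m.right.appV h))
      (B.sqv.id (n.top.app (A.hor.tgt h))) (n.app (A.hor.tgt h))
    have i₃ := B.interchange (m.app (A.hor.src h)) (B.sqv.id (m.bot.app (A.hor.src h)))
      (B.sqh.comp (n.left.appV h) (n.app (A.hor.tgt h))) (n.bot.nat h)
    have i₄ := B.interchange (B.sqv.id (m.top.app (A.hor.src h))) (m.app (A.hor.src h))
      (n.top.nat h) (B.sqh.comp (n.app (A.hor.src h)) (n.right.appV h))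
    rw [hm] at i₁
    rw [hn] at i₃
    simp [e, e₁, e₂, CatOn.assoc, HorTrans.comp] at i₁ i₂ i₃ i₄ ⊢
    refine CatOn.assoc_swap _ (i₁.symm.trans i₂) (i₃.symm.trans i₄) ?_ ?_ ?_ ?_ ?_ ?_ <;>
      simp [e, e₁, e₂, CatOn.assoc]
  natural_ver u := by
    have hm := m.natural_ver u
    have hn := n.natural_ver u
    have e₁ := top_cod_eq e
    have e₂ := bot_cod_eq e
    have i₁ := B.interchange (m.top.appV u) (m.app (A.ver.tgt u)) (n.top.appV u)
      (n.app (A.ver.tgt u))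
    have i₂ := B.interchange (m.app (A.ver.src u)) (m.bot.appV u) (n.app (A.ver.src u))
      (n.bot.appV u)
    simp [e, e₁, e₂] at i₁ i₂
    simp only [HorTrans.comp]
    rw [← i₁, ← i₂, B.sqh.assoc, hn, ← B.sqh.assoc, ← e, hm, B.sqh.assoc] <;> simp [e, e₁, e₂]

theorem interchange' (α β γ δ : DblMod A B) (h₁ : α.bot = β.top) (h₂ : γ.bot = δ.top)
    (h₃ : α.right = γ.left) (h₄ : β.right = δ.left)
    (h₅ : (hcomp α γ h₃).bot = (hcomp β δ h₄).top)
    (h₆ : (hcomp α.tr β.tr h₁).tr.right = (hcomp γ.tr δ.tr h₂).tr.left) :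
    hcomp (hcomp α.tr β.tr h₁).tr (hcomp γ.tr δ.tr h₂).tr h₆ =
      (hcomp (hcomp α γ h₃).tr (hcomp β δ h₄).tr h₅).tr := by
  refine DblMod.ext rfl rfl rfl rfl (funext fun a => ?_)
  refine B.interchange _ _ _ _ ?_ ?_ ?_ ?_
  · exact (α.app_bot a).trans ((congrArg (fun x => x.app a) h₁).trans (β.app_top a).symm)
  · exact (γ.app_bot a).trans ((congrArg (fun x => x.app a) h₂).trans (δ.app_top a).symm)
  · exact (α.app_right a).trans ((congrArg (fun x => x.app a) h₃).trans (γ.app_left a).symm)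
  · exact (β.app_right a).trans ((congrArg (fun x => x.app a) h₄).trans (δ.app_left a).symm)

end DblMod

open DblMod in
theorem DblMod.idh_hcomp {A B : DblCat.{u}} (u) (x : DblMod A B) (e : (DblMod.idh u).right = x.left) :
    DblMod.hcomp (DblMod.idh u) x e = x := by
  cases (show u = x.left from e)
  have e : (DblMod.idh x.left).right = x.left := rfl
  refine DblMod.ext (HorTrans.id_comp' _ _ (top_cod_eq e)) (HorTrans.id_comp' _ _ (bot_cod_eq e)) rfl rfl (funext fun a => ?_)
  simp [DblMod.hcomp, DblMod.idh]

open DblMod in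
theorem DblMod.hcomp_idh {A B : DblCat.{u}} (u) (x : DblMod A B) (e : x.right = (DblMod.idh u).left) :
    DblMod.hcomp x (DblMod.idh u) e = x := by
  cases (show x.right = u from e)
  have e : x.right = (DblMod.idh x.right).left := rfl
  refine DblMod.ext (HorTrans.comp_id' _ _ (top_cod_eq e)) (HorTrans.comp_id' _ _ (bot_cod_eq e)) rfl rfl (funext fun a => ?_)
  simp [DblMod.hcomp, DblMod.idh]

open DblMod in
theorem DblMod.hcomp_assoc {A B : DblCat.{u}} (x y z : DblMod A B) (e : x.right = y.left)
    (e₁ : y.right = z.left) (h h') :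
    DblMod.hcomp (DblMod.hcomp x y e) z h = DblMod.hcomp x (DblMod.hcomp y z e₁) h' := by
  refine DblMod.ext (HorTrans.assoc' _ _ _ (top_cod_eq e) (top_cod_eq e₁) (top_cod_eq h)
    (top_cod_eq h'))
    (HorTrans.assoc' _ _ _ (bot_cod_eq e) (bot_cod_eq e₁) (bot_cod_eq h) (bot_cod_eq h')) rfl rfl
    (funext fun a => ?_)
  apply CatOn.assoc <;> simp [e, e₁]

/-- Transport of a category structure along a bijection of objects. -/
def CatOn.mapOb {O : Type u} {O' : Type v} {M : Type w} (C : CatOn O M) (e : O ≃ O') :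
    CatOn O' M where
  src f := e (C.src f)
  tgt f := e (C.tgt f)
  id a := C.id (e.symm a)
  comp := C.comp
  src_id a := by simp
  tgt_id a := by simp
  src_comp f g h := by rw [C.src_comp _ _ (e.injective h)]
  tgt_comp f g h := by rw [C.tgt_comp _ _ (e.injective h)]
  id_comp f := by simp
  comp_id f := by simp
  assoc f g h p q := C.assoc _ _ _ (e.injective p) (e.injective q)

/-- Transposition as a bijection. -/
def DblFunctor.trEquiv (A B : DblCat.{u}) : (A.tr ⟶ B.tr) ≃ (A ⟶ B) where
  toFun F := DblFunctor.tr F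
  invFun F := F.tr
  left_inv _ := rfl
  right_inv _ := rfl

theorem CatOn.ofPartial_comp {O : Type u} {M : Type v} (src tgt : M → O) (id : O → M)
    (comp : ∀ f g, tgt f = src g → M) (h₁ h₂ h₃ h₄ h₅ h₆ h₇) (f g : M) (h : tgt f = src g) :
    (CatOn.ofPartial src tgt id comp h₁ h₂ h₃ h₄ h₅ h₆ h₇).comp f g = comp f g h := dif_pos h

namespace DblMod

variable (A B : DblCat.{u})

/-- Modifications form a category over vertical transformations. -/
noncomputable def catH : CatOn (HorTrans A.tr B.tr) (DblMod A B) :=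
  CatOn.ofPartial DblMod.left DblMod.right DblMod.idh DblMod.hcomp
    (fun _ => rfl) (fun _ => rfl) (fun _ _ _ => rfl) (fun _ _ _ => rfl)
    (fun _ _ => idh_hcomp _ _ _) (fun _ _ => hcomp_idh _ _ _)
    (fun _ _ _ _ _ _ _ => hcomp_assoc _ _ _ _ _ _ _)

/-- Modifications form a category over horizontal transformations. -/
noncomputable def catV : CatOn (HorTrans A B) (DblMod A B) :=
  CatOn.ofPartial DblMod.top DblMod.bot (fun x => (DblMod.idh (A := A.tr) (B := B.tr) x).tr)
    (fun x y e => (DblMod.hcomp x.tr y.tr e).tr)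
    (fun _ => rfl) (fun _ => rfl) (fun _ _ _ => rfl) (fun _ _ _ => rfl)
    (fun _ _ => congrArg DblMod.tr (idh_hcomp (A := A.tr) (B := B.tr) _ _ _))
    (fun _ _ => congrArg DblMod.tr (hcomp_idh (A := A.tr) (B := B.tr) _ _ _))
    (fun _ _ _ e _ e₁ _ => congrArg DblMod.tr (hcomp_assoc (A := A.tr) (B := B.tr) _ _ _ e e₁ _ _))

variable {A B}

theorem catH_comp (x y : DblMod A B) (e : x.right = y.left) : (catH A B).comp x y = x.hcomp y e :=
  CatOn.ofPartial_comp _ _ _ _ _ _ _ _ _ _ _ _ _ e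

theorem catV_comp (x y : DblMod A B) (e : x.bot = y.top) :
    (catV A B).comp x y = (x.tr.hcomp y.tr e).tr :=
  CatOn.ofPartial_comp _ _ _ _ _ _ _ _ _ _ _ _ _ e

theorem _root_.HorTrans.cat_comp (x y : HorTrans A B) (e : x.cod = y.dom) :
    (HorTrans.cat A B).comp x y = x.comp y e :=
  CatOn.ofPartial_comp _ _ _ _ _ _ _ _ _ _ _ _ _ e

theorem isFun_top : (catH A B).IsFun (HorTrans.cat A B)
    (fun x => DblFunctor.trEquiv A B x.dom) DblMod.top where
  src f := (congrArg (DblFunctor.trEquiv A B) f.left_dom).symm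
  tgt f := (congrArg (DblFunctor.trEquiv A B) f.right_dom).symm
  id a := rfl
  comp f g h := by
    rw [catH_comp _ _ h]; exact (HorTrans.cat_comp _ _ (top_cod_eq h)).symm

theorem isFun_bot : (catH A B).IsFun (HorTrans.cat A B)
    (fun x => DblFunctor.trEquiv A B x.cod) DblMod.bot where
  src f := (congrArg (DblFunctor.trEquiv A B) f.left_cod).symm
  tgt f := (congrArg (DblFunctor.trEquiv A B) f.right_cod).symm
  id a := rfl
  comp f g h := by
    rw [catH_comp _ _ h]; exact (HorTrans.cat_comp _ _ (bot_cod_eq h)).symm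

theorem isFun_left : (catV A B).IsFun ((HorTrans.cat A.tr B.tr).mapOb (DblFunctor.trEquiv A B))
    HorTrans.dom DblMod.left where
  src f := congrArg (DblFunctor.trEquiv A B) f.left_dom
  tgt f := congrArg (DblFunctor.trEquiv A B) f.left_cod
  id a := rfl
  comp f g h := by
    rw [catV_comp _ _ h]
    exact (HorTrans.cat_comp (A := A.tr) (B := B.tr) _ _ (top_cod_eq (m := f.tr) (n := g.tr) h)).symm

theorem isFun_right : (catV A B).IsFun ((HorTrans.cat A.tr B.tr).mapOb (DblFunctor.trEquiv A B))
    HorTrans.cod DblMod.right where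
  src f := congrArg (DblFunctor.trEquiv A B) f.right_dom
  tgt f := congrArg (DblFunctor.trEquiv A B) f.right_cod
  id a := rfl
  comp f g h := by
    rw [catV_comp _ _ h]
    exact (HorTrans.cat_comp (A := A.tr) (B := B.tr) _ _ (bot_cod_eq (m := f.tr) (n := g.tr) h)).symm

theorem isFun_idh : (HorTrans.cat A B).IsFun (catH A B) (fun F => .idt F.tr)
    (fun x => (DblMod.idh (A := A.tr) (B := B.tr) x).tr) where
  src f := rfl
  tgt f := rfl
  id a := by
    refine DblMod.ext rfl rfl rfl rfl (funext fun b => ?_)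
    exact B.idh_id _
  comp f g h := by
    rw [HorTrans.cat_comp _ _ h, catH_comp _ _ (congrArg (fun F => HorTrans.idt (DblFunctor.tr F)) h)]
    refine DblMod.ext rfl rfl rfl rfl (funext fun b => ?_)
    exact B.idh_comp _ _ (by
      have := congrArg (fun F => DblFunctor.ob F b) h
      exact (f.app_tgt b).trans (this.trans (g.app_src b).symm))

theorem isFun_idv : ((HorTrans.cat A.tr B.tr).mapOb (DblFunctor.trEquiv A B)).IsFun (catV A B)
    HorTrans.idt DblMod.idh where
  src f := rfl
  tgt f := rfl
  id a := by
    refine DblMod.ext rfl rfl rfl rfl (funext fun b => ?_)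
    exact (B.idh_id _).symm
  comp f g h := by
    have h' : f.cod = g.dom := (DblFunctor.trEquiv A B).injective h
    have := HorTrans.cat_comp _ _ h'
    refine (congrArg DblMod.idh this).trans ?_
    rw [catV_comp _ _ (congrArg (fun F => HorTrans.idt (DblFunctor.tr F)) h')]
    refine DblMod.ext rfl rfl rfl rfl (funext fun b => ?_)
    exact B.idv_comp _ _ (by
      have := congrArg (fun F : A.tr ⟶ B.tr => DblFunctor.ob F b) h'
      exact (f.app_tgt b).trans (this.trans (g.app_src b).symm))

end DblMod

/-- The double category of double functors, horizontal and vertical pseudonatural transformations,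
and modifications. -/
noncomputable def DblCat.ihom (A B : DblCat.{u}) : DblCat.{u} where
  Ob := A ⟶ B
  Hor := HorTrans A B
  Ver := HorTrans A.tr B.tr
  Sq := DblMod A B
  hor := HorTrans.cat A B
  ver := (HorTrans.cat A.tr B.tr).mapOb (DblFunctor.trEquiv A B)
  sqh := DblMod.catH A B
  sqv := DblMod.catV A B
  isFun_top := DblMod.isFun_top
  isFun_bot := DblMod.isFun_bot
  isFun_idh := DblMod.isFun_idh
  isFun_left := DblMod.isFun_left
  isFun_right := DblMod.isFun_right
  isFun_idv := DblMod.isFun_idv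
  interchange α β γ δ h₁ h₂ h₃ h₄ := by
    rw [DblMod.catV_comp _ _ h₁, DblMod.catV_comp _ _ h₂, DblMod.catH_comp _ _ h₃,
      DblMod.catH_comp _ _ h₄]
    have h₅ : (α.hcomp γ h₃).bot = (β.hcomp δ h₄).top := by
      simp only [DblMod.hcomp]
      congr 1
    have h₆ : (α.tr.hcomp β.tr h₁).tr.right = (γ.tr.hcomp δ.tr h₂).tr.left := by
      simp only [DblMod.hcomp, DblMod.tr]
      congr 1
    rw [DblMod.catH_comp _ _ h₆, DblMod.catV_comp _ _ h₅]
    exact DblMod.interchange' _ _ _ _ _ _ _ _ _ _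

namespace HorTrans

variable {A A' B B' : DblCat.{u}}

/-- The whiskering of a transformation with double functors on both sides. -/
def map (F : A' ⟶ A) (G : B ⟶ B') (x : HorTrans A B) : HorTrans A' B' where
  dom := F ≫ x.dom ≫ G
  cod := F ≫ x.cod ≫ G
  app a := DblFunctor.horm G (x.app (DblFunctor.ob F a))
  appV u := DblFunctor.sq G (x.appV (DblFunctor.verm F u))
  nat h := DblFunctor.sq G (x.nat (DblFunctor.horm F h))
  app_src a := by simp; rfl
  app_tgt a := by simp; rfl
  isFun_appV := (F.isFun_ver.trans x.isFun_appV).trans G.isFun_sqv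
  appV_left u := by simp; rfl
  appV_right u := by simp; rfl
  nat_top h := by simp; rfl
  nat_bot h := by simp; rfl
  nat_left h := by simp; rfl
  nat_right h := by simp; rfl
  nat_inv h := G.isFun_sqv.isInv (x.nat_inv _)
  nat_id a := by simp
  nat_comp h k e := by
    have e' : A.hor.tgt (DblFunctor.horm F h) = A.hor.src (DblFunctor.horm F k) := by simp [e]
    have h₁ := congrArg (DblFunctor.sq G) (x.nat_comp _ _ e')
    rw [← DblFunctor.hor_comp F _ _ e] at h₁
    rw [DblFunctor.sqv_comp, DblFunctor.sqh_comp, DblFunctor.sqh_comp,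
      DblFunctor.sqv_id, DblFunctor.sqv_id] at h₁
    · exact h₁
    all_goals simp [e, CatOn.assoc]
  natural s := by
    have h := congrArg (DblFunctor.sq G) (x.natural (DblFunctor.sq F s))
    simp at h
    exact h

end HorTrans

namespace DblMod

variable {A A' B B' : DblCat.{u}}

/-- The whiskering of a modification with double functors on both sides. -/
def map (F : A' ⟶ A) (G : B ⟶ B') (m : DblMod A B) : DblMod A' B' where
  top := m.top.map F G
  bot := m.bot.map F G
  left := m.left.map F.tr G.tr
  right := m.right.map F.tr G.tr
  app a := DblFunctor.sq G (m.app (DblFunctor.ob F a))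
  left_dom := congrArg (fun K => F.tr ≫ K ≫ G.tr) m.left_dom
  left_cod := congrArg (fun K => F.tr ≫ K ≫ G.tr) m.left_cod
  right_dom := congrArg (fun K => F.tr ≫ K ≫ G.tr) m.right_dom
  right_cod := congrArg (fun K => F.tr ≫ K ≫ G.tr) m.right_cod
  app_top a := by simp; rfl
  app_bot a := by simp; rfl
  app_left a := by simp; rfl
  app_right a := by simp; rfl
  natural_hor s := by
    have h := congrArg (DblFunctor.sq G) (m.natural_hor (DblFunctor.horm F s))
    simp at h
    exact h
  natural_ver s := by
    have h := congrArg (DblFunctor.sq G) (m.natural_ver (DblFunctor.verm F s))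
    simp at h
    exact h

end DblMod

namespace DblCat

theorem isFun_map {A A' B B' : DblCat.{u}} (F : A' ⟶ A) (G : B ⟶ B') :
    (HorTrans.cat A B).IsFun (HorTrans.cat A' B') (fun K => F ≫ K ≫ G) (HorTrans.map F G) where
  src _ := rfl
  tgt _ := rfl
  id a := by
    refine HorTrans.ext rfl rfl ?_ ?_ ?_ <;> funext x
    · exact G.isFun_hor.id _
    · exact G.isFun_sqh.id _
    · exact G.isFun_sqv.id _
  comp x y h := by
    have h : x.cod = y.dom := h
    rw [HorTrans.cat_comp _ _ h, HorTrans.cat_comp _ _ (congrArg (fun K => F ≫ K ≫ G) h)]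
    refine HorTrans.ext rfl rfl ?_ ?_ ?_ <;> funext x
    · simp [HorTrans.map, HorTrans.comp, h]
    · simp [HorTrans.map, HorTrans.comp, h]
    · simp [HorTrans.map, HorTrans.comp, h, CatOn.assoc]

theorem isFun_modMap {A A' B B' : DblCat.{u}} (F : A' ⟶ A) (G : B ⟶ B') :
    (DblMod.catH A B).IsFun (DblMod.catH A' B') (HorTrans.map F.tr G.tr) (DblMod.map F G) where
  src _ := rfl
  tgt _ := rfl
  id a := by
    refine DblMod.ext ?_ ?_ rfl rfl (funext fun x => ?_)
    · exact (isFun_map F G).id _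
    · exact (isFun_map F G).id _
    · exact G.isFun_sqh.id _
  comp x y h := by
    have h : x.right = y.left := h
    have h' : (x.map F G).right = (y.map F G).left := congrArg (HorTrans.map F.tr G.tr) h
    rw [DblMod.catH_comp _ _ h, DblMod.catH_comp _ _ h']
    refine DblMod.ext ?_ ?_ rfl rfl (funext fun x => ?_)
    · have := (isFun_map F G).comp _ _ (DblMod.top_cod_eq h)
      rw [HorTrans.cat_comp _ _ (DblMod.top_cod_eq h)] at this
      exact this.trans (HorTrans.cat_comp _ _ (DblMod.top_cod_eq h'))
    · have := (isFun_map F G).comp _ _ (DblMod.bot_cod_eq h)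
      rw [HorTrans.cat_comp _ _ (DblMod.bot_cod_eq h)] at this
      exact this.trans (HorTrans.cat_comp _ _ (DblMod.bot_cod_eq h'))
    · simp [DblMod.map, DblMod.hcomp, h]

/-- Functoriality of the double category of double functors. -/
def ihomMap {A A' B B' : DblCat.{u}} (F : A' ⟶ A) (G : B ⟶ B') : ihom A B ⟶ ihom A' B' where
  ob K := F ≫ K ≫ G
  horm := HorTrans.map F G
  verm := HorTrans.map F.tr G.tr
  sq := DblMod.map F G
  isFun_hor := isFun_map F G
  isFun_ver :=
    { src _ := rfl
      tgt _ := rfl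
      id _ := (isFun_map F.tr G.tr).id _
      comp x y h := (isFun_map F.tr G.tr).comp x y ((DblFunctor.trEquiv A B).injective h) }
  isFun_sqh := isFun_modMap F G
  isFun_sqv :=
    { src _ := rfl
      tgt _ := rfl
      id _ := congrArg DblMod.tr ((isFun_modMap F.tr G.tr).id _)
      comp x y h := by
        have h : x.bot = y.top := h
        have h' : (x.map F G).bot = (y.map F G).top := congrArg (HorTrans.map F G) h
        have := (isFun_modMap F.tr G.tr).comp x.tr y.tr h
        rw [DblMod.catH_comp _ _ h] at this
        have h₂ := DblMod.catH_comp (x.tr.map F.tr G.tr) (y.tr.map F.tr G.tr) h'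
        refine (congrArg (DblMod.map F G) (DblMod.catV_comp _ _ h)).trans ?_
        refine Eq.trans ?_ (DblMod.catV_comp _ _ h').symm
        exact congrArg DblMod.tr (this.trans h₂) }

/-- The internal hom functor of double categories. -/
noncomputable def ihomFunctor : DblCat.{u}ᵒᵖ ⥤ DblCat.{u} ⥤ DblCat.{u} where
  obj A :=
    { obj B := ihom A.unop B
      map G := ihomMap (𝟙 _) G }
  map F :=
    { app B := ihomMap F.unop (𝟙 B) }

end DblCat

namespace HorTrans

variable {S : Type w} {A E : DblCat.{u}} {D : S → DblCat.{u}} {p : ∀ s, E ⟶ D s}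

theorem ext_cells {A B : DblCat.{u}} {x y : HorTrans A B} (h₁ : ∀ a, x.dom.sq a = y.dom.sq a)
    (h₂ : ∀ a, x.cod.sq a = y.cod.sq a) (h₃ : ∀ a, x.appV a = y.appV a)
    (h₄ : ∀ a, x.nat a = y.nat a) : x = y := by
  refine HorTrans.ext (DblCat.hom_ext _ _ h₁) (DblCat.hom_ext _ _ h₂) (funext fun a => ?_)
    (funext h₃) (funext h₄)
  rw [← B.sqv.src_id (x.app a), ← B.sqv.src_id (y.app a), ← x.appV_id, ← y.appV_id, h₃]

theorem exists_lift (hp : DblCat.Emb p) (x : ∀ s, HorTrans A (D s)) (F G : A ⟶ E)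
    (hF : ∀ s, F ≫ p s = (x s).dom) (hG : ∀ s, G ≫ p s = (x s).cod) (kV : A.Ver → E.Sq)
    (hV : ∀ s u, (p s).sq (kV u) = (x s).appV u) (kN : A.Hor → E.Sq)
    (hN : ∀ s h, (p s).sq (kN h) = (x s).nat h) :
    ∃ y : HorTrans A E, y.dom = F ∧ y.cod = G ∧ ∀ s, y.map (𝟙 A) (p s) = x s := by
  obtain ⟨ih, iv, io⟩ := DblCat.inj_cells hp.inj
  have Fo : ∀ s a, (p s).ob (F.ob a) = (x s).dom.ob a := fun s a => by rw [← hF]; rfl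
  have Fh : ∀ s a, (p s).horm (F.horm a) = (x s).dom.horm a := fun s a => by rw [← hF]; rfl
  have Fv : ∀ s a, (p s).verm (F.verm a) = (x s).dom.verm a := fun s a => by rw [← hF]; rfl
  have Fs : ∀ s a, (p s).sq (F.sq a) = (x s).dom.sq a := fun s a => by rw [← hF]; rfl
  have Go : ∀ s a, (p s).ob (G.ob a) = (x s).cod.ob a := fun s a => by rw [← hG]; rfl
  have Gh : ∀ s a, (p s).horm (G.horm a) = (x s).cod.horm a := fun s a => by rw [← hG]; rfl
  have Gv : ∀ s a, (p s).verm (G.verm a) = (x s).cod.verm a := fun s a => by rw [← hG]; rfl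
  have Gs : ∀ s a, (p s).sq (G.sq a) = (x s).cod.sq a := fun s a => by rw [← hG]; rfl
  let app : A.Ob → E.Hor := fun a => E.sqv.src (kV (A.ver.id a))
  have hA : ∀ s a, (p s).horm (app a) = (x s).app a := fun s a => by
    rw [← DblFunctor.sqv_src, hV, (x s).appV_id, CatOn.src_id]
  have c₁ : ∀ a, E.hor.src (app a) = F.ob a := fun a => io _ _ fun s => by
    rw [← DblFunctor.hor_src, hA, app_src, Fo]
  have c₂ : ∀ a, E.hor.tgt (app a) = G.ob a := fun a => io _ _ fun s => by
    rw [← DblFunctor.hor_tgt, hA, app_tgt, Go]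
  have c₃ : A.ver.IsFun E.sqv app kV := CatOn.IsFun.of_inj (fun s => (x s).isFun_appV)
    (fun s => (p s).isFun_sqv) (fun s => .refl _) ih hp.inj hA hV
  have c₄ : ∀ u, E.sqh.src (kV u) = F.verm u := fun u => iv _ _ fun s => by
    rw [← DblFunctor.sqh_src, hV, appV_left, Fv]
  have c₅ : ∀ u, E.sqh.tgt (kV u) = G.verm u := fun u => iv _ _ fun s => by
    rw [← DblFunctor.sqh_tgt, hV, appV_right, Gv]
  have c₆ : ∀ h, E.sqv.src (kN h) = E.hor.comp (F.horm h) (app (A.hor.tgt h)) := fun u =>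
    ih _ _ fun s => by
    rw [← DblFunctor.sqv_src, hN, nat_top, DblFunctor.hor_comp _ _ _ (by simp [c₁]), Fh, hA]
  have c₇ : ∀ h, E.sqv.tgt (kN h) = E.hor.comp (app (A.hor.src h)) (G.horm h) := fun u =>
    ih _ _ fun s => by
    rw [← DblFunctor.sqv_tgt, hN, nat_bot, DblFunctor.hor_comp _ _ _ (by simp [c₂]), Gh, hA]
  have c₈ : ∀ h, E.sqh.src (kN h) = E.ver.id (F.ob (A.hor.src h)) := fun u =>
    iv _ _ fun s => by
    rw [← DblFunctor.sqh_src, hN, nat_left, DblFunctor.ver_id, Fo]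
  have c₉ : ∀ h, E.sqh.tgt (kN h) = E.ver.id (G.ob (A.hor.tgt h)) := fun u =>
    iv _ _ fun s => by
    rw [← DblFunctor.sqh_tgt, hN, nat_right, DblFunctor.ver_id, Go]
  have c₁₀ : ∀ u, E.sqv.src (kV u) = app (A.ver.src u) := fun u => c₃.src u
  have c₁₁ : ∀ u, E.sqv.tgt (kV u) = app (A.ver.tgt u) := fun u => c₃.tgt u
  refine ⟨⟨F, G, app, kV, kN, c₁, c₂, c₃, c₄, c₅, c₆, c₇, c₈, c₉, fun h => ?_, fun a => ?_,
    fun h k e => ?_, fun z => ?_⟩, rfl, rfl, fun s => ?_⟩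
  · exact hp.vinv _ fun s => by rw [hN]; exact (x s).nat_inv h
  · exact hp.inj _ _ fun s => by rw [hN, nat_id, DblFunctor.sqv_id, hA]
  · refine hp.inj _ _ fun s => ?_
    rw [hN, (x s).nat_comp _ _ e, DblFunctor.sqv_comp, DblFunctor.sqh_comp, DblFunctor.sqh_comp,
      DblFunctor.sqv_id, DblFunctor.sqv_id, hN, hN, Fh, Gh] <;>
    simp [c₁, c₂, c₄, c₅, c₆, c₇, c₈, c₉, c₁₀, c₁₁, e, CatOn.assoc]
  · refine hp.inj _ _ fun s => ?_
    have := (x s).natural z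
    rw [← Fs, ← hV, ← hN, ← Gs, ← hV, ← hN] at this
    rwa [DblFunctor.sqv_comp, DblFunctor.sqh_comp, DblFunctor.sqv_comp, DblFunctor.sqh_comp] <;>
    simp [c₁, c₂, c₄, c₅, c₆, c₇, c₈, c₉, c₁₀, c₁₁, CatOn.assoc]
  · exact ext_cells (fun a => Fs s a) (fun a => Gs s a) (fun a => hV s a) (fun a => hN s a)

/-- The cells of which a transformation consists. -/
def Ix (A : DblCat.{u}) : Type u := A.Sq ⊕ A.Sq ⊕ A.Ver ⊕ A.Hor

/-- The cells of which a transformation consists. -/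
def cells {A B : DblCat.{u}} (x : HorTrans A B) : Ix A → B.Sq
  | .inl a => x.dom.sq a
  | .inr (.inl a) => x.cod.sq a
  | .inr (.inr (.inl u)) => x.appV u
  | .inr (.inr (.inr h)) => x.nat h

theorem ext_cells' {A B : DblCat.{u}} {x y : HorTrans A B} (h : ∀ i, x.cells i = y.cells i) :
    x = y :=
  ext_cells (fun a => h (.inl a)) (fun a => h (.inr (.inl a))) (fun a => h (.inr (.inr (.inl a))))
    (fun a => h (.inr (.inr (.inr a))))

theorem exists_lift' (hp : DblCat.Emb p) (x : ∀ s, HorTrans A (D s)) (e : Ix A → E.Sq)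
    (he : ∀ s i, (p s).sq (e i) = (x s).cells i) :
    ∃ y : HorTrans A E, ∀ s, y.map (𝟙 A) (p s) = x s := by
  obtain ⟨F, hF⟩ := DblCat.exists_lift p hp.inj (fun s => (x s).dom) (fun a => e (.inl a))
    (fun s a => he s (.inl a))
  obtain ⟨G, hG⟩ := DblCat.exists_lift p hp.inj (fun s => (x s).cod) (fun a => e (.inr (.inl a)))
    (fun s a => he s (.inr (.inl a)))
  obtain ⟨y, _, _, h⟩ := exists_lift hp x F G
    (fun s => DblCat.hom_ext _ _ fun a => by
      refine Eq.trans ?_ (he s (.inl a)); rw [← hF]; rfl)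
    (fun s => DblCat.hom_ext _ _ fun a => by
      refine Eq.trans ?_ (he s (.inr (.inl a))); rw [← hG]; rfl)
    (fun u => e (.inr (.inr (.inl u)))) (fun s u => he s (.inr (.inr (.inl u))))
    (fun u => e (.inr (.inr (.inr u)))) (fun s u => he s (.inr (.inr (.inr u))))
  exact ⟨y, h⟩

end HorTrans

theorem DblCat.Emb.tr {S : Type w} {E : DblCat.{u}} {D : S → DblCat.{u}} {p : ∀ s, E ⟶ D s}
    (h : DblCat.Emb p) : DblCat.Emb (fun s => DblFunctor.tr (p s)) :=
  ⟨h.inj, h.vinv, h.hinv⟩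

theorem DblCat.Emb.cancel {S : Type w} {E : DblCat.{u}} {D : S → DblCat.{u}} {p : ∀ s, E ⟶ D s}
    (h : DblCat.Emb p) {A : DblCat.{u}} (F G : A ⟶ E) (e : ∀ s, F ≫ p s = G ≫ p s) : F = G :=
  DblCat.hom_ext _ _ fun a => h.inj _ _ fun s => congrArg (fun K => DblFunctor.sq K a) (e s)

namespace DblMod

/-- The cells of which a modification consists. -/
def Ix (A : DblCat.{u}) : Type u :=
  HorTrans.Ix A ⊕ HorTrans.Ix A ⊕ HorTrans.Ix A.tr ⊕ HorTrans.Ix A.tr ⊕ A.Ob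

/-- The cells of which a modification consists. -/
def cells {A B : DblCat.{u}} (x : DblMod A B) : Ix A → B.Sq
  | .inl a => x.top.cells a
  | .inr (.inl a) => x.bot.cells a
  | .inr (.inr (.inl a)) => x.left.cells a
  | .inr (.inr (.inr (.inl a))) => x.right.cells a
  | .inr (.inr (.inr (.inr a))) => x.app a

theorem ext_cells {A B : DblCat.{u}} {x y : DblMod A B} (h : ∀ i, x.cells i = y.cells i) : x = y :=
  DblMod.ext (HorTrans.ext_cells' fun a => h (.inl a)) (HorTrans.ext_cells' fun a => h (.inr (.inl a)))
    (HorTrans.ext_cells' fun a => h (.inr (.inr (.inl a))))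
    (HorTrans.ext_cells' fun a => h (.inr (.inr (.inr (.inl a)))))
    (funext fun a => h (.inr (.inr (.inr (.inr a)))))

variable {S : Type w} {A E : DblCat.{u}} {D : S → DblCat.{u}} {p : ∀ s, E ⟶ D s}

theorem exists_lift (hp : DblCat.Emb p) (x : ∀ s, DblMod A (D s)) (e : Ix A → E.Sq)
    (he : ∀ s i, (p s).sq (e i) = (x s).cells i) :
    ∃ y : DblMod A E, ∀ s, y.map (𝟙 A) (p s) = x s := by
  obtain ⟨ih, iv, io⟩ := DblCat.inj_cells hp.inj
  obtain ⟨t, ht⟩ := HorTrans.exists_lift' hp (fun s => (x s).top) _ (fun s i => he s (.inl i))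
  obtain ⟨b, hb⟩ := HorTrans.exists_lift' hp (fun s => (x s).bot) _ (fun s i => he s (.inr (.inl i)))
  obtain ⟨l, hl⟩ := HorTrans.exists_lift' hp.tr (fun s => (x s).left) _
    (fun s i => he s (.inr (.inr (.inl i))))
  obtain ⟨r, hr⟩ := HorTrans.exists_lift' hp.tr (fun s => (x s).right) _
    (fun s i => he s (.inr (.inr (.inr (.inl i)))))
  let m : A.Ob → E.Sq := fun a => e (.inr (.inr (.inr (.inr a))))
  have hm : ∀ s a, (p s).sq (m a) = (x s).app a := fun s a => he s (.inr (.inr (.inr (.inr a))))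
  have d₁ : l.dom = t.dom.tr := hp.tr.cancel _ _ fun s => by
    refine (congrArg HorTrans.dom (hl s)).trans ((x s).left_dom.trans ?_)
    exact congrArg (fun z => DblFunctor.tr (HorTrans.dom z)) (ht s).symm
  have d₂ : l.cod = b.dom.tr := hp.tr.cancel _ _ fun s => by
    refine (congrArg HorTrans.cod (hl s)).trans ((x s).left_cod.trans ?_)
    exact congrArg (fun z => DblFunctor.tr (HorTrans.dom z)) (hb s).symm
  have d₃ : r.dom = t.cod.tr := hp.tr.cancel _ _ fun s => by
    refine (congrArg HorTrans.dom (hr s)).trans ((x s).right_dom.trans ?_)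
    exact congrArg (fun z => DblFunctor.tr (HorTrans.cod z)) (ht s).symm
  have d₄ : r.cod = b.cod.tr := hp.tr.cancel _ _ fun s => by
    refine (congrArg HorTrans.cod (hr s)).trans ((x s).right_cod.trans ?_)
    exact congrArg (fun z => DblFunctor.tr (HorTrans.cod z)) (hb s).symm
  have c₁ : ∀ a, E.sqv.src (m a) = t.app a := fun a => ih _ _ fun s => by
    rw [← DblFunctor.sqv_src, hm, app_top, ← ht s]; rfl
  have c₂ : ∀ a, E.sqv.tgt (m a) = b.app a := fun a => ih _ _ fun s => by
    rw [← DblFunctor.sqv_tgt, hm, app_bot, ← hb s]; rfl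
  have c₃ : ∀ a, E.sqh.src (m a) = l.app a := fun a => iv _ _ fun s => by
    rw [← DblFunctor.sqh_src, hm, app_left, ← hl s]; rfl
  have c₄ : ∀ a, E.sqh.tgt (m a) = r.app a := fun a => iv _ _ fun s => by
    rw [← DblFunctor.sqh_tgt, hm, app_right, ← hr s]; rfl
  refine ⟨⟨t, b, l, r, m, d₁, d₂, d₃, d₄, c₁, c₂, c₃, c₄, fun h => ?_, fun u => ?_⟩, fun s => ?_⟩
  · refine hp.inj _ _ fun s => ?_
    have := (x s).natural_hor h
    rw [← hl s, ← hr s, ← hb s, ← ht s, ← hm, ← hm] at this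
    rw [DblFunctor.sqv_comp, DblFunctor.sqh_comp, DblFunctor.sqv_comp, DblFunctor.sqh_comp]
    · exact this
    all_goals simp [c₁, c₂, c₃, c₄, d₁, d₂, d₃, d₄]
  · refine hp.inj _ _ fun s => ?_
    have := (x s).natural_ver u
    rw [← hl s, ← hr s, ← hb s, ← ht s, ← hm, ← hm] at this
    rw [DblFunctor.sqh_comp, DblFunctor.sqv_comp, DblFunctor.sqh_comp, DblFunctor.sqv_comp]
    · exact this
    all_goals simp [c₁, c₂, c₃, c₄, d₁, d₂, d₃, d₄]
  · exact DblMod.ext (ht s) (hb s) (hl s) (hr s) (funext fun a => hm s a)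

end DblMod

theorem DblCat.isGood_ihom (A : DblCat.{0}) :
    CellCategory.IsGood (DblCat.ihomFunctor.obj (op A) ⋙ CellCategory.cells DblCat.{0}) :=
  ⟨DblMod.Ix A, fun _ x => DblMod.cells x, fun B C f r i => by
    rcases i with (i | i | i | i) | (i | i | i | i) | (i | i | i | i) | (i | i | i | i) | i <;> rfl,
    fun _ _ _ h => DblMod.ext_cells h, fun _ hp r e he => DblMod.exists_lift hp r e he⟩

namespace TwoCat

variable (B : TwoCat.{u})

@[simp] theorem src_src (x) : B.one.src (B.ver.src x) = B.hor.src x := B.isFun_src.src x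
@[simp] theorem src_tgt (x) : B.one.tgt (B.ver.src x) = B.hor.tgt x := B.isFun_src.tgt x
@[simp] theorem src_id (x) : B.ver.src (B.hor.id x) = B.one.id x := B.isFun_src.id x
@[simp] theorem src_comp (x y) (h : B.hor.tgt x = B.hor.src y) :
    B.ver.src (B.hor.comp x y) = B.one.comp (B.ver.src x) (B.ver.src y) := B.isFun_src.comp x y h
@[simp] theorem tgt_src (x) : B.one.src (B.ver.tgt x) = B.hor.src x := B.isFun_tgt.src x
@[simp] theorem tgt_tgt (x) : B.one.tgt (B.ver.tgt x) = B.hor.tgt x := B.isFun_tgt.tgt x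
@[simp] theorem tgt_id (x) : B.ver.tgt (B.hor.id x) = B.one.id x := B.isFun_tgt.id x
@[simp] theorem tgt_comp (x y) (h : B.hor.tgt x = B.hor.src y) :
    B.ver.tgt (B.hor.comp x y) = B.one.comp (B.ver.tgt x) (B.ver.tgt y) := B.isFun_tgt.comp x y h
@[simp] theorem id_src (x) : B.hor.src (B.ver.id x) = B.one.src x := B.isFun_id.src x
@[simp] theorem id_tgt (x) : B.hor.tgt (B.ver.id x) = B.one.tgt x := B.isFun_id.tgt x
@[simp] theorem id_id (x) : B.ver.id (B.one.id x) = B.hor.id x := B.isFun_id.id x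
@[simp] theorem id_comp (x y) (h : B.one.tgt x = B.one.src y) :
    B.ver.id (B.one.comp x y) = B.hor.comp (B.ver.id x) (B.ver.id y) := B.isFun_id.comp x y h
@[simp] theorem hsrc_comp (x y) (h : B.ver.tgt x = B.ver.src y) :
    B.hor.src (B.ver.comp x y) = B.hor.src x := by
  rw [← src_src, ← src_src, B.ver.src_comp _ _ h]
@[simp] theorem htgt_comp (x y) (h : B.ver.tgt x = B.ver.src y) :
    B.hor.tgt (B.ver.comp x y) = B.hor.tgt x := by
  rw [← src_tgt, ← src_tgt, B.ver.src_comp _ _ h]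

theorem id_hcomp_id (f g : B.Hom) (h : B.one.tgt f = B.one.src g) :
    B.hor.comp (B.ver.id f) (B.ver.id g) = B.ver.id (B.one.comp f g) := (B.id_comp f g h).symm

theorem wl_comp (f : B.Hom) (a b : B.Cell) (h : B.ver.tgt a = B.ver.src b)
    (h₁ : B.one.tgt f = B.hor.src a) :
    B.hor.comp (B.ver.id f) (B.ver.comp a b) =
      B.ver.comp (B.hor.comp (B.ver.id f) a) (B.hor.comp (B.ver.id f) b) := by
  have h₂ : B.one.tgt f = B.hor.src b := by rw [h₁, ← tgt_src, h, src_src]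
  rw [← B.interchange _ _ _ _ (by simp) h (by simp [h₁]) (by simp [h₂]), B.ver.id_id]

theorem wr_comp (f : B.Hom) (a b : B.Cell) (h : B.ver.tgt a = B.ver.src b)
    (h₁ : B.hor.tgt a = B.one.src f) :
    B.hor.comp (B.ver.comp a b) (B.ver.id f) =
      B.ver.comp (B.hor.comp a (B.ver.id f)) (B.hor.comp b (B.ver.id f)) := by
  have h₂ : B.hor.tgt b = B.one.src f := by rw [← h₁, ← src_tgt B b, ← h, tgt_tgt]
  rw [← B.interchange _ _ _ _ h (by simp) (by simp [h₁]) (by simp [h₂]), B.ver.id_id]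

theorem exch (a b : B.Cell) (h : B.hor.tgt a = B.hor.src b) :
    B.ver.comp (B.hor.comp a (B.ver.id (B.ver.src b))) (B.hor.comp (B.ver.id (B.ver.tgt a)) b) =
    B.ver.comp (B.hor.comp (B.ver.id (B.ver.src a)) b) (B.hor.comp a (B.ver.id (B.ver.tgt b))) := by
  rw [← B.interchange _ _ _ _ (by simp) (by simp) (by simp [h]) (by simp [h]),
    ← B.interchange _ _ _ _ (by simp) (by simp) (by simp [h]) (by simp [h])]
  simp

theorem isInv_hcomp {B : TwoCat.{u}} {a b : B.Cell} (ha : B.ver.IsInv a) (hb : B.ver.IsInv b)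
    (h : B.hor.tgt a = B.hor.src b) : B.ver.IsInv (B.hor.comp a b) := by
  obtain ⟨a', i₁, i₂, i₃, i₄⟩ := ha
  obtain ⟨b', k₁, k₂, k₃, k₄⟩ := hb
  have ea : B.hor.tgt a' = B.hor.tgt a := by rw [← src_tgt, i₁, tgt_tgt]
  have eb : B.hor.src b' = B.hor.src b := by rw [← src_src, k₁, tgt_src]
  refine ⟨B.hor.comp a' b', ?_, ?_, ?_, ?_⟩
  · simp [*]
  · simp [*]
  · rw [← B.interchange _ _ _ _ i₁.symm k₁.symm (by simp [*]) (by simp [*]), i₃, k₃]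
    simp [*]
  · rw [← B.interchange _ _ _ _ i₂ k₂ (by simp [*]) (by simp [*]), i₄, k₄]
    simp [*]

end TwoCat

namespace TwoFunctor

variable {A B : TwoCat.{u}} (F : A ⟶ B)

@[simp] theorem one_src (x) : B.one.src (TwoFunctor.hom F x) = TwoFunctor.ob F (A.one.src x) :=
  F.isFun_one.src x
@[simp] theorem one_tgt (x) : B.one.tgt (TwoFunctor.hom F x) = TwoFunctor.ob F (A.one.tgt x) :=
  F.isFun_one.tgt x
@[simp] theorem one_id (x) : TwoFunctor.hom F (A.one.id x) = B.one.id (TwoFunctor.ob F x) :=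
  F.isFun_one.id x
@[simp] theorem one_comp (x y) (h : A.one.tgt x = A.one.src y) :
    TwoFunctor.hom F (A.one.comp x y) = B.one.comp (TwoFunctor.hom F x) (TwoFunctor.hom F y) :=
  F.isFun_one.comp x y h
@[simp] theorem hor_src (x) : B.hor.src (TwoFunctor.cell F x) = TwoFunctor.ob F (A.hor.src x) :=
  F.isFun_hor.src x
@[simp] theorem hor_tgt (x) : B.hor.tgt (TwoFunctor.cell F x) = TwoFunctor.ob F (A.hor.tgt x) :=
  F.isFun_hor.tgt x
@[simp] theorem hor_id (x) : TwoFunctor.cell F (A.hor.id x) = B.hor.id (TwoFunctor.ob F x) :=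
  F.isFun_hor.id x
@[simp] theorem hor_comp (x y) (h : A.hor.tgt x = A.hor.src y) :
    TwoFunctor.cell F (A.hor.comp x y) = B.hor.comp (TwoFunctor.cell F x) (TwoFunctor.cell F y) :=
  F.isFun_hor.comp x y h
@[simp] theorem ver_src (x) : B.ver.src (TwoFunctor.cell F x) = TwoFunctor.hom F (A.ver.src x) :=
  F.isFun_ver.src x
@[simp] theorem ver_tgt (x) : B.ver.tgt (TwoFunctor.cell F x) = TwoFunctor.hom F (A.ver.tgt x) :=
  F.isFun_ver.tgt x
@[simp] theorem ver_id (x) : TwoFunctor.cell F (A.ver.id x) = B.ver.id (TwoFunctor.hom F x) :=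
  F.isFun_ver.id x
@[simp] theorem ver_comp (x y) (h : A.ver.tgt x = A.ver.src y) :
    TwoFunctor.cell F (A.ver.comp x y) = B.ver.comp (TwoFunctor.cell F x) (TwoFunctor.cell F y) :=
  F.isFun_ver.comp x y h

end TwoFunctor

/-- A lax natural transformation between 2-functors, with components `app a` and
`nat h : (dom h) ≫ app b ⟶ app a ≫ (cod h)` for `h : a ⟶ b`. -/
@[ext]
structure LaxTrans (A B : TwoCat.{u}) where
  dom : A ⟶ B
  cod : A ⟶ B
  app : A.Ob → B.Hom
  nat : A.Hom → B.Cell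
  app_src : ∀ a, B.one.src (app a) = dom.ob a
  app_tgt : ∀ a, B.one.tgt (app a) = cod.ob a
  nat_src : ∀ h, B.ver.src (nat h) = B.one.comp (dom.hom h) (app (A.one.tgt h))
  nat_tgt : ∀ h, B.ver.tgt (nat h) = B.one.comp (app (A.one.src h)) (cod.hom h)
  nat_id : ∀ a, nat (A.one.id a) = B.ver.id (app a)
  nat_comp : ∀ h k, A.one.tgt h = A.one.src k → nat (A.one.comp h k) =
    B.ver.comp (B.hor.comp (B.ver.id (dom.hom h)) (nat k))
      (B.hor.comp (nat h) (B.ver.id (cod.hom k)))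
  natural : ∀ x,
    B.ver.comp (B.hor.comp (dom.cell x) (B.ver.id (app (A.hor.tgt x)))) (nat (A.ver.tgt x)) =
      B.ver.comp (nat (A.ver.src x)) (B.hor.comp (B.ver.id (app (A.hor.src x))) (cod.cell x))

attribute [simp] LaxTrans.app_src LaxTrans.app_tgt LaxTrans.nat_src LaxTrans.nat_tgt
  LaxTrans.nat_id

namespace LaxTrans

variable {A B : TwoCat.{u}} (x y z : LaxTrans A B)

@[simp] theorem nat_hsrc (h) : B.hor.src (x.nat h) = x.dom.ob (A.one.src h) := by
  rw [← TwoCat.src_src, nat_src, CatOn.src_comp] <;> simp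
@[simp] theorem nat_htgt (h) : B.hor.tgt (x.nat h) = x.cod.ob (A.one.tgt h) := by
  rw [← TwoCat.src_tgt, nat_src, CatOn.tgt_comp] <;> simp

/-- The identity transformation. -/
def idt (F : A ⟶ B) : LaxTrans A B where
  dom := F
  cod := F
  app a := B.one.id (F.ob a)
  nat h := B.ver.id (F.hom h)
  app_src a := by simp
  app_tgt a := by simp
  nat_src h := by simp
  nat_tgt h := by simp
  nat_id a := by simp
  nat_comp h k e := by rw [← B.id_comp _ _ (by simp [e])]; simp [e, -TwoCat.id_comp]
  natural x := by simp

/-- Composition of transformations. -/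
def comp (e : x.cod = y.dom) : LaxTrans A B where
  dom := x.dom
  cod := y.cod
  app a := B.one.comp (x.app a) (y.app a)
  nat h := B.ver.comp (B.hor.comp (x.nat h) (B.ver.id (y.app (A.one.tgt h))))
    (B.hor.comp (B.ver.id (x.app (A.one.src h))) (y.nat h))
  app_src a := by simp [e]
  app_tgt a := by simp [e]
  nat_src h := by simp [e, CatOn.assoc]
  nat_tgt h := by simp [e, CatOn.assoc]
  nat_id a := by
    rw [x.nat_id, y.nat_id, A.one.src_id, A.one.tgt_id, ← B.id_comp _ _ (by simp [e]), CatOn.id_id]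
  nat_comp h k H := by
    simp [e, CatOn.assoc, nat_comp, H, TwoCat.wl_comp, TwoCat.wr_comp]
    have := B.exch (x.nat h) (y.nat k) (by simp [e, H])
    apply CatOn.assoc4
    · simpa [e, H, CatOn.assoc] using this
    all_goals simp [e, H, CatOn.assoc]
  natural s := by
    have hx := x.natural s
    have hy := y.natural s
    have e₁ := B.wr_comp (y.app (A.hor.tgt s)) (B.hor.comp (x.dom.cell s) (B.ver.id (x.app (A.hor.tgt s))))
      (x.nat (A.ver.tgt s)) (by simp) (by simp [e])
    have e₂ := B.wr_comp (y.app (A.hor.tgt s)) (x.nat (A.ver.src s))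
      (B.hor.comp (B.ver.id (x.app (A.hor.src s))) (x.cod.cell s)) (by simp) (by simp [e])
    have e₃ := B.wl_comp (x.app (A.hor.src s)) (B.hor.comp (y.dom.cell s) (B.ver.id (y.app (A.hor.tgt s))))
      (y.nat (A.ver.tgt s)) (by simp) (by simp [e])
    have e₄ := B.wl_comp (x.app (A.hor.src s)) (y.nat (A.ver.src s))
      (B.hor.comp (B.ver.id (y.app (A.hor.src s))) (y.cod.cell s)) (by simp) (by simp [e])
    rw [hx] at e₁
    rw [hy] at e₃
    simp [e, CatOn.assoc] at e₁ e₂ e₃ e₄ ⊢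
    refine CatOn.assoc_swap _ (e₁.symm.trans e₂) (e₃.symm.trans e₄) ?_ ?_ ?_ ?_ ?_ ?_ <;>
      simp [e, CatOn.assoc]

theorem id_comp' (F : A ⟶ B) (x : LaxTrans A B) (e : (idt F).cod = x.dom) :
    (idt F).comp x e = x := by
  obtain rfl : F = x.dom := e
  refine LaxTrans.ext rfl rfl ?_ ?_ <;> funext a <;>
    simp [LaxTrans.comp, LaxTrans.idt, TwoCat.id_hcomp_id, -TwoCat.id_comp]

theorem comp_id' (F : A ⟶ B) (x : LaxTrans A B) (e : x.cod = (idt F).dom) :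
    x.comp (idt F) e = x := by
  obtain rfl : x.cod = F := e
  refine LaxTrans.ext rfl rfl ?_ ?_ <;> funext a <;>
    simp [LaxTrans.comp, LaxTrans.idt, TwoCat.id_hcomp_id, -TwoCat.id_comp]

theorem assoc' (e : x.cod = y.dom) (e₁ : y.cod = z.dom) (h h') :
    (x.comp y e).comp z h = x.comp (y.comp z e₁) h' := by
  refine LaxTrans.ext rfl rfl ?_ ?_ <;> funext a
  · simp [LaxTrans.comp, CatOn.assoc, e, e₁]
  · simp [LaxTrans.comp, CatOn.assoc, e, e₁, TwoCat.wl_comp, TwoCat.wr_comp]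
    apply CatOn.assoc <;> simp [e, e₁, CatOn.assoc]

/-- The whiskering of a transformation with 2-functors on both sides. -/
def map {A' B' : TwoCat.{u}} (F : A' ⟶ A) (G : B ⟶ B') (x : LaxTrans A B) : LaxTrans A' B' where
  dom := F ≫ x.dom ≫ G
  cod := F ≫ x.cod ≫ G
  app a := TwoFunctor.hom G (x.app (TwoFunctor.ob F a))
  nat h := TwoFunctor.cell G (x.nat (TwoFunctor.hom F h))
  app_src a := by simp; rfl
  app_tgt a := by simp; rfl
  nat_src h := by simp; rfl
  nat_tgt h := by simp; rfl
  nat_id a := by simp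
  nat_comp h k e := by
    have e' : A.one.tgt (TwoFunctor.hom F h) = A.one.src (TwoFunctor.hom F k) := by simp [e]
    have h₁ := congrArg (TwoFunctor.cell G) (x.nat_comp _ _ e')
    rw [← TwoFunctor.one_comp F _ _ e] at h₁
    rw [TwoFunctor.ver_comp, TwoFunctor.hor_comp, TwoFunctor.hor_comp,
      TwoFunctor.ver_id, TwoFunctor.ver_id] at h₁
    · exact h₁
    all_goals simp [e, CatOn.assoc]
  natural s := by
    have h := congrArg (TwoFunctor.cell G) (x.natural (TwoFunctor.cell F s))
    simp at h
    exact h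

end LaxTrans

/-- A modification between lax natural transformations. -/
@[ext]
structure Modification (A B : TwoCat.{u}) where
  dom : LaxTrans A B
  cod : LaxTrans A B
  app : A.Ob → B.Cell
  dom_dom : dom.dom = cod.dom
  dom_cod : dom.cod = cod.cod
  app_src : ∀ a, B.ver.src (app a) = dom.app a
  app_tgt : ∀ a, B.ver.tgt (app a) = cod.app a
  natural : ∀ h : A.Hom,
    B.ver.comp (B.hor.comp (B.ver.id (dom.dom.hom h)) (app (A.one.tgt h))) (cod.nat h) =
      B.ver.comp (dom.nat h) (B.hor.comp (app (A.one.src h)) (B.ver.id (dom.cod.hom h)))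

attribute [simp] Modification.app_src Modification.app_tgt

namespace Modification

variable {A B : TwoCat.{u}} (m n l : Modification A B)

@[simp] theorem app_hsrc (a) : B.hor.src (m.app a) = m.dom.dom.ob a := by
  rw [← TwoCat.src_src, app_src, LaxTrans.app_src]
@[simp] theorem app_htgt (a) : B.hor.tgt (m.app a) = m.dom.cod.ob a := by
  rw [← TwoCat.src_tgt, app_src, LaxTrans.app_tgt]

/-- The identity modification. -/
def idm (x : LaxTrans A B) : Modification A B where
  dom := x
  cod := x
  app a := B.ver.id (x.app a)
  dom_dom := rfl
  dom_cod := rfl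
  app_src a := by simp
  app_tgt a := by simp
  natural h := by
    rw [TwoCat.id_hcomp_id _ _ _ (by simp), TwoCat.id_hcomp_id _ _ _ (by simp),
      CatOn.id_comp_of _ _ _ (by simp), CatOn.comp_id_of _ _ _ (by simp)]

/-- The vertical composite of modifications. -/
def vcomp (e : m.cod = n.dom) : Modification A B where
  dom := m.dom
  cod := n.cod
  app a := B.ver.comp (m.app a) (n.app a)
  dom_dom := by rw [m.dom_dom, e, n.dom_dom]
  dom_cod := by rw [m.dom_cod, e, n.dom_cod]
  app_src a := by simp [e]
  app_tgt a := by simp [e]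
  natural h := by
    have hm := m.natural h
    have hn := n.natural h
    have e₁ := m.dom_dom
    have e₂ := m.dom_cod
    have e₃ := n.dom_dom
    have e₄ := n.dom_cod
    rw [TwoCat.wl_comp _ _ _ _ (by simp [e]) (by simp), TwoCat.wr_comp _ _ _ _ (by simp [e]) (by simp),
      CatOn.assoc, e₁, e, hn, ← CatOn.assoc, ← e, ← e₁, hm, CatOn.assoc, e₂, e] <;>
      simp [e, e₁, e₂, e₃, e₄]

theorem dom_eq_of_cod_eq {m n : Modification A B} (e : m.dom.cod = n.dom.dom) :
    m.cod.cod = n.cod.dom := by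
  rw [← m.dom_cod, e, n.dom_dom]

/-- The horizontal composite of modifications. -/
def hcomp (e : m.dom.cod = n.dom.dom) : Modification A B where
  dom := m.dom.comp n.dom e
  cod := m.cod.comp n.cod (dom_eq_of_cod_eq e)
  app a := B.hor.comp (m.app a) (n.app a)
  dom_dom := m.dom_dom
  dom_cod := n.dom_cod
  app_src a := by simp [e, LaxTrans.comp]
  app_tgt a := by simp [e, LaxTrans.comp]
  natural h := by
    have hm := m.natural h
    have hn := n.natural h
    have e₁ := m.dom_dom
    have e₂ := m.dom_cod
    have e₃ := n.dom_dom
    have e₄ := n.dom_cod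
    have i₁ := B.interchange (B.hor.comp (B.ver.id (m.dom.dom.hom h)) (m.app (A.one.tgt h)))
      (m.cod.nat h) (n.app (A.one.tgt h)) (B.ver.id (n.cod.app (A.one.tgt h)))
    have i₂ := B.interchange (m.dom.nat h)
      (B.hor.comp (m.app (A.one.src h)) (B.ver.id (m.dom.cod.hom h)))
      (B.ver.id (n.dom.app (A.one.tgt h))) (n.app (A.one.tgt h))
    have i₃ := B.interchange (m.app (A.one.src h)) (B.ver.id (m.cod.app (A.one.src h)))
      (B.hor.comp (B.ver.id (n.dom.dom.hom h)) (n.app (A.one.tgt h))) (n.cod.nat h)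
    have i₄ := B.interchange (B.ver.id (m.dom.app (A.one.src h))) (m.app (A.one.src h))
      (n.dom.nat h) (B.hor.comp (n.app (A.one.src h)) (B.ver.id (n.dom.cod.hom h)))
    rw [hm] at i₁
    rw [hn] at i₃
    simp [e, ← e₁, ← e₂, ← e₃, ← e₄, CatOn.assoc, LaxTrans.comp] at i₁ i₂ i₃ i₄ ⊢
    refine CatOn.assoc_swap _ (i₁.symm.trans i₂) (i₃.symm.trans i₄) ?_ ?_ ?_ ?_ ?_ ?_ <;>
      simp [e, ← e₁, ← e₂, ← e₃, ← e₄, CatOn.assoc]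

/-- The whiskering of a modification with 2-functors on both sides. -/
def map {A' B' : TwoCat.{u}} (F : A' ⟶ A) (G : B ⟶ B') (m : Modification A B) :
    Modification A' B' where
  dom := m.dom.map F G
  cod := m.cod.map F G
  app a := TwoFunctor.cell G (m.app (TwoFunctor.ob F a))
  dom_dom := congrArg (fun K => F ≫ K ≫ G) m.dom_dom
  dom_cod := congrArg (fun K => F ≫ K ≫ G) m.dom_cod
  app_src a := by simp; rfl
  app_tgt a := by simp; rfl
  natural s := by
    have h := congrArg (TwoFunctor.cell G) (m.natural (TwoFunctor.hom F s))
    rw [TwoFunctor.ver_comp, TwoFunctor.hor_comp, TwoFunctor.ver_comp, TwoFunctor.hor_comp,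
      TwoFunctor.ver_id, TwoFunctor.ver_id, TwoFunctor.one_tgt F, TwoFunctor.one_src F] at h
    · exact h
    all_goals simp [m.dom_dom, m.dom_cod]

end Modification

namespace LaxTrans

theorem comp_assoc' {A B : TwoCat.{u}} (x y z : LaxTrans A B) (e : x.cod = y.dom) (e₁ : y.cod = z.dom) (h h') :
    (x.comp y e).comp z h = x.comp (y.comp z e₁) h' := assoc' x y z e e₁ h h'

theorem map_idt {A A' B B' : TwoCat.{u}} (F : A' ⟶ A) (G : B ⟶ B') (K : A ⟶ B) :
    (idt K).map F G = idt (F ≫ K ≫ G) := by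
  refine LaxTrans.ext rfl rfl ?_ ?_ <;> funext x
  · exact G.isFun_one.id _
  · exact G.isFun_ver.id _

theorem map_comp {A A' B B' : TwoCat.{u}} (F : A' ⟶ A) (G : B ⟶ B') (x y : LaxTrans A B)
    (e : x.cod = y.dom) :
    (x.comp y e).map F G = (x.map F G).comp (y.map F G) (congrArg (fun K => F ≫ K ≫ G) e) := by
  refine LaxTrans.ext rfl rfl ?_ ?_ <;> funext a
  · simp [map, comp, e]
  · simp [map, comp, e, CatOn.assoc]

theorem ext_cells {A B : TwoCat.{u}} {x y : LaxTrans A B} (h₁ : ∀ a, x.dom.cell a = y.dom.cell a)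
    (h₂ : ∀ a, x.cod.cell a = y.cod.cell a) (h₄ : ∀ a, x.nat a = y.nat a) : x = y := by
  refine LaxTrans.ext (TwoCat.hom_ext _ _ h₁) (TwoCat.hom_ext _ _ h₂) (funext fun a => ?_)
    (funext h₄)
  rw [← B.ver.src_id (x.app a), ← B.ver.src_id (y.app a), ← x.nat_id, ← y.nat_id, h₄]

/-- The cells of which a transformation consists. -/
def Ix (A : TwoCat.{u}) : Type u := A.Cell ⊕ A.Cell ⊕ A.Hom

/-- The cells of which a transformation consists. -/
def cells {A B : TwoCat.{u}} (x : LaxTrans A B) : Ix A → B.Cell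
  | .inl a => x.dom.cell a
  | .inr (.inl a) => x.cod.cell a
  | .inr (.inr u) => x.nat u

theorem ext_cells' {A B : TwoCat.{u}} {x y : LaxTrans A B} (h : ∀ i, x.cells i = y.cells i) :
    x = y :=
  ext_cells (fun a => h (.inl a)) (fun a => h (.inr (.inl a))) (fun a => h (.inr (.inr a)))

variable {S : Type w} {A E : TwoCat.{u}} {D : S → TwoCat.{u}} {p : ∀ s, E ⟶ D s}

theorem exists_lift (hp : TwoCat.Emb p) (x : ∀ s, LaxTrans A (D s)) (e : Ix A → E.Cell)
    (he : ∀ s i, (p s).cell (e i) = (x s).cells i) :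
    ∃ y : LaxTrans A E, ∀ s, y.map (𝟙 A) (p s) = x s := by
  obtain ⟨ih, io⟩ := TwoCat.inj_cells hp.inj
  obtain ⟨F, hF⟩ := TwoCat.exists_lift p hp.inj (fun s => (x s).dom) (fun a => e (.inl a))
    (fun s a => he s (.inl a))
  obtain ⟨G, hG⟩ := TwoCat.exists_lift p hp.inj (fun s => (x s).cod) (fun a => e (.inr (.inl a)))
    (fun s a => he s (.inr (.inl a)))
  have hF : ∀ s, F ≫ p s = (x s).dom := fun s => TwoCat.hom_ext _ _ fun a => by
    refine Eq.trans ?_ (he s (.inl a)); rw [← hF]; rfl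
  have hG : ∀ s, G ≫ p s = (x s).cod := fun s => TwoCat.hom_ext _ _ fun a => by
    refine Eq.trans ?_ (he s (.inr (.inl a))); rw [← hG]; rfl
  let kN : A.Hom → E.Cell := fun u => e (.inr (.inr u))
  have hN : ∀ s h, (p s).cell (kN h) = (x s).nat h := fun s u => he s (.inr (.inr u))
  have Fo : ∀ s a, (p s).ob (F.ob a) = (x s).dom.ob a := fun s a => by rw [← hF]; rfl
  have Fh : ∀ s a, (p s).hom (F.hom a) = (x s).dom.hom a := fun s a => by rw [← hF]; rfl
  have Fs : ∀ s a, (p s).cell (F.cell a) = (x s).dom.cell a := fun s a => by rw [← hF]; rfl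
  have Go : ∀ s a, (p s).ob (G.ob a) = (x s).cod.ob a := fun s a => by rw [← hG]; rfl
  have Gh : ∀ s a, (p s).hom (G.hom a) = (x s).cod.hom a := fun s a => by rw [← hG]; rfl
  have Gs : ∀ s a, (p s).cell (G.cell a) = (x s).cod.cell a := fun s a => by rw [← hG]; rfl
  let app : A.Ob → E.Hom := fun a => E.ver.src (kN (A.one.id a))
  have hA : ∀ s a, (p s).hom (app a) = (x s).app a := fun s a => by
    rw [← TwoFunctor.ver_src, hN, (x s).nat_id, CatOn.src_id]
  have c₁ : ∀ a, E.one.src (app a) = F.ob a := fun a => io _ _ fun s => by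
    rw [← TwoFunctor.one_src, hA, app_src, Fo]
  have c₂ : ∀ a, E.one.tgt (app a) = G.ob a := fun a => io _ _ fun s => by
    rw [← TwoFunctor.one_tgt, hA, app_tgt, Go]
  have c₆ : ∀ h, E.ver.src (kN h) = E.one.comp (F.hom h) (app (A.one.tgt h)) := fun u =>
    ih _ _ fun s => by
    rw [← TwoFunctor.ver_src, hN, nat_src, TwoFunctor.one_comp _ _ _ (by simp [c₁]), Fh, hA]
  have c₇ : ∀ h, E.ver.tgt (kN h) = E.one.comp (app (A.one.src h)) (G.hom h) := fun u =>
    ih _ _ fun s => by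
    rw [← TwoFunctor.ver_tgt, hN, nat_tgt, TwoFunctor.one_comp _ _ _ (by simp [c₂]), Gh, hA]
  have c₈ : ∀ h, E.hor.src (kN h) = F.ob (A.one.src h) := fun u => by
    rw [← TwoCat.src_src, c₆, CatOn.src_comp _ _ _ (by simp [c₁]), TwoFunctor.one_src]
  have c₉ : ∀ h, E.hor.tgt (kN h) = G.ob (A.one.tgt h) := fun u => by
    rw [← TwoCat.src_tgt, c₆, CatOn.tgt_comp _ _ _ (by simp [c₁]), c₂]
  refine ⟨⟨F, G, app, kN, c₁, c₂, c₆, c₇, fun a => ?_,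
    fun h k e => ?_, fun z => ?_⟩, fun s => ?_⟩
  · exact hp.inj _ _ fun s => by rw [hN, nat_id, TwoFunctor.ver_id, hA]
  · refine hp.inj _ _ fun s => ?_
    rw [hN, (x s).nat_comp _ _ e, TwoFunctor.ver_comp, TwoFunctor.hor_comp, TwoFunctor.hor_comp,
      TwoFunctor.ver_id, TwoFunctor.ver_id, hN, hN, Fh, Gh] <;>
    simp [c₁, c₂, c₆, c₇, c₈, c₉, e, CatOn.assoc]
  · refine hp.inj _ _ fun s => ?_
    have := (x s).natural z
    rw [← Fs, ← hA, ← hN, ← Gs, ← hA, ← hN] at this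
    rw [TwoFunctor.ver_comp, TwoFunctor.hor_comp, TwoFunctor.ver_comp, TwoFunctor.hor_comp,
      TwoFunctor.ver_id, TwoFunctor.ver_id]
    · exact this
    all_goals simp [c₁, c₂, c₆, c₇, c₈, c₉, CatOn.assoc]
  · exact ext_cells (fun a => Fs s a) (fun a => Gs s a) (fun a => hN s a)

end LaxTrans

theorem TwoCat.Emb.cancel {S : Type w} {E : TwoCat.{u}} {D : S → TwoCat.{u}} {p : ∀ s, E ⟶ D s}
    (h : TwoCat.Emb p) {A : TwoCat.{u}} (F G : A ⟶ E) (e : ∀ s, F ≫ p s = G ≫ p s) : F = G :=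
  TwoCat.hom_ext _ _ fun a => h.inj _ _ fun s => congrArg (fun K => TwoFunctor.cell K a) (e s)

namespace Modification

/-- The cells of which a modification consists. -/
def Ix (A : TwoCat.{u}) : Type u := LaxTrans.Ix A ⊕ LaxTrans.Ix A ⊕ A.Ob

/-- The cells of which a modification consists. -/
def cells {A B : TwoCat.{u}} (x : Modification A B) : Ix A → B.Cell
  | .inl a => x.dom.cells a
  | .inr (.inl a) => x.cod.cells a
  | .inr (.inr a) => x.app a

theorem ext_cells {A B : TwoCat.{u}} {x y : Modification A B} (h : ∀ i, x.cells i = y.cells i) :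
    x = y :=
  Modification.ext (LaxTrans.ext_cells' fun a => h (.inl a))
    (LaxTrans.ext_cells' fun a => h (.inr (.inl a))) (funext fun a => h (.inr (.inr a)))

variable {S : Type w} {A E : TwoCat.{u}} {D : S → TwoCat.{u}} {p : ∀ s, E ⟶ D s}

theorem exists_lift (hp : TwoCat.Emb p) (x : ∀ s, Modification A (D s)) (e : Ix A → E.Cell)
    (he : ∀ s i, (p s).cell (e i) = (x s).cells i) :
    ∃ y : Modification A E, ∀ s, y.map (𝟙 A) (p s) = x s := by
  obtain ⟨ih, io⟩ := TwoCat.inj_cells hp.inj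
  obtain ⟨t, ht⟩ := LaxTrans.exists_lift hp (fun s => (x s).dom) _ (fun s i => he s (.inl i))
  obtain ⟨b, hb⟩ := LaxTrans.exists_lift hp (fun s => (x s).cod) _ (fun s i => he s (.inr (.inl i)))
  let m : A.Ob → E.Cell := fun a => e (.inr (.inr a))
  have hm : ∀ s a, (p s).cell (m a) = (x s).app a := fun s a => he s (.inr (.inr a))
  have d₁ : t.dom = b.dom := hp.cancel _ _ fun s => by
    refine (congrArg LaxTrans.dom (ht s)).trans ((x s).dom_dom.trans ?_)
    exact congrArg (fun z => (LaxTrans.dom z)) (hb s).symm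
  have d₂ : t.cod = b.cod := hp.cancel _ _ fun s => by
    refine (congrArg LaxTrans.cod (ht s)).trans ((x s).dom_cod.trans ?_)
    exact congrArg (fun z => (LaxTrans.cod z)) (hb s).symm
  have c₁ : ∀ a, E.ver.src (m a) = t.app a := fun a => ih _ _ fun s => by
    rw [← TwoFunctor.ver_src, hm, app_src, ← ht s]; rfl
  have c₂ : ∀ a, E.ver.tgt (m a) = b.app a := fun a => ih _ _ fun s => by
    rw [← TwoFunctor.ver_tgt, hm, app_tgt, ← hb s]; rfl
  have c₃ : ∀ a, E.hor.src (m a) = t.dom.ob a := fun a => by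
    rw [← TwoCat.src_src, c₁, LaxTrans.app_src]
  have c₄ : ∀ a, E.hor.tgt (m a) = t.cod.ob a := fun a => by
    rw [← TwoCat.src_tgt, c₁, LaxTrans.app_tgt]
  refine ⟨⟨t, b, m, d₁, d₂, c₁, c₂, fun h => ?_⟩, fun s => ?_⟩
  · refine hp.inj _ _ fun s => ?_
    have := (x s).natural h
    rw [← hb s, ← ht s, ← hm, ← hm] at this
    rw [TwoFunctor.ver_comp, TwoFunctor.hor_comp, TwoFunctor.ver_comp, TwoFunctor.hor_comp,
      TwoFunctor.ver_id, TwoFunctor.ver_id]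
    · exact this
    all_goals simp [c₁, c₂, c₃, c₄, d₁, d₂]
  · exact Modification.ext (ht s) (hb s) (funext fun a => hm s a)

end Modification

/-- A class of lax natural transformations which determines a locally full sub-2-category of the
2-category of 2-functors, lax natural transformations and modifications. -/
structure TransClass where
  mem : ∀ {A B : TwoCat.{u}}, LaxTrans A B → Prop
  mem_idt : ∀ {A B : TwoCat.{u}} (F : A ⟶ B), mem (.idt F)
  mem_comp : ∀ {A B : TwoCat.{u}} (x y : LaxTrans A B) (e : x.cod = y.dom), mem x → mem y →
    mem (x.comp y e)
  mem_map : ∀ {A A' B B' : TwoCat.{u}} (F : A' ⟶ A) (G : B ⟶ B') (x : LaxTrans A B), mem x →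
    mem (x.map F G)
  mem_of_emb : ∀ {S : Type (u + 1)} {A E : TwoCat.{u}} {D : S → TwoCat.{u}} (p : ∀ s, E ⟶ D s),
    TwoCat.Emb p → ∀ x : LaxTrans A E, (∀ s, mem (x.map (𝟙 A) (p s))) → mem x

/-- Pseudonatural transformations. -/
def TransClass.pseudo : TransClass.{u} where
  mem {_ B} x := ∀ h, B.ver.IsInv (x.nat h)
  mem_idt F h := CatOn.isInv_id _ _
  mem_comp x y e hx hy h := by
    refine CatOn.IsInv.comp (TwoCat.isInv_hcomp (hx h) (CatOn.isInv_id _ _) ?_)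
      (TwoCat.isInv_hcomp (CatOn.isInv_id _ _) (hy h) ?_) ?_ <;> simp [e, CatOn.assoc]
  mem_map F G x hx h := G.isFun_ver.isInv (hx _)
  mem_of_emb p hp x hx h := hp.inv _ fun s => hx s h

/-- Icons: lax natural transformations whose components are identities. -/
def TransClass.icon : TransClass.{u} where
  mem {_ B} x := ∀ a, x.app a = B.one.id (x.dom.ob a)
  mem_idt F h := rfl
  mem_comp x y e hx hy a := by
    have := x.app_tgt a
    rw [hx, CatOn.tgt_id] at this
    simp [LaxTrans.comp, hx, hy, ← e, ← this]
  mem_map F G x hx h := by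
    refine (congrArg (TwoFunctor.hom G) (hx _)).trans (G.isFun_one.id _)
  mem_of_emb p hp x hx a := by
    refine (TwoCat.inj_cells hp.inj).1 _ _ fun s => ?_
    rw [TwoFunctor.one_id]
    exact hx s a

namespace Modification

variable {A B : TwoCat.{u}}

theorem idm_vcomp (x : LaxTrans A B) (m : Modification A B) (e : (idm x).cod = m.dom) :
    (idm x).vcomp m e = m := by
  cases (show x = m.dom from e)
  exact Modification.ext rfl rfl (funext fun a => by simp [vcomp, idm])

theorem vcomp_idm (x : LaxTrans A B) (m : Modification A B) (e : m.cod = (idm x).dom) :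
    m.vcomp (idm x) e = m := by
  cases (show m.cod = x from e)
  exact Modification.ext rfl rfl (funext fun a => by simp [vcomp, idm])

theorem vcomp_assoc (x y z : Modification A B) (e : x.cod = y.dom) (e₁ : y.cod = z.dom) (h h') :
    (x.vcomp y e).vcomp z h = x.vcomp (y.vcomp z e₁) h' :=
  Modification.ext rfl rfl (funext fun a => by apply CatOn.assoc <;> simp [e, e₁])

theorem idt_hcomp (F : A ⟶ B) (m : Modification A B) (e : (idm (.idt F)).dom.cod = m.dom.dom) :
    (idm (.idt F)).hcomp m e = m :=
  Modification.ext (LaxTrans.id_comp' _ _ e) (LaxTrans.id_comp' _ _ (dom_eq_of_cod_eq e))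
    (funext fun a => by
      have e' : F = m.dom.dom := e
      simp [hcomp, idm, LaxTrans.idt, e'])

theorem hcomp_idt (F : A ⟶ B) (m : Modification A B) (e : m.dom.cod = (idm (.idt F)).dom.dom) :
    m.hcomp (idm (.idt F)) e = m :=
  Modification.ext (LaxTrans.comp_id' _ _ e) (LaxTrans.comp_id' _ _ (dom_eq_of_cod_eq e))
    (funext fun a => by
      have e' : m.dom.cod = F := e
      simp [hcomp, idm, LaxTrans.idt, e'])

theorem hcomp_assoc (x y z : Modification A B) (e : x.dom.cod = y.dom.dom)
    (e₁ : y.dom.cod = z.dom.dom) (h h') :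
    (x.hcomp y e).hcomp z h = x.hcomp (y.hcomp z e₁) h' :=
  Modification.ext (LaxTrans.assoc' _ _ _ e e₁ h h')
    (LaxTrans.assoc' _ _ _ (dom_eq_of_cod_eq e) (dom_eq_of_cod_eq e₁) (dom_eq_of_cod_eq h)
      (dom_eq_of_cod_eq h'))
    (funext fun a => by apply CatOn.assoc <;> simp [e, e₁])

end Modification

namespace TransClass

variable (P : TransClass.{u}) (A B : TwoCat.{u})

/-- The 1-cells: transformations in the class. -/
def Tr : Type u := {x : LaxTrans A B // P.mem x}

/-- The 2-cells: modifications between transformations in the class. -/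
def Md : Type u := {m : Modification A B // P.mem m.dom ∧ P.mem m.cod}

/-- The category of 2-functors and transformations. -/
noncomputable def catOne : CatOn (A ⟶ B) (P.Tr A B) :=
  CatOn.ofPartial (fun x => x.1.dom) (fun x => x.1.cod) (fun F => ⟨.idt F, P.mem_idt F⟩)
    (fun x y e => ⟨x.1.comp y.1 e, P.mem_comp _ _ e x.2 y.2⟩)
    (fun _ => rfl) (fun _ => rfl) (fun _ _ _ => rfl) (fun _ _ _ => rfl)
    (fun x e => Subtype.ext (x.1.id_comp' _ e)) (fun x e => Subtype.ext (x.1.comp_id' _ e))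
    (fun x y z e h e₁ h' => Subtype.ext (x.1.assoc' y.1 z.1 e e₁ h h'))

/-- The category of transformations and modifications. -/
noncomputable def catVer : CatOn (P.Tr A B) (P.Md A B) :=
  CatOn.ofPartial (fun m => ⟨m.1.dom, m.2.1⟩) (fun m => ⟨m.1.cod, m.2.2⟩)
    (fun x => ⟨.idm x.1, x.2, x.2⟩)
    (fun m n e => ⟨m.1.vcomp n.1 (congrArg Subtype.val e), m.2.1, n.2.2⟩)
    (fun _ => rfl) (fun _ => rfl) (fun _ _ _ => rfl) (fun _ _ _ => rfl)
    (fun m e => Subtype.ext (m.1.idm_vcomp _ (congrArg Subtype.val e)))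
    (fun m e => Subtype.ext (m.1.vcomp_idm _ (congrArg Subtype.val e)))
    (fun x y z e h e₁ h' => Subtype.ext (x.1.vcomp_assoc y.1 z.1 (congrArg Subtype.val e)
      (congrArg Subtype.val e₁) (congrArg Subtype.val h) (congrArg Subtype.val h')))

/-- The category of 2-functors and modifications. -/
noncomputable def catHor : CatOn (A ⟶ B) (P.Md A B) :=
  CatOn.ofPartial (fun m => m.1.dom.dom) (fun m => m.1.dom.cod)
    (fun F => ⟨.idm (.idt F), P.mem_idt F, P.mem_idt F⟩)
    (fun m n e => ⟨m.1.hcomp n.1 e, P.mem_comp _ _ e m.2.1 n.2.1,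
      P.mem_comp _ _ (Modification.dom_eq_of_cod_eq e) m.2.2 n.2.2⟩)
    (fun _ => rfl) (fun _ => rfl) (fun _ _ _ => rfl) (fun _ _ _ => rfl)
    (fun m e => Subtype.ext (m.1.idt_hcomp _ e))
    (fun m e => Subtype.ext (m.1.hcomp_idt _ e))
    (fun x y z e h e₁ h' => Subtype.ext (x.1.hcomp_assoc y.1 z.1 e e₁ h h'))

variable {P A B}

theorem catOne_comp (x y : P.Tr A B) (e : x.1.cod = y.1.dom) :
    (P.catOne A B).comp x y = ⟨x.1.comp y.1 e, P.mem_comp _ _ e x.2 y.2⟩ :=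
  dif_pos e

theorem catVer_comp (m n : P.Md A B) (e : m.1.cod = n.1.dom) :
    (P.catVer A B).comp m n = ⟨m.1.vcomp n.1 e, m.2.1, n.2.2⟩ :=
  CatOn.ofPartial_comp _ _ _ _ _ _ _ _ _ _ _ _ _ (Subtype.ext e)

theorem catHor_comp (m n : P.Md A B) (e : m.1.dom.cod = n.1.dom.dom) :
    (P.catHor A B).comp m n =
      ⟨m.1.hcomp n.1 e, P.mem_comp _ _ e m.2.1 n.2.1,
      P.mem_comp _ _ (Modification.dom_eq_of_cod_eq e) m.2.2 n.2.2⟩ :=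
  dif_pos e

variable (P A B)

/-- The 2-category of 2-functors, transformations in the class `P`, and modifications. -/
noncomputable def hom : TwoCat.{u} where
  Ob := A ⟶ B
  Hom := P.Tr A B
  Cell := P.Md A B
  one := P.catOne A B
  hor := P.catHor A B
  ver := P.catVer A B
  isFun_src :=
    { src _ := rfl
      tgt _ := rfl
      id _ := rfl
      comp x y e := by
        rw [catHor_comp _ _ e]
        exact (catOne_comp ⟨x.1.dom, x.2.1⟩ ⟨y.1.dom, y.2.1⟩ e).symm }
  isFun_tgt :=
    { src m := m.1.dom_dom.symm
      tgt m := m.1.dom_cod.symm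
      id _ := rfl
      comp x y e := by
        rw [catHor_comp _ _ e]
        exact (catOne_comp ⟨x.1.cod, x.2.2⟩ ⟨y.1.cod, y.2.2⟩
          (Modification.dom_eq_of_cod_eq e)).symm }
  isFun_id :=
    { src _ := rfl
      tgt _ := rfl
      id _ := rfl
      comp x y e := by
        have e : x.1.cod = y.1.dom := e
        rw [catOne_comp _ _ e]
        refine Eq.trans ?_ (catHor_comp _ _ e).symm
        refine Subtype.ext (Modification.ext rfl rfl (funext fun a => ?_))
        exact B.id_comp _ _ (by simp [e]) }
  interchange α β γ δ h₁ h₂ h₃ h₄ := by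
    have h₁ : α.1.cod = β.1.dom := congrArg Subtype.val h₁
    have h₂ : γ.1.cod = δ.1.dom := congrArg Subtype.val h₂
    have h₃ : α.1.dom.cod = γ.1.dom.dom := h₃
    have h₄ : β.1.dom.cod = δ.1.dom.dom := h₄
    rw [catVer_comp _ _ h₁, catVer_comp _ _ h₂, catHor_comp _ _ h₃, catHor_comp _ _ h₄]
    refine (catHor_comp ⟨α.1.vcomp β.1 h₁, _⟩ ⟨γ.1.vcomp δ.1 h₂, _⟩ h₃).trans
      (Eq.trans ?_ (catVer_comp ⟨α.1.hcomp γ.1 h₃, _⟩ ⟨β.1.hcomp δ.1 h₄, _⟩ ?_).symm)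
    · refine Subtype.ext (Modification.ext rfl rfl (funext fun a => ?_))
      apply B.interchange <;> simp [h₁, h₂, h₃, h₄]
    · simp only [Modification.hcomp]
      congr 1

variable {A B}

/-- Functoriality of the 2-category of 2-functors. -/
def homMap {A' B' : TwoCat.{u}} (F : A' ⟶ A) (G : B ⟶ B') : P.hom A B ⟶ P.hom A' B' where
  ob K := F ≫ K ≫ G
  hom x := ⟨x.1.map F G, P.mem_map _ _ _ x.2⟩
  cell m := ⟨m.1.map F G, P.mem_map _ _ _ m.2.1, P.mem_map _ _ _ m.2.2⟩
  isFun_one :=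
    { src _ := rfl
      tgt _ := rfl
      id K := Subtype.ext (LaxTrans.map_idt F G K)
      comp x y e := by
        have e : x.1.cod = y.1.dom := e
        refine Eq.trans ?_ (catOne_comp _ _ (congrArg (fun K => F ≫ K ≫ G) e)).symm
        refine Subtype.ext (Eq.trans ?_ (LaxTrans.map_comp F G _ _ e))
        exact congrArg (fun z : P.Tr A B => z.1.map F G) (catOne_comp _ _ e) }
  isFun_hor :=
    { src _ := rfl
      tgt _ := rfl
      id K := Subtype.ext (Modification.ext (LaxTrans.map_idt F G K) (LaxTrans.map_idt F G K)
        (funext fun a => (G.isFun_ver.id _).trans (congrArg _ (G.isFun_one.id _))))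
      comp m n e := by
        have e : m.1.dom.cod = n.1.dom.dom := e
        refine Eq.trans ?_ (catHor_comp _ _ (congrArg (fun K => F ≫ K ≫ G) e)).symm
        refine Subtype.ext ?_
        refine (congrArg (fun z : P.Md A B => z.1.map F G) (catHor_comp _ _ e)).trans ?_
        refine Modification.ext (LaxTrans.map_comp F G _ _ e)
          (LaxTrans.map_comp F G _ _ (Modification.dom_eq_of_cod_eq e))
          (funext fun a => ?_)
        exact G.isFun_hor.comp _ _ (by simp [e]) }
  isFun_ver :=
    { src _ := rfl
      tgt _ := rfl
      id x := Subtype.ext (Modification.ext rfl rfl (funext fun a => G.isFun_ver.id _))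
      comp m n e := by
        have e : m.1.cod = n.1.dom := congrArg Subtype.val e
        refine Eq.trans ?_ (catVer_comp _ _ (congrArg (LaxTrans.map F G) e)).symm
        refine Subtype.ext ?_
        refine (congrArg (fun z : P.Md A B => z.1.map F G) (catVer_comp _ _ e)).trans ?_
        refine Modification.ext rfl rfl (funext fun a => ?_)
        exact G.isFun_ver.comp _ _ (by simp [e]) }

/-- The internal hom functor of 2-categories given by a class of transformations. -/
noncomputable def homFunctor : TwoCat.{u}ᵒᵖ ⥤ TwoCat.{u} ⥤ TwoCat.{u} where
  obj A :=
    { obj B := P.hom A.unop B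
      map G := P.homMap (𝟙 _) G }
  map F :=
    { app B := P.homMap F.unop (𝟙 B) }

theorem isGood_hom (P : TransClass.{0}) (A : TwoCat.{0}) :
    CellCategory.IsGood (P.homFunctor.obj (op A) ⋙ CellCategory.cells TwoCat.{0}) :=
  ⟨Modification.Ix A, fun _ x => Modification.cells x.1, fun B C f r i => by
    rcases i with (i | i | i) | (i | i | i) | i <;> rfl,
    fun _ _ _ h => Subtype.ext (Modification.ext_cells h), fun p hp r e he => by
      obtain ⟨y, hy⟩ := Modification.exists_lift hp (fun s => (r s).1) e he
      refine ⟨⟨y, P.mem_of_emb p hp _ fun s => ?_, P.mem_of_emb p hp _ fun s => ?_⟩,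
        fun s => Subtype.ext (hy s)⟩
      · have h := (r s).2.1
        rw [← hy s] at h
        exact h
      · have h := (r s).2.2
        rw [← hy s] at h
        exact h⟩

end TransClass

/-- The functor `B ↦ (- ⊗ B)`, where `- ⊗ B` is left adjoint to the internal hom functor
`I.obj (op B)`. -/
noncomputable def tensorRight {K : Type 1} [Category.{0} K] (I : Kᵒᵖ ⥤ K ⥤ K)
    [∀ B, (I.obj B).IsRightAdjoint] : K ⥤ K ⥤ K where
  obj B := (I.obj (op B)).leftAdjoint
  map {B B'} f := (conjugateEquiv (.ofIsRightAdjoint (I.obj (op B')))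
    (.ofIsRightAdjoint (I.obj (op B)))).symm (I.map f.op)
  map_id B := by simp
  map_comp f g := by simp

/-- The tensor product `(A, B) ↦ A ⊗ B` determined by an internal hom functor `I`: morphisms
`A ⊗ B ⟶ D` correspond naturally to morphisms `A ⟶ I(B, D)`. -/
noncomputable def tensor {K : Type 1} [Category.{0} K] (I : Kᵒᵖ ⥤ K ⥤ K)
    [∀ B, (I.obj B).IsRightAdjoint] : K × K ⥤ K :=
  CategoryTheory.Prod.swap K K ⋙ Functor.uncurry.obj (tensorRight I)

/-- The universal property of the tensor product. -/
noncomputable def tensorHomEquiv {K : Type 1} [Category.{0} K] (I : Kᵒᵖ ⥤ K ⥤ K)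
    [∀ B, (I.obj B).IsRightAdjoint] (A B D : K) :
    ((tensor I).obj (A, B) ⟶ D) ≃ (A ⟶ (I.obj (op B)).obj D) :=
  (Adjunction.ofIsRightAdjoint (I.obj (op B))).homEquiv A D

theorem conjugateEquiv_homEquiv {K : Type 1} [Category.{0} K] {L L' R R' : K ⥤ K} (h : L ⊣ R)
    (h' : L' ⊣ R') (α : R ⟶ R') {A A' D D' : K} (a : A' ⟶ A) (d : D ⟶ D') (f : L.obj A ⟶ D) :
    h'.homEquiv A' D' ((((conjugateEquiv h h').symm α).app A' ≫ L.map a) ≫ f ≫ d) =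
      a ≫ h.homEquiv A D f ≫ R.map d ≫ α.app D' := by
  have e := unit_conjugateEquiv_symm h h' α A'
  have n := h.unit.naturality a
  simp only [Functor.id_map, Functor.comp_map] at n
  simp only [Adjunction.homEquiv_unit, Functor.map_comp, Category.assoc]
  rw [← reassoc_of% e, reassoc_of% n]
  simp

/-- The universal property of the tensor product is natural in all variables. -/
theorem tensorHomEquiv_naturality {K : Type 1} [Category.{0} K] (I : Kᵒᵖ ⥤ K ⥤ K)
    [∀ B, (I.obj B).IsRightAdjoint] {A A' B B' D D' : K} (a : A' ⟶ A) (b : B' ⟶ B) (d : D ⟶ D')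
    (f : (tensor I).obj (A, B) ⟶ D) :
    tensorHomEquiv I A' B' D' ((tensor I).map ((a, b) : (A', B') ⟶ (A, B)) ≫ f ≫ d) =
      a ≫ tensorHomEquiv I A B D f ≫ (I.obj (op B)).map d ≫ (I.map b.op).app D' := by
  have e : (tensor I).map ((a, b) : (A', B') ⟶ (A, B)) =
      ((tensorRight I).map b).app A' ≫ ((tensorRight I).obj B).map a := by simp [tensor]
  rw [e]
  exact conjugateEquiv_homEquiv _ _ (I.map b.op) a d f

instance (B : DblCat.{0}ᵒᵖ) : (DblCat.ihomFunctor.obj B).IsRightAdjoint :=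
  (DblCat.isGood_ihom B.unop).isRightAdjoint

instance (P : TransClass.{0}) (B : TwoCat.{0}ᵒᵖ) : (P.homFunctor.obj B).IsRightAdjoint :=
  (P.isGood_hom B.unop).isRightAdjoint

instance : horEmb.{0}.IsRightAdjoint :=
  CellCategory.IsGood.isRightAdjoint
    (show CellCategory.IsGood (horEmb.{0} ⋙ CellCategory.cells DblCat.{0}) from
      CellCategory.isGood_cells (K := TwoCat.{0}))

/-- The Gray tensor product of 2-categories (for pseudonatural transformations). -/
noncomputable def tensorPs : TwoCat.{0} × TwoCat.{0} ⥤ TwoCat.{0} :=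
  tensor TransClass.pseudo.homFunctor

/-- The icon tensor product of 2-categories. -/
noncomputable def tensorIc : TwoCat.{0} × TwoCat.{0} ⥤ TwoCat.{0} :=
  tensor TransClass.icon.homFunctor

/-- The Gray tensor product of double categories (for pseudonatural transformations). -/
noncomputable def tensorDbl : DblCat.{0} × DblCat.{0} ⥤ DblCat.{0} :=
  tensor DblCat.ihomFunctor

/-- The left adjoint of the horizontal embedding of 2-categories into double categories. -/
noncomputable def horLeft : DblCat.{0} ⥤ TwoCat.{0} := horEmb.leftAdjoint

/-- The opposite of a category structure. -/
def CatOn.op {O : Type u} {M : Type v} (C : CatOn O M) : CatOn O M where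
  src := C.tgt
  tgt := C.src
  id := C.id
  comp f g := C.comp g f
  src_id := C.tgt_id
  tgt_id := C.src_id
  src_comp _ _ h := C.tgt_comp _ _ h.symm
  tgt_comp _ _ h := C.src_comp _ _ h.symm
  id_comp := C.comp_id
  comp_id := C.id_comp
  assoc _ _ _ h h' := (C.assoc _ _ _ h'.symm h.symm).symm

/-- The 2-category obtained by reversing the 2-cells (but not the 1-cells). -/
def TwoCat.co : TwoCat.{u} ⥤ TwoCat.{u} where
  obj A :=
    { A with
      ver := A.ver.op
      isFun_src := A.isFun_tgt
      isFun_tgt := A.isFun_src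
      isFun_id := A.isFun_id
      interchange := fun α β γ δ h₁ h₂ h₃ h₄ =>
        A.interchange β α δ γ h₁.symm h₂.symm h₄ h₃ }
  map F := ⟨F.ob, F.hom, F.cell, F.isFun_one, F.isFun_hor,
    ⟨F.isFun_ver.tgt, F.isFun_ver.src, F.isFun_ver.id, fun _ _ h => F.isFun_ver.comp _ _ h.symm⟩⟩

/-- The vertical embedding of 2-categories into double categories: the vertical morphisms are the
1-cells, the horizontal morphisms are identities, and the squares are the 2-cells, from the right
side to the left side. (With this orientation, squares of `verEmb` and of `horEmb` both are 2-cells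
from the composite of the top and the right side to the composite of the left side and the
bottom.) -/
def verEmb : TwoCat.{u} ⥤ DblCat.{u} := TwoCat.co ⋙ horEmb ⋙ DblCat.transpose

/-- Nonempty finite subsets of `X`. -/
def FinSub (X : Type u) : Type u := {S : Finset X // S.Nonempty}

namespace FinSub

variable {X : Type u} [LinearOrder X]

/-- The minimum. -/
def lo (S : FinSub X) : X := S.1.min' S.2

/-- The maximum. -/
def hi (S : FinSub X) : X := S.1.max' S.2

/-- The union. -/
def union (S T : FinSub X) : FinSub X := ⟨S.1 ∪ T.1, S.2.mono Finset.subset_union_left⟩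

/-- The singleton subset. -/
def single (a : X) : FinSub X := ⟨{a}, Finset.singleton_nonempty a⟩

theorem lo_le_hi (S : FinSub X) : S.lo ≤ S.hi := Finset.min'_le_max' _ _

@[simp] theorem lo_single (a : X) : (single a).lo = a := rfl
@[simp] theorem hi_single (a : X) : (single a).hi = a := rfl
theorem lo_union (S T : FinSub X) : (S.union T).lo = S.lo ⊓ T.lo := Finset.min'_union S.2 T.2
theorem hi_union (S T : FinSub X) : (S.union T).hi = S.hi ⊔ T.hi := Finset.max'_union S.2 T.2

theorem lo_union_of (S T : FinSub X) (h : S.hi = T.lo) : (S.union T).lo = S.lo := by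
  rw [lo_union, inf_eq_left, ← h]; exact S.lo_le_hi
theorem hi_union_of (S T : FinSub X) (h : S.hi = T.lo) : (S.union T).hi = T.hi := by
  rw [hi_union, sup_eq_right, h]; exact T.lo_le_hi

theorem single_lo_union (S : FinSub X) : (single S.lo).union S = S :=
  Subtype.ext (Finset.union_eq_right.2 (Finset.singleton_subset_iff.2 (Finset.min'_mem _ _)))
theorem union_single_hi (S : FinSub X) : S.union (single S.hi) = S :=
  Subtype.ext (Finset.union_eq_left.2 (Finset.singleton_subset_iff.2 (Finset.max'_mem _ _)))
theorem union_assoc (S T U : FinSub X) : (S.union T).union U = S.union (T.union U) :=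
  Subtype.ext (Finset.union_assoc _ _ _)

/-- Inclusions of nonempty finite subsets with the same minimum and the same maximum. -/
def Incl (X : Type u) [LinearOrder X] : Type u :=
  {p : FinSub X × FinSub X // p.1.1 ⊆ p.2.1 ∧ p.1.lo = p.2.lo ∧ p.1.hi = p.2.hi}

/-- Composition of inclusions. -/
def Incl.trans (p q : Incl X) (h : p.1.2 = q.1.1) : Incl X :=
  ⟨⟨p.1.1, q.1.2⟩, p.2.1.trans ((congrArg (fun S : FinSub X => S.1) h).subset.trans q.2.1),
    p.2.2.1.trans ((congrArg lo h).trans q.2.2.1), p.2.2.2.trans ((congrArg hi h).trans q.2.2.2)⟩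

/-- Horizontal composition of inclusions. -/
def Incl.union (p q : Incl X) : Incl X :=
  ⟨⟨p.1.1.union q.1.1, p.1.2.union q.1.2⟩, Finset.union_subset_union p.2.1 q.2.1,
    by simp only [lo_union, p.2.2.1, q.2.2.1], by simp only [hi_union, p.2.2.2, q.2.2.2]⟩

/-- The identity inclusion. -/
def Incl.refl (S : FinSub X) : Incl X := ⟨⟨S, S⟩, subset_rfl, rfl, rfl⟩

/-- Inclusions form a category. -/
noncomputable def Incl.cat (X : Type u) [LinearOrder X] : CatOn (FinSub X) (Incl X) :=
  CatOn.ofPartial (fun p => p.1.1) (fun p => p.1.2) Incl.refl Incl.trans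
    (fun _ => rfl) (fun _ => rfl) (fun _ _ _ => rfl) (fun _ _ _ => rfl)
    (fun _ _ => rfl) (fun _ _ => rfl) (fun _ _ _ _ _ _ _ => rfl)

theorem Incl.cat_comp (p q : Incl X) (h : p.1.2 = q.1.1) : (Incl.cat X).comp p q = p.trans q h :=
  dif_pos h

/-- Image under a monotone map. -/
def image {Y : Type u} [LinearOrder Y] (f : X →o Y) (S : FinSub X) : FinSub Y :=
  ⟨S.1.image f, S.2.image f⟩

theorem lo_image {Y : Type u} [LinearOrder Y] (f : X →o Y) (S : FinSub X) :
    (S.image f).lo = f S.lo := Finset.min'_image f.monotone _ _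
theorem hi_image {Y : Type u} [LinearOrder Y] (f : X →o Y) (S : FinSub X) :
    (S.image f).hi = f S.hi := Finset.max'_image f.monotone _ _

end FinSub

open FinSub in
/-- The 2-truncated oriental of a linearly ordered set `X`. The 1-cells from `a` to `b` are the
finite subsets with minimum `a` and maximum `b`, composed by unions, and there is a unique 2-cell
from `S` to `T` if `S ⊆ T` (where `S` and `T` have the same minimum and the same maximum). -/
noncomputable def oriental (X : Type u) [LinearOrder X] : TwoCat.{u} where
  Ob := X
  Hom := FinSub X
  Cell := Incl X
  one :=
    { src := lo
      tgt := hi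
      id := single
      comp := union
      src_id := lo_single
      tgt_id := hi_single
      src_comp := lo_union_of
      tgt_comp := hi_union_of
      id_comp := single_lo_union
      comp_id := union_single_hi
      assoc _ _ _ _ _ := union_assoc _ _ _ }
  hor :=
    { src p := p.1.1.lo
      tgt p := p.1.1.hi
      id a := Incl.refl (single a)
      comp := Incl.union
      src_id _ := rfl
      tgt_id _ := rfl
      src_comp _ _ h := lo_union_of _ _ h
      tgt_comp _ _ h := hi_union_of _ _ h
      id_comp p := Subtype.ext (Prod.ext (single_lo_union _) (by
        have := single_lo_union p.1.2
        rwa [← p.2.2.1] at this))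
      comp_id p := Subtype.ext (Prod.ext (union_single_hi _) (by
        have := union_single_hi p.1.2
        rwa [← p.2.2.2] at this))
      assoc _ _ _ _ _ := Subtype.ext (Prod.ext (union_assoc _ _ _) (union_assoc _ _ _)) }
  ver := Incl.cat X
  isFun_src := ⟨fun _ => rfl, fun _ => rfl, fun _ => rfl, fun _ _ _ => rfl⟩
  isFun_tgt := ⟨fun p => p.2.2.1.symm, fun p => p.2.2.2.symm, fun _ => rfl, fun _ _ _ => rfl⟩
  isFun_id := ⟨fun _ => rfl, fun _ => rfl, fun _ => rfl, fun _ _ _ => rfl⟩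
  interchange α β γ δ h₁ h₂ h₃ h₄ := by
    have h₁ : α.1.2 = β.1.1 := h₁
    have h₂ : γ.1.2 = δ.1.1 := h₂
    rw [Incl.cat_comp _ _ h₁, Incl.cat_comp _ _ h₂]
    exact (Incl.cat_comp (α.union γ) (β.union δ) (congrArg₂ FinSub.union h₁ h₂)).symm

namespace FinSub

variable {X Y : Type u} [LinearOrder X] [LinearOrder Y]

theorem image_union (f : X →o Y) (S T : FinSub X) :
    (S.union T).image f = (S.image f).union (T.image f) := Subtype.ext (Finset.image_union _ _)

theorem image_image {Z : Type u} [LinearOrder Z] (f : X →o Y) (g : Y →o Z) (S : FinSub X) :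
    (S.image f).image g = S.image (g.comp f) := Subtype.ext Finset.image_image

theorem image_single (f : X →o Y) (a : X) : (single a).image f = single (f a) :=
  Subtype.ext (Finset.image_singleton _ _)

/-- Image under a monotone map. -/
def Incl.image (f : X →o Y) (p : Incl X) : Incl Y :=
  ⟨⟨p.1.1.image f, p.1.2.image f⟩, Finset.image_subset_image p.2.1,
    by simp only [lo_image, p.2.2.1], by simp only [hi_image, p.2.2.2]⟩

end FinSub

open FinSub in
/-- Functoriality of orientals: 1-cells are sent to their images. -/
noncomputable def oriental.map {X Y : Type u} [LinearOrder X] [LinearOrder Y] (f : X →o Y) :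
    oriental X ⟶ oriental Y where
  ob := f
  hom := image f
  cell := Incl.image f
  isFun_one := ⟨lo_image f, hi_image f, image_single f, fun _ _ _ => image_union f _ _⟩
  isFun_hor := ⟨fun _ => lo_image f _, fun _ => hi_image f _,
    fun _ => Subtype.ext (Prod.ext (image_single f _) (image_single f _)),
    fun _ _ _ => Subtype.ext (Prod.ext (image_union f _ _) (image_union f _ _))⟩
  isFun_ver := ⟨fun _ => rfl, fun _ => rfl, fun _ => rfl, fun p q h => by
    have h : p.1.2 = q.1.1 := h
    refine Eq.trans ?_ (Incl.cat_comp (Incl.image f p) (Incl.image f q)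
      (congrArg (FinSub.image f) h)).symm
    exact congrArg (Incl.image f) (Incl.cat_comp _ _ h)⟩

open FinSub in
/-- The cosimplicial 2-category of 2-truncated orientals. -/
noncomputable def orientalFunctor : SimplexCategory ⥤ TwoCat.{0} where
  obj n := oriental (Fin (n.len + 1))
  map f := oriental.map f.toOrderHom
  map_id n := TwoCat.hom_ext _ _ fun p =>
    Subtype.ext (Prod.ext (Subtype.ext Finset.image_id) (Subtype.ext Finset.image_id))
  map_comp f g := TwoCat.hom_ext _ _ fun p =>
    Subtype.ext (Prod.ext (image_image f.toOrderHom g.toOrderHom p.1.1).symm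
      (image_image f.toOrderHom g.toOrderHom p.1.2).symm)

/-- An invertible 2-cell. -/
def InvCell (D : TwoCat.{u}) : Type u := {α : D.Cell // D.ver.IsInv α}

/-- The image of an invertible 2-cell. -/
def InvCell.map {D E : TwoCat.{u}} (F : D ⟶ E) (α : InvCell D) : InvCell E :=
  ⟨F.cell α.1, F.isFun_ver.isInv α.2⟩

/-- An adjoint equivalence `f ⊣ g` in a 2-category, with unit `η : id ⟶ f ≫ g` and counit
`ε : g ≫ f ⟶ id`. -/
@[ext]
structure AdjEquiv (D : TwoCat.{u}) where
  f : D.Hom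
  g : D.Hom
  η : D.Cell
  ε : D.Cell
  g_src : D.one.src g = D.one.tgt f
  g_tgt : D.one.tgt g = D.one.src f
  η_src : D.ver.src η = D.one.id (D.one.src f)
  η_tgt : D.ver.tgt η = D.one.comp f g
  ε_src : D.ver.src ε = D.one.comp g f
  ε_tgt : D.ver.tgt ε = D.one.id (D.one.tgt f)
  η_inv : D.ver.IsInv η
  ε_inv : D.ver.IsInv ε
  triangle_f : D.ver.comp (D.hor.comp η (D.ver.id f)) (D.hor.comp (D.ver.id f) ε) = D.ver.id f
  triangle_g : D.ver.comp (D.hor.comp (D.ver.id g) η) (D.hor.comp ε (D.ver.id g)) = D.ver.id g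

namespace AdjEquiv

theorem η_hsrc {D : TwoCat.{u}} (e : AdjEquiv D) : D.hor.src e.η = D.one.src e.f := by
  rw [← TwoCat.src_src, e.η_src, CatOn.src_id]
theorem η_htgt {D : TwoCat.{u}} (e : AdjEquiv D) : D.hor.tgt e.η = D.one.src e.f := by
  rw [← TwoCat.src_tgt, e.η_src, CatOn.tgt_id]
theorem ε_hsrc {D : TwoCat.{u}} (e : AdjEquiv D) : D.hor.src e.ε = D.one.tgt e.f := by
  rw [← TwoCat.tgt_src, e.ε_tgt, CatOn.src_id]
theorem ε_htgt {D : TwoCat.{u}} (e : AdjEquiv D) : D.hor.tgt e.ε = D.one.tgt e.f := by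
  rw [← TwoCat.tgt_tgt, e.ε_tgt, CatOn.tgt_id]

/-- The image of an adjoint equivalence. -/
def map {D E : TwoCat.{u}} (F : D ⟶ E) (e : AdjEquiv D) : AdjEquiv E where
  f := F.hom e.f
  g := F.hom e.g
  η := F.cell e.η
  ε := F.cell e.ε
  g_src := by simp [e.g_src]
  g_tgt := by simp [e.g_tgt]
  η_src := by simp [e.η_src]
  η_tgt := by simp [e.η_tgt, e.g_src]
  ε_src := by simp [e.ε_src, e.g_tgt]
  ε_tgt := by simp [e.ε_tgt]
  η_inv := F.isFun_ver.isInv e.η_inv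
  ε_inv := F.isFun_ver.isInv e.ε_inv
  triangle_f := by
    have h := congrArg (TwoFunctor.cell F) e.triangle_f
    rw [TwoFunctor.ver_comp, TwoFunctor.hor_comp, TwoFunctor.hor_comp, TwoFunctor.ver_id] at h
    · exact h
    all_goals simp [η_hsrc, η_htgt, ε_hsrc, ε_htgt, e.η_src, e.η_tgt, e.ε_src, e.ε_tgt, e.g_src,
      e.g_tgt, CatOn.assoc]
  triangle_g := by
    have h := congrArg (TwoFunctor.cell F) e.triangle_g
    rw [TwoFunctor.ver_comp, TwoFunctor.hor_comp, TwoFunctor.hor_comp, TwoFunctor.ver_id] at h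
    · exact h
    all_goals simp [η_hsrc, η_htgt, ε_hsrc, ε_htgt, e.η_src, e.η_tgt, e.ε_src, e.ε_tgt, e.g_src,
      e.g_tgt, CatOn.assoc]

/-- The identity adjoint equivalence. -/
def refl {D : TwoCat.{u}} (a : D.Ob) : AdjEquiv D where
  f := D.one.id a
  g := D.one.id a
  η := D.hor.id a
  ε := D.hor.id a
  g_src := by simp
  g_tgt := by simp
  η_src := by simp
  η_tgt := by simp
  ε_src := by simp
  ε_tgt := by simp
  η_inv := by rw [← D.id_id]; exact CatOn.isInv_id _ _
  ε_inv := by rw [← D.id_id]; exact CatOn.isInv_id _ _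
  triangle_f := by simp; rw [← D.id_id, CatOn.id_id]
  triangle_g := by simp; rw [← D.id_id, CatOn.id_id]

/-- The cells of an adjoint equivalence. -/
def cells {D : TwoCat.{u}} (e : AdjEquiv D) : Fin 4 → D.Cell :=
  ![D.ver.id e.f, D.ver.id e.g, e.η, e.ε]

theorem ext_cells {D : TwoCat.{u}} {e e' : AdjEquiv D} (h : ∀ i, e.cells i = e'.cells i) :
    e = e' := by
  refine AdjEquiv.ext ?_ ?_ (h 2) (h 3)
  · rw [← D.ver.src_id e.f, ← D.ver.src_id e'.f]; exact congrArg _ (h 0)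
  · rw [← D.ver.src_id e.g, ← D.ver.src_id e'.g]; exact congrArg _ (h 1)

theorem exists_lift {S : Type w} {E : TwoCat.{u}} {D : S → TwoCat.{u}} {p : ∀ s, E ⟶ D s}
    (hp : TwoCat.Emb p) (r : ∀ s, AdjEquiv (D s)) (c : Fin 4 → E.Cell)
    (hc : ∀ s i, (p s).cell (c i) = (r s).cells i) : ∃ e, ∀ s, AdjEquiv.map (p s) e = r s := by
  obtain ⟨ih, io⟩ := TwoCat.inj_cells hp.inj
  obtain ⟨f, hf⟩ : ∃ f, ∀ s, (p s).hom f = (r s).f := ⟨E.ver.src (c 0), fun s => by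
    rw [← TwoFunctor.ver_src, hc]; exact (D s).ver.src_id _⟩
  obtain ⟨g, hg⟩ : ∃ f, ∀ s, (p s).hom f = (r s).g := ⟨E.ver.src (c 1), fun s => by
    rw [← TwoFunctor.ver_src, hc]; exact (D s).ver.src_id _⟩
  obtain ⟨η, hη⟩ : ∃ f, ∀ s, (p s).cell f = (r s).η := ⟨c 2, fun s => hc s 2⟩
  obtain ⟨ε, hε⟩ : ∃ f, ∀ s, (p s).cell f = (r s).ε := ⟨c 3, fun s => hc s 3⟩
  have c₁ : E.one.src g = E.one.tgt f := io _ _ fun s => by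
    rw [← TwoFunctor.one_src, ← TwoFunctor.one_tgt, hf, hg, (r s).g_src]
  have c₂ : E.one.tgt g = E.one.src f := io _ _ fun s => by
    rw [← TwoFunctor.one_src, ← TwoFunctor.one_tgt, hf, hg, (r s).g_tgt]
  have c₃ : E.ver.src η = E.one.id (E.one.src f) := ih _ _ fun s => by
    rw [← TwoFunctor.ver_src, TwoFunctor.one_id, ← TwoFunctor.one_src, hf, hη, (r s).η_src]
  have c₄ : E.ver.tgt η = E.one.comp f g := ih _ _ fun s => by
    rw [← TwoFunctor.ver_tgt, TwoFunctor.one_comp _ _ _ c₁.symm, hf, hg, hη, (r s).η_tgt]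
  have c₅ : E.ver.src ε = E.one.comp g f := ih _ _ fun s => by
    rw [← TwoFunctor.ver_src, TwoFunctor.one_comp _ _ _ c₂, hf, hg, hε, (r s).ε_src]
  have c₆ : E.ver.tgt ε = E.one.id (E.one.tgt f) := ih _ _ fun s => by
    rw [← TwoFunctor.ver_tgt, TwoFunctor.one_id, ← TwoFunctor.one_tgt, hf, hε, (r s).ε_tgt]
  have d₁ : E.hor.src η = E.one.src f := by rw [← TwoCat.src_src, c₃, CatOn.src_id]
  have d₂ : E.hor.tgt η = E.one.src f := by rw [← TwoCat.src_tgt, c₃, CatOn.tgt_id]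
  have d₃ : E.hor.src ε = E.one.tgt f := by rw [← TwoCat.tgt_src, c₆, CatOn.src_id]
  have d₄ : E.hor.tgt ε = E.one.tgt f := by rw [← TwoCat.tgt_tgt, c₆, CatOn.tgt_id]
  refine ⟨⟨f, g, η, ε, c₁, c₂, c₃, c₄, c₅, c₆, hp.inv _ fun s => ?_, hp.inv _ fun s => ?_,
    hp.inj _ _ fun s => ?_, hp.inj _ _ fun s => ?_⟩, fun s => ?_⟩
  · rw [hη]; exact (r s).η_inv
  · rw [hε]; exact (r s).ε_inv
  · rw [TwoFunctor.ver_comp, TwoFunctor.hor_comp, TwoFunctor.hor_comp, TwoFunctor.ver_id, hf, hη,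
      hε, (r s).triangle_f] <;> simp [c₁, c₂, c₃, c₄, c₅, c₆, d₁, d₂, d₃, d₄, CatOn.assoc]
  · rw [TwoFunctor.ver_comp, TwoFunctor.hor_comp, TwoFunctor.hor_comp, TwoFunctor.ver_id, hg, hη,
      hε, (r s).triangle_g] <;> simp [c₁, c₂, c₃, c₄, c₅, c₆, d₁, d₂, d₃, d₄, CatOn.assoc]
  · exact AdjEquiv.ext (hf s) (hg s) (hη s) (hε s)

end AdjEquiv

namespace TwoCat

/-- The set of 1-cells. -/
def homs : TwoCat.{0} ⥤ Type where
  obj D := D.Hom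
  map F := ↾F.hom

/-- The set of 2-cells. -/
def twoCells : TwoCat.{0} ⥤ Type where
  obj D := D.Cell
  map F := ↾F.cell

/-- The set of invertible 2-cells. -/
def invCells : TwoCat.{0} ⥤ Type where
  obj D := InvCell D
  map F := ↾(InvCell.map F)

/-- The set of adjoint equivalences. -/
def adjEquivs : TwoCat.{0} ⥤ Type where
  obj D := AdjEquiv D
  map F := ↾(AdjEquiv.map F)

instance : homs.IsCorepresentable := CellCategory.IsGood.isCorepresentable
  ⟨Unit, fun D f _ => D.ver.id f, fun A B F f _ => (F.isFun_ver.id f).symm,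
    fun D f f' h => by
      rw [← D.ver.src_id f, ← D.ver.src_id f']; exact congrArg D.ver.src (h ()),
    fun {S E D} p hp r e he => ⟨E.ver.src (e ()), fun s => by
      have h := congrArg (D s).ver.src (he s ())
      exact ((p s).isFun_ver.src (e ())).symm.trans (h.trans ((D s).ver.src_id _))⟩⟩

instance : twoCells.IsCorepresentable :=
  CellCategory.IsGood.isCorepresentable (CellCategory.isGood_cells (K := TwoCat.{0}))

instance : invCells.IsCorepresentable := CellCategory.IsGood.isCorepresentable
  ⟨Unit, fun D f _ => f.1, fun A B F f _ => rfl, fun D f f' h => Subtype.ext (h ()),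
    fun {S E D} p hp r e he => ⟨⟨e (), hp.inv _ fun s => (congrArg (D s).ver.IsInv (he s ())).mpr (r s).2⟩, fun s => Subtype.ext (he s ())⟩⟩

instance : adjEquivs.IsCorepresentable := CellCategory.IsGood.isCorepresentable
  ⟨Fin 4, fun D f => f.cells, fun A B F f i => by
    fin_cases i
    · exact (F.isFun_ver.id f.f).symm
    · exact (F.isFun_ver.id f.g).symm
    · rfl
    · rfl, fun D f f' h => AdjEquiv.ext_cells h,
    fun p hp r e he => AdjEquiv.exists_lift hp r e he⟩

end TwoCat

section

open Limits

/-- The morphism from a corepresenting object that classifies an element. -/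
noncomputable def classify {K : Type 1} [Category.{0} K] (R : K ⥤ Type) [R.IsCorepresentable] {D : K}
    (x : R.obj D) : R.coreprX ⟶ D := R.corepresentableBy.homEquiv.symm x

theorem classify_comp {K : Type 1} [Category.{0} K] (R : K ⥤ Type) [R.IsCorepresentable] {D E : K}
    (x : R.obj D) (f : D ⟶ E) : classify R x ≫ f = classify R (R.map f x) :=
  by
  rw [classify, classify, Equiv.eq_symm_apply, R.corepresentableBy.homEquiv_comp,
    Equiv.apply_symm_apply]

theorem classify_coreprx {K : Type 1} [Category.{0} K] (R : K ⥤ Type) [R.IsCorepresentable] {D : K}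
    (f : R.coreprX ⟶ D) : classify R (R.map f R.coreprx) = f := by
  rw [classify, Equiv.symm_apply_eq]
  exact (R.corepresentableBy.homEquiv_eq f).symm

theorem map_classify {K : Type 1} [Category.{0} K] (R : K ⥤ Type) [R.IsCorepresentable] {D : K}
    (x : R.obj D) : R.map (classify R x) R.coreprx = x := by
  have := R.corepresentableBy.homEquiv_eq (classify R x)
  exact this.symm.trans (Equiv.apply_symm_apply _ _)

theorem classify_injective {K : Type 1} [Category.{0} K] (R : K ⥤ Type) [R.IsCorepresentable]
    {D : K} {x y : R.obj D} (h : classify R x = classify R y) : x = y :=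
  R.corepresentableBy.homEquiv.symm.injective h

namespace TwoCat

/-- The free-living 1-cell. -/
noncomputable abbrev walkingHom : TwoCat.{0} := homs.coreprX

/-- The free-living 2-cell. -/
noncomputable abbrev walkingCell : TwoCat.{0} := twoCells.coreprX

/-- The free-living invertible 2-cell. -/
noncomputable abbrev walkingInvCell : TwoCat.{0} := invCells.coreprX

/-- The free-living adjoint equivalence. -/
noncomputable abbrev walkingAdjEquiv : TwoCat.{0} := adjEquivs.coreprX

/-- The inclusion of the free-living 2-cell into the free-living invertible 2-cell. -/
noncomputable def cellToInv : walkingCell ⟶ walkingInvCell :=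
  classify twoCells (D := walkingInvCell) (show InvCell walkingInvCell from invCells.coreprx).1

/-- The inclusion of the free-living 1-cell into the free-living adjoint equivalence, as the left
adjoint. -/
noncomputable def homToAdjEquiv : walkingHom ⟶ walkingAdjEquiv :=
  classify homs (D := walkingAdjEquiv) (show AdjEquiv walkingAdjEquiv from adjEquivs.coreprx).f

theorem cellToInv_comp {D : TwoCat.{0}} (x : InvCell D) :
    cellToInv ≫ classify invCells x = classify twoCells x.1 := by
  refine (classify_comp twoCells _ _).trans (congrArg (classify twoCells) ?_)
  exact congrArg Subtype.val (map_classify invCells x)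

theorem homToAdjEquiv_comp {D : TwoCat.{0}} (x : AdjEquiv D) :
    homToAdjEquiv ≫ classify adjEquivs x = classify homs x.f := by
  refine (classify_comp homs _ _).trans (congrArg (classify homs) ?_)
  exact congrArg AdjEquiv.f (map_classify adjEquivs x)

instance : Epi cellToInv where
  left_cancellation {D} f g h := by
    obtain ⟨x, rfl⟩ : ∃ x, f = classify invCells x := ⟨_, (classify_coreprx invCells f).symm⟩
    obtain ⟨y, rfl⟩ : ∃ x, g = classify invCells x := ⟨_, (classify_coreprx invCells g).symm⟩
    have h := (cellToInv_comp x).symm.trans (h.trans (cellToInv_comp y))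
    exact congrArg _ (Subtype.ext (classify_injective twoCells h))

end TwoCat

namespace FinSub

/-- The generating 2-cell of the oriental of `Fin 3`, from `{0, 2}` to `{0, 1, 2}`. -/
def triangle₀ : Incl (Fin 3) :=
  ⟨⟨⟨{0, 2}, by decide⟩, ⟨{0, 1, 2}, by decide⟩⟩, by decide, by decide, by decide⟩

/-- The 2-cell from `{t 0, t 2}` to `{t 0, t 1, t 2}`. -/
def triangle {X : Type} [LinearOrder X] (t : Fin 3 →o X) : Incl X := Incl.image t triangle₀

/-- The 1-cell `{t 0, t 1}`. -/
def edge {X : Type} [LinearOrder X] (t : Fin 2 →o X) : FinSub X :=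
  image t ⟨{0, 1}, by decide⟩

theorem image_triangle {X Y : Type} [LinearOrder X] [LinearOrder Y] (f : X →o Y) (t : Fin 3 →o X) :
    Incl.image f (triangle t) = triangle (f.comp t) :=
  Subtype.ext (Prod.ext (image_image t f _) (image_image t f _))

theorem image_edge {X Y : Type} [LinearOrder X] [LinearOrder Y] (f : X →o Y) (t : Fin 2 →o X) :
    image f (edge t) = edge (f.comp t) := image_image t f _

end FinSub

/-- The 2-truncated oriental of `[n]`. -/
noncomputable abbrev Ori (n : SimplexCategory) : TwoCat.{0} := orientalFunctor.obj n

/-- The index set of the generating 2-cells of the 2-truncated oriental of `[n]`. -/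
abbrev Gen₂ (n : SimplexCategory) : Type := Fin 3 ↪o Fin (n.len + 1)

/-- The index set of the generating 1-cells of the 2-truncated oriental of `[n]`. -/
abbrev Gen₁ (n : SimplexCategory) : Type := Fin 2 ↪o Fin (n.len + 1)

/-- The generating 2-cells of the 2-truncated oriental of `[n]`. -/
noncomputable def genCells (n : SimplexCategory) :
    (∐ fun _ : Gen₂ n => TwoCat.walkingCell) ⟶ Ori n :=
  Sigma.desc fun t => classify TwoCat.twoCells (D := Ori n) (FinSub.triangle t.toOrderHom)

/-- The inclusion of free-living 2-cells into free-living invertible 2-cells. -/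
noncomputable def genInv (n : SimplexCategory) :
    (∐ fun _ : Gen₂ n => TwoCat.walkingCell) ⟶ ∐ fun _ : Gen₂ n => TwoCat.walkingInvCell :=
  Limits.Sigma.map fun _ => TwoCat.cellToInv

/-- The 2-category obtained from the 2-truncated oriental of `[n]` by gluing an invertible 2-cell on
each generating 2-cell. -/
noncomputable abbrev OsimOb (n : SimplexCategory) : TwoCat.{0} := pushout (genCells n) (genInv n)

/-- The canonical 2-functor from the 2-truncated oriental. -/
noncomputable abbrev oriToOsim (n : SimplexCategory) : Ori n ⟶ OsimOb n := pushout.inl _ _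

theorem ι_genCells {n : SimplexCategory} (t : Gen₂ n) : Sigma.ι _ t ≫ genCells n =
    classify TwoCat.twoCells (D := Ori n) (FinSub.triangle t.toOrderHom) := by
  simp [genCells]

theorem ι_genInv {n : SimplexCategory} (t : Gen₂ n) : Sigma.ι _ t ≫ genInv n =
    TwoCat.cellToInv ≫ Sigma.ι (fun _ : Gen₂ n => TwoCat.walkingInvCell) t := by
  simp [genInv]

theorem Osim_condition {n : SimplexCategory} (t : Gen₂ n) :
    classify TwoCat.twoCells (D := Ori n) (FinSub.triangle t.toOrderHom) ≫ oriToOsim n =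
    TwoCat.cellToInv ≫ Sigma.ι (fun _ : Gen₂ n => TwoCat.walkingInvCell) t ≫
      pushout.inr (genCells n) (genInv n) := by
  rw [← ι_genCells, Category.assoc, ← Category.assoc TwoCat.cellToInv, ← ι_genInv, Category.assoc]
  exact congrArg (fun z => Sigma.ι _ t ≫ z) pushout.condition

theorem Osim_hom_ext {n : SimplexCategory} {D : TwoCat.{0}} (f g : OsimOb n ⟶ D)
    (h : oriToOsim n ≫ f = oriToOsim n ≫ g) : f = g := by
  refine pushout.hom_ext h (Sigma.hom_ext _ _ fun t => ?_)
  rw [← cancel_epi TwoCat.cellToInv]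
  have e : ∀ k : OsimOb n ⟶ D, TwoCat.cellToInv ≫
      Sigma.ι (fun _ : Gen₂ n => TwoCat.walkingInvCell) t ≫ pushout.inr (genCells n) (genInv n) ≫ k =
      classify TwoCat.twoCells (D := Ori n) (FinSub.triangle t.toOrderHom) ≫ oriToOsim n ≫ k := by
    intro k
    rw [← Category.assoc _ (oriToOsim n), Osim_condition]
    simp only [Category.assoc]
  exact (e f).trans ((congrArg _ h).trans (e g).symm)

/-- The 2-cells `{t 0, t 2} ⟶ {t 0, t 1, t 2}` become invertible. -/
theorem isInv_triangle {n : SimplexCategory} (t : Fin 3 →o Fin (n.len + 1)) :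
    (OsimOb n).ver.IsInv ((oriToOsim n).cell (FinSub.triangle t)) := by
  by_cases ht : StrictMono t
  · let s : Gen₂ n := OrderEmbedding.ofStrictMono t ht
    let x : InvCell (OsimOb n) := TwoCat.invCells.map (Sigma.ι (fun _ : Gen₂ n =>
      TwoCat.walkingInvCell) s ≫ pushout.inr (genCells n) (genInv n)) TwoCat.invCells.coreprx
    have hx : (oriToOsim n).cell (FinSub.triangle t) = x.1 := by
      refine classify_injective TwoCat.twoCells (D := OsimOb n) ?_
      rw [← TwoCat.cellToInv_comp]
      refine Eq.trans ?_ ((Osim_condition s).trans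
        (congrArg _ (classify_coreprx TwoCat.invCells _).symm))
      exact (classify_comp TwoCat.twoCells (D := Ori n) (FinSub.triangle t) (oriToOsim n)).symm
    rw [hx]
    exact x.2
  · have h : t 0 = t 1 ∨ t 1 = t 2 := by
      by_contra! h
      refine ht (Fin.strictMono_iff_lt_succ.2 fun i => ?_)
      fin_cases i
      · exact lt_of_le_of_ne (t.monotone (by decide)) h.1
      · exact lt_of_le_of_ne (t.monotone (by decide)) h.2
    have : FinSub.triangle t = (Ori n).ver.id (FinSub.triangle t).1.1 := by
      refine Subtype.ext (Prod.ext rfl (Subtype.ext ?_))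
      change Finset.image t {0, 1, 2} = Finset.image t {0, 2}
      rcases h with h | h <;> simp [Finset.image_insert, h]
    rw [this]
    exact (oriToOsim n).isFun_ver.isInv (CatOn.isInv_id _ _)

/-- The 2-functor from `OsimOb` given by a 2-functor from the oriental that inverts the generating
2-cells. -/
noncomputable def Osim_desc {n : SimplexCategory} {D : TwoCat.{0}} (F : Ori n ⟶ D)
    (hF : ∀ t : Gen₂ n, D.ver.IsInv (F.cell (FinSub.triangle t.toOrderHom))) : OsimOb n ⟶ D :=
  pushout.desc F (Sigma.desc fun t => classify TwoCat.invCells (D := D) ⟨_, hF t⟩)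
    (Sigma.hom_ext _ _ fun t => by
      rw [← Category.assoc, ← Category.assoc, ι_genCells, ι_genInv, Category.assoc, Sigma.ι_desc]
      exact (classify_comp TwoCat.twoCells (D := Ori n) _ F).trans
        (TwoCat.cellToInv_comp (⟨_, hF t⟩ : InvCell D)).symm)

theorem oriToOsim_desc {n : SimplexCategory} {D : TwoCat.{0}} (F : Ori n ⟶ D) (hF) :
    oriToOsim n ≫ Osim_desc F hF = F := pushout.inl_desc _ _ _

theorem isInv_map_triangle {m n : SimplexCategory} (f : m ⟶ n) (t : Gen₂ m) :
    (OsimOb n).ver.IsInv ((orientalFunctor.map f ≫ oriToOsim n).cell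
      (FinSub.triangle t.toOrderHom)) :=
  (congrArg (fun z => (OsimOb n).ver.IsInv ((oriToOsim n).cell z))
    (FinSub.image_triangle f.toOrderHom t.toOrderHom)).mpr (isInv_triangle _)

/-- Functoriality of `OsimOb`. -/
noncomputable def OsimMap {m n : SimplexCategory} (f : m ⟶ n) : OsimOb m ⟶ OsimOb n :=
  Osim_desc (orientalFunctor.map f ≫ oriToOsim n) (isInv_map_triangle f)

theorem oriToOsim_map {m n : SimplexCategory} (f : m ⟶ n) :
    oriToOsim m ≫ OsimMap f = orientalFunctor.map f ≫ oriToOsim n := oriToOsim_desc _ _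

/-- The cosimplicial 2-category given by the 2-truncated orientals with an invertible 2-cell glued
on each generating 2-cell. -/
noncomputable def Osim : SimplexCategory ⥤ TwoCat.{0} where
  obj := OsimOb
  map := OsimMap
  map_id n := Osim_hom_ext _ _ (by rw [oriToOsim_map, CategoryTheory.Functor.map_id]; simp)
  map_comp f g := Osim_hom_ext _ _ (by
    rw [oriToOsim_map, ← Category.assoc, oriToOsim_map, Category.assoc, oriToOsim_map,
      CategoryTheory.Functor.map_comp, Category.assoc])

end

section

open Limits

/-- The generating 1-cells `{t 0, t 1}` of `OsimOb n` (more generally, for monotone `t`). -/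
noncomputable def edgeOsim {n : SimplexCategory} (t : Fin 2 →o Fin (n.len + 1)) : (OsimOb n).Hom :=
  (oriToOsim n).hom (FinSub.edge t)

/-- The generating 1-cells. -/
noncomputable def genHoms (n : SimplexCategory) :
    (∐ fun _ : Gen₁ n => TwoCat.walkingHom) ⟶ OsimOb n :=
  Sigma.desc fun t => classify TwoCat.homs (D := OsimOb n) (edgeOsim t.toOrderHom)

/-- The inclusion of free-living 1-cells into free-living adjoint equivalences. -/
noncomputable def genAdj (n : SimplexCategory) :
    (∐ fun _ : Gen₁ n => TwoCat.walkingHom) ⟶ ∐ fun _ : Gen₁ n => TwoCat.walkingAdjEquiv :=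
  Limits.Sigma.map fun _ => TwoCat.homToAdjEquiv

/-- The 2-category obtained from `OsimOb n` by gluing an adjoint equivalence on each generating
1-cell. -/
noncomputable abbrev OtildeOb (n : SimplexCategory) : TwoCat.{0} := pushout (genHoms n) (genAdj n)

/-- The canonical 2-functor. -/
noncomputable abbrev OsimToOtilde (n : SimplexCategory) : OsimOb n ⟶ OtildeOb n := pushout.inl _ _

/-- The canonical 2-functor. -/
noncomputable abbrev adjToOtilde {n : SimplexCategory} (t : Gen₁ n) :
    TwoCat.walkingAdjEquiv ⟶ OtildeOb n :=
  Sigma.ι (fun _ : Gen₁ n => TwoCat.walkingAdjEquiv) t ≫ pushout.inr (genHoms n) (genAdj n)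

theorem ι_genHoms {n : SimplexCategory} (t : Gen₁ n) : Sigma.ι _ t ≫ genHoms n =
    classify TwoCat.homs (D := OsimOb n) (edgeOsim t.toOrderHom) := by
  simp [genHoms]

theorem ι_genAdj {n : SimplexCategory} (t : Gen₁ n) : Sigma.ι _ t ≫ genAdj n =
    TwoCat.homToAdjEquiv ≫ Sigma.ι (fun _ : Gen₁ n => TwoCat.walkingAdjEquiv) t := by
  simp [genAdj]

theorem Otilde_condition {n : SimplexCategory} (t : Gen₁ n) :
    classify TwoCat.homs (D := OsimOb n) (edgeOsim t.toOrderHom) ≫ OsimToOtilde n =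
    TwoCat.homToAdjEquiv ≫ adjToOtilde t := by
  rw [← ι_genHoms, Category.assoc, ← Category.assoc TwoCat.homToAdjEquiv, ← ι_genAdj,
    Category.assoc]
  exact congrArg (fun z => Sigma.ι _ t ≫ z) pushout.condition

theorem Otilde_hom_ext {n : SimplexCategory} {D : TwoCat.{0}} (f g : OtildeOb n ⟶ D)
    (h : OsimToOtilde n ≫ f = OsimToOtilde n ≫ g)
    (h' : ∀ t, adjToOtilde t ≫ f = adjToOtilde t ≫ g) : f = g :=
  pushout.hom_ext h (Sigma.hom_ext _ _ fun t => by simpa using h' t)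

/-- The 2-functor from `OtildeOb n` determined by a 2-functor from `OsimOb n` and adjoint
equivalences extending its values on generating 1-cells. -/
noncomputable def Otilde_desc {n : SimplexCategory} {D : TwoCat.{0}} (F : OsimOb n ⟶ D)
    (e : Gen₁ n → AdjEquiv D) (he : ∀ t : Gen₁ n, (e t).f = F.hom (edgeOsim t.toOrderHom)) :
    OtildeOb n ⟶ D :=
  pushout.desc F (Sigma.desc fun t => classify TwoCat.adjEquivs (D := D) (e t))
    (Sigma.hom_ext _ _ fun t => by
      rw [← Category.assoc, ← Category.assoc, ι_genHoms, ι_genAdj, Category.assoc, Sigma.ι_desc]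
      refine (classify_comp TwoCat.homs (D := OsimOb n) _ F).trans
        (Eq.trans ?_ (TwoCat.homToAdjEquiv_comp (e t)).symm)
      exact congrArg (classify TwoCat.homs) (he t).symm)

theorem OsimToOtilde_desc {n : SimplexCategory} {D : TwoCat.{0}} (F : OsimOb n ⟶ D) (e he) :
    OsimToOtilde n ≫ Otilde_desc F e he = F := pushout.inl_desc _ _ _

theorem adjToOtilde_desc {n : SimplexCategory} {D : TwoCat.{0}} (F : OsimOb n ⟶ D) (e he)
    (t : Gen₁ n) : adjToOtilde t ≫ Otilde_desc F e he = classify TwoCat.adjEquivs (D := D) (e t) := by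
  rw [Otilde_desc, Category.assoc, pushout.inr_desc, Sigma.ι_desc]

/-- The adjoint equivalence on a generating 1-cell. -/
noncomputable def genEquiv {n : SimplexCategory} (t : Gen₁ n) : AdjEquiv (OtildeOb n) :=
  AdjEquiv.map (adjToOtilde t) TwoCat.adjEquivs.coreprx

theorem classify_genEquiv {n : SimplexCategory} (t : Gen₁ n) :
    classify TwoCat.adjEquivs (D := OtildeOb n) (genEquiv t) = adjToOtilde t :=
  classify_coreprx TwoCat.adjEquivs (adjToOtilde t)

theorem genEquiv_f {n : SimplexCategory} (t : Gen₁ n) :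
    (genEquiv t).f = (OsimToOtilde n).hom (edgeOsim t.toOrderHom) := by
  refine classify_injective TwoCat.homs (D := OtildeOb n) ?_
  refine (TwoCat.homToAdjEquiv_comp _).symm.trans ?_
  rw [classify_genEquiv]
  exact (Otilde_condition t).symm.trans (classify_comp TwoCat.homs (D := OsimOb n) _ _)

open Classical in
/-- The adjoint equivalence on the 1-cell `{t 0, t 1}`: the one that was glued on it if
`t 0 < t 1`, and the identity if `t 0 = t 1`. -/
noncomputable def edgeEquiv {n : SimplexCategory} (t : Fin 2 →o Fin (n.len + 1)) :
    AdjEquiv (OtildeOb n) :=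
  if h : StrictMono t then genEquiv (OrderEmbedding.ofStrictMono t h)
  else .refl ((OsimToOtilde n).ob ((oriToOsim n).ob (t 0)))

theorem edgeEquiv_of {n : SimplexCategory} (t : Gen₁ n) : edgeEquiv t.toOrderHom = genEquiv t :=
  dif_pos t.strictMono

theorem edge_of_eq {n : SimplexCategory} {t : Fin 2 →o Fin (n.len + 1)} (h : ¬ StrictMono t) :
    t 0 = t 1 := by
  by_contra! h'
  refine h (Fin.strictMono_iff_lt_succ.2 fun i => ?_)
  fin_cases i
  exact lt_of_le_of_ne (t.monotone (by decide)) h'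

theorem edgeEquiv_f {n : SimplexCategory} (t : Fin 2 →o Fin (n.len + 1)) :
    (edgeEquiv t).f = (OsimToOtilde n).hom (edgeOsim t) := by
  by_cases h : StrictMono t
  · rw [edgeEquiv, dif_pos h, genEquiv_f]; rfl
  · rw [edgeEquiv, dif_neg h]
    have h' := edge_of_eq h
    have : FinSub.edge t = FinSub.single (t 0) := Subtype.ext (by
      change Finset.image t {0, 1} = {t 0}
      simp [Finset.image_insert, h'])
    refine Eq.trans ?_ (congrArg (fun z => (OsimToOtilde n).hom ((oriToOsim n).hom z)) this.symm)
    refine ((OsimToOtilde n).isFun_one.id _).symm.trans (congrArg _ ?_)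
    exact ((oriToOsim n).isFun_one.id _).symm

theorem Osim_edge {m n : SimplexCategory} (f : m ⟶ n) (t : Fin 2 →o Fin (m.len + 1)) :
    (OsimMap f).hom (edgeOsim t) = edgeOsim (f.toOrderHom.comp t) := by
  have := congrArg (fun F : Ori m ⟶ OsimOb n => F.hom (FinSub.edge t)) (oriToOsim_map f)
  exact this.trans (congrArg (oriToOsim n).hom (FinSub.image_edge f.toOrderHom t))

theorem Osim_ob {m n : SimplexCategory} (f : m ⟶ n) (a : Fin (m.len + 1)) :
    (OsimMap f).ob ((oriToOsim m).ob a) = (oriToOsim n).ob (f.toOrderHom a) :=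
  congrArg (fun F : Ori m ⟶ OsimOb n => F.ob a) (oriToOsim_map f)

theorem edgeEquiv_comp_f {m n : SimplexCategory} (f : m ⟶ n) (t : Gen₁ m) :
    (edgeEquiv (f.toOrderHom.comp t.toOrderHom)).f =
      (OsimMap f ≫ OsimToOtilde n).hom (edgeOsim t.toOrderHom) :=
  (edgeEquiv_f _).trans (congrArg (OsimToOtilde n).hom (Osim_edge f t.toOrderHom).symm)

/-- Functoriality of `OtildeOb`. -/
noncomputable def OtildeMap {m n : SimplexCategory} (f : m ⟶ n) : OtildeOb m ⟶ OtildeOb n :=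
  Otilde_desc (OsimMap f ≫ OsimToOtilde n) (fun t => edgeEquiv (f.toOrderHom.comp t.toOrderHom))
    (edgeEquiv_comp_f f)

theorem OsimToOtilde_map {m n : SimplexCategory} (f : m ⟶ n) :
    OsimToOtilde m ≫ OtildeMap f = OsimMap f ≫ OsimToOtilde n := OsimToOtilde_desc _ _ _

theorem AdjEquiv.map_refl {D E : TwoCat.{u}} (F : D ⟶ E) (a : D.Ob) :
    (AdjEquiv.refl a).map F = .refl (F.ob a) :=
  AdjEquiv.ext (F.isFun_one.id _) (F.isFun_one.id _) (F.isFun_hor.id _) (F.isFun_hor.id _)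

theorem OtildeMap_equiv {m n : SimplexCategory} (f : m ⟶ n) (t : Fin 2 →o Fin (m.len + 1)) :
    (edgeEquiv t).map (OtildeMap f) = edgeEquiv (f.toOrderHom.comp t) := by
  by_cases h : StrictMono t
  · let s : Gen₁ m := OrderEmbedding.ofStrictMono t h
    have e : edgeEquiv t = genEquiv s := edgeEquiv_of s
    rw [e]
    refine classify_injective TwoCat.adjEquivs (D := OtildeOb n) ?_
    refine (classify_comp TwoCat.adjEquivs (D := OtildeOb m) (genEquiv s) (OtildeMap f)).symm.trans ?_
    rw [classify_genEquiv]
    exact adjToOtilde_desc _ _ _ s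
  · have h' : ¬ StrictMono (f.toOrderHom.comp t) := fun h' => by
      have := h' (show (0 : Fin 2) < 1 by decide)
      exact this.ne (congrArg f.toOrderHom (edge_of_eq h))
    rw [edgeEquiv, dif_neg h, edgeEquiv, dif_neg h', AdjEquiv.map_refl]
    refine congrArg AdjEquiv.refl ?_
    refine (congrArg (fun F : OsimOb m ⟶ OtildeOb n => F.ob ((oriToOsim m).ob (t 0)))
      (OsimToOtilde_map f)).trans ?_
    exact congrArg (OsimToOtilde n).ob (Osim_ob f (t 0))

theorem adjToOtilde_map {m n : SimplexCategory} (f : m ⟶ n) (t : Gen₁ m) :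
    adjToOtilde t ≫ OtildeMap f =
      classify TwoCat.adjEquivs (D := OtildeOb n) (edgeEquiv (f.toOrderHom.comp t.toOrderHom)) :=
  adjToOtilde_desc _ _ _ t

theorem classify_edgeEquiv {m n : SimplexCategory} (f : m ⟶ n) (t : Fin 2 →o Fin (m.len + 1)) :
    classify TwoCat.adjEquivs (D := OtildeOb m) (edgeEquiv t) ≫ OtildeMap f =
      classify TwoCat.adjEquivs (D := OtildeOb n) (edgeEquiv (f.toOrderHom.comp t)) :=
  (classify_comp TwoCat.adjEquivs (D := OtildeOb m) _ _).trans
    (congrArg (classify TwoCat.adjEquivs) (OtildeMap_equiv f t))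

/-- The cosimplicial 2-category obtained from `Osim` by gluing an adjoint equivalence on each
generating 1-cell. Degenerate 1-cells are sent to identity adjoint equivalences. -/
noncomputable def Otilde : SimplexCategory ⥤ TwoCat.{0} where
  obj := OtildeOb
  map := OtildeMap
  map_id n := Otilde_hom_ext _ _
    (by rw [OsimToOtilde_map, show OsimMap (𝟙 n) = 𝟙 _ from Osim.map_id n]; simp)
    (fun t => by
      rw [adjToOtilde_map, Category.comp_id, ← classify_genEquiv, ← edgeEquiv_of]; rfl)
  map_comp f g := Otilde_hom_ext _ _
    (by
      rw [OsimToOtilde_map, ← Category.assoc, OsimToOtilde_map, Category.assoc, OsimToOtilde_map,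
        show OsimMap (f ≫ g) = OsimMap f ≫ OsimMap g from Osim.map_comp f g, Category.assoc])
    (fun t => by
      rw [adjToOtilde_map, ← Category.assoc, adjToOtilde_map, classify_edgeEquiv]; rfl)

end

/-- The product of three copies of the simplex category. -/
abbrev Simplex₃ : Type := SimplexCategory × SimplexCategory × SimplexCategory

/-- The projection `(i, j, k) ↦ i`. -/
abbrev projI : Simplex₃ ⥤ SimplexCategory := CategoryTheory.Prod.fst _ _

/-- The projection `(i, j, k) ↦ j`. -/
abbrev projJ : Simplex₃ ⥤ SimplexCategory := CategoryTheory.Prod.snd _ _ ⋙ CategoryTheory.Prod.fst _ _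

/-- The projection `(i, j, k) ↦ k`. -/
abbrev projK : Simplex₃ ⥤ SimplexCategory := CategoryTheory.Prod.snd _ _ ⋙ CategoryTheory.Prod.snd _ _

/-- The functor `(i, j, k) ↦ verEmb (Osim j) ⊗ (horEmb (Osim i) ⊗ horEmb (Otilde k))`, for the Gray
tensor product of double categories. -/
noncomputable def dblSimplex : Simplex₃ ⥤ DblCat.{0} :=
  (projJ ⋙ Osim ⋙ verEmb).prod'
    ((projI ⋙ Osim ⋙ horEmb).prod' (projK ⋙ Otilde ⋙ horEmb) ⋙ tensorDbl) ⋙ tensorDbl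

/-- The colimit-preserving functor from presheaves on `Δ × Δ × Δ` to double categories which extends
`dblSimplex` along the Yoneda embedding. -/
noncomputable def dblRealization : (Simplex₃ᵒᵖ ⥤ Type) ⥤ DblCat.{0} :=
  yoneda.leftKanExtension dblSimplex

/-- The functor `(i, j, k) ↦ Osim j ⊗ (Osim i ⊗ Otilde k)`, for the icon tensor product and the Gray
tensor product of 2-categories. -/
noncomputable def twoSimplex : Simplex₃ ⥤ TwoCat.{0} :=
  (projJ ⋙ Osim).prod' ((projI ⋙ Osim).prod' (projK ⋙ Otilde) ⋙ tensorPs) ⋙ tensorIc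

/-!
Every functor in the statement other than the embeddings is characterised by the morphisms out of
its values, so isomorphisms are obtained by comparing corepresented functors
(`natIsoOfHomEquiv`).

The Kan extension disappears first: the Yoneda embedding is fully faithful, so `dblRealization`
restricts to `dblSimplex` on representables. It remains to compare two tensor products.

The horizontal embedding has a right adjoint `DblCat.glob`, which keeps the objects, the horizontal
morphisms and the globular squares, those with identity vertical sides (`horGlobEquiv`).

* For 2-categories `A`, `C` and a double category `B`, double functors from the tensor product of
  `horEmb A` and `horEmb C` to `B` are 2-functors from `A` to `glob (ihom (horEmb C) B)`. A
  horizontal pseudonatural transformation between double functors on `horEmb C` is determined by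
  globular squares, and a globular modification has globular components, so this 2-category is the
  2-category of 2-functors from `C` to `glob B`, pseudonatural transformations and modifications
  (`DblCat.globHorHom`). Hence `horEmb` preserves the Gray tensor product (`horTensorIso`).
* 2-functors to `D` from the reflection of the tensor product of `verEmb B` and `horEmb E` are
  double functors from `verEmb B` to `ihom (horEmb E) (horEmb D)`, that is, 2-functors from `co B`
  to the globular squares of the transpose. The only vertical morphisms of `horEmb D` are
  identities, so vertical pseudonatural transformations are icons. The components of the
  modifications between them are 2-cells between identity 1-cells, for which the two compositions
  agree, in either order of the factors, by the Eckmann-Hilton argument. Thus one finds the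
  2-category of 2-functors from `E` to `D`, icons and modifications, with its 2-cells reversed
  (`DblCat.globVerHom`). The reversal cancels the one in the definition of `verEmb`, and the icon
  tensor product results (`leftTensorIso`).

Both comparison 2-functors are bijective on 2-cells, which makes them invertible
(`TwoCat.isIso_of_bijective`).
-/

/-! ### Functors agreeing on morphisms into every object -/

/-- A form of the Yoneda lemma: functors whose values corepresent the same functors are
isomorphic, provided that the bijections are natural in both variables. -/
def natIsoOfHomEquiv {J K : Type*} [Category* J] [Category* K] {F G : J ⥤ K}
    (e : ∀ j D, (F.obj j ⟶ D) ≃ (G.obj j ⟶ D))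
    (he : ∀ {i j : J} (f : i ⟶ j) {D D' : K} (d : D ⟶ D') (φ : F.obj j ⟶ D),
      e i D' (F.map f ≫ φ ≫ d) = G.map f ≫ e j D φ ≫ d) : F ≅ G :=
  have he' : ∀ {i j : J} (f : i ⟶ j) {D D' : K} (d : D ⟶ D') (ψ : G.obj j ⟶ D),
      (e i D').symm (G.map f ≫ ψ ≫ d) = F.map f ≫ (e j D).symm ψ ≫ d := fun f _ _ d ψ => by
    rw [Equiv.symm_apply_eq, he, Equiv.apply_symm_apply]
  NatIso.ofComponents
    (fun j =>
      { hom := (e j _).symm (𝟙 _)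
        inv := e j _ (𝟙 _)
        hom_inv_id := by
          have := he' (𝟙 j) (e j _ (𝟙 _)) (𝟙 _)
          simpa using this.symm
        inv_hom_id := by
          have := he (𝟙 j) ((e j _).symm (𝟙 _)) (𝟙 _)
          simpa using this.symm })
    (fun {i j} f => by
      have h₁ := he' f (𝟙 _) (𝟙 _)
      have h₂ := he' (𝟙 i) (G.map f) (𝟙 _)
      simp only [Category.comp_id] at h₁
      rw [F.map_id, G.map_id, Category.id_comp, Category.id_comp, Category.id_comp] at h₂
      exact h₁.symm.trans h₂)

/-- A 2-functor which is bijective on 2-cells is an isomorphism. -/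
theorem TwoCat.isIso_of_bijective {A B : TwoCat.{0}} (F : A ⟶ B)
    (hF : Function.Bijective (TwoFunctor.cell F)) : IsIso F := by
  have hs := fun x => Function.surjInv_eq hF.2 x
  -- The inverse is the lift of the identity of `B` along the one-element family `F`.
  obtain ⟨G, hG⟩ := TwoCat.exists_lift (S := Unit) (fun _ => F) (fun x y h => hF.1 (h ()))
    (fun _ => 𝟙 B) (Function.surjInv hF.2) (fun _ x => hs x)
  refine ⟨G, TwoCat.hom_ext _ _ fun x => hF.1 ?_, TwoCat.hom_ext _ _ fun x => ?_⟩
  · exact (congrArg (TwoFunctor.cell F) (hG _)).trans (hs _)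
  · exact (congrArg (TwoFunctor.cell F) (hG _)).trans (hs _)

theorem CatOn.IsFun.map_composable {O M O' M' : Type*} {C : CatOn O M} {C' : CatOn O' M'}
    {F₀ : O → O'} {F₁ : M → M'} (hF : C.IsFun C' F₀ F₁) {f g : M} (h : C.tgt f = C.src g) :
    C'.tgt (F₁ f) = C'.src (F₁ g) := by rw [hF.tgt, hF.src, h]

/-! ### The 2-category of globular squares of a double category -/

namespace DblCat

/-- A square is globular if both of its vertical sides are identities. -/
def IsGlob (B : DblCat.{u}) (α : B.Sq) : Prop :=
  B.sqh.src α = B.ver.id (B.ver.src (B.sqh.src α)) ∧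
    B.sqh.tgt α = B.ver.id (B.ver.src (B.sqh.tgt α))

/-- The globular squares of a double category. -/
def GlobSq (B : DblCat.{u}) : Type u := {α : B.Sq // B.IsGlob α}

variable {B : DblCat.{u}}

theorem isGlob_of_eq {α : B.Sq} {a b : B.Ob} (h₁ : B.sqh.src α = B.ver.id a)
    (h₂ : B.sqh.tgt α = B.ver.id b) : B.IsGlob α := by
  rw [IsGlob, h₁, h₂, B.ver.src_id, B.ver.src_id]
  exact ⟨rfl, rfl⟩

theorem GlobSq.composable {α β : B.GlobSq}
    (h : B.ver.src (B.sqh.tgt α.1) = B.ver.src (B.sqh.src β.1)) :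
    B.sqh.tgt α.1 = B.sqh.src β.1 := by
  rw [α.2.2, h, ← β.2.1]

theorem GlobSq.tgt_left (α : B.GlobSq) :
    B.ver.tgt (B.sqh.src α.1) = B.ver.src (B.sqh.src α.1) := by
  conv_lhs => rw [α.2.1, B.ver.tgt_id]

theorem GlobSq.tgt_right (α : B.GlobSq) :
    B.ver.tgt (B.sqh.tgt α.1) = B.ver.src (B.sqh.tgt α.1) := by
  conv_lhs => rw [α.2.2, B.ver.tgt_id]

theorem IsGlob.hcomp {α β : B.Sq} (hα : B.IsGlob α) (hβ : B.IsGlob β)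
    (h : B.sqh.tgt α = B.sqh.src β) : B.IsGlob (B.sqh.comp α β) :=
  isGlob_of_eq ((B.sqh.src_comp _ _ h).trans hα.1) ((B.sqh.tgt_comp _ _ h).trans hβ.2)

theorem GlobSq.left_eq {α β : B.GlobSq} (h : B.sqv.tgt α.1 = B.sqv.src β.1) :
    B.sqh.src β.1 = B.sqh.src α.1 := by
  rw [α.2.1, β.2.1, ← B.top_src, ← h, B.bot_src, α.tgt_left]

theorem GlobSq.right_eq {α β : B.GlobSq} (h : B.sqv.tgt α.1 = B.sqv.src β.1) :
    B.sqh.tgt β.1 = B.sqh.tgt α.1 := by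
  rw [α.2.2, β.2.2, ← B.top_tgt, ← h, B.bot_tgt, α.tgt_right]

theorem GlobSq.left_vcomp {α β : B.GlobSq} (h : B.sqv.tgt α.1 = B.sqv.src β.1) :
    B.sqh.src (B.sqv.comp α.1 β.1) = B.sqh.src α.1 := by
  rw [B.left_comp _ _ h, left_eq h]
  exact B.ver.comp_id_of _ _ α.tgt_left |> fun h' => by rw [← α.2.1] at h'; exact h'

theorem GlobSq.right_vcomp {α β : B.GlobSq} (h : B.sqv.tgt α.1 = B.sqv.src β.1) :
    B.sqh.tgt (B.sqv.comp α.1 β.1) = B.sqh.tgt α.1 := by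
  rw [B.right_comp _ _ h, right_eq h]
  exact B.ver.comp_id_of _ _ α.tgt_right |> fun h' => by rw [← α.2.2] at h'; exact h'

theorem GlobSq.vcomp_isGlob (α β : B.GlobSq) (h : B.sqv.tgt α.1 = B.sqv.src β.1) :
    B.IsGlob (B.sqv.comp α.1 β.1) :=
  isGlob_of_eq ((left_vcomp h).trans α.2.1) ((right_vcomp h).trans α.2.2)

variable (B)

/-- Globular squares form a category under horizontal composition. -/
noncomputable def globHor : CatOn B.Ob B.GlobSq :=
  CatOn.ofPartial (fun α => B.ver.src (B.sqh.src α.1)) (fun α => B.ver.src (B.sqh.tgt α.1))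
    (fun a => ⟨B.sqh.id (B.ver.id a), isGlob_of_eq (B.sqh.src_id _) (B.sqh.tgt_id _)⟩)
    (fun α β h => ⟨B.sqh.comp α.1 β.1, α.2.hcomp β.2 (GlobSq.composable h)⟩)
    (fun a => by simp) (fun a => by simp)
    (fun α β h => by rw [B.sqh.src_comp _ _ (GlobSq.composable h)])
    (fun α β h => by rw [B.sqh.tgt_comp _ _ (GlobSq.composable h)])
    (fun α h => Subtype.ext (by simp only; rw [← α.2.1, B.sqh.id_comp]))
    (fun α h => Subtype.ext (by simp only; rw [← α.2.2, B.sqh.comp_id]))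
    (fun α β γ h h' k k' => Subtype.ext
      (B.sqh.assoc _ _ _ (GlobSq.composable h) (GlobSq.composable k)))

/-- Globular squares form a category under vertical composition. -/
noncomputable def globVer : CatOn B.Hor B.GlobSq :=
  CatOn.ofPartial (fun α => B.sqv.src α.1) (fun α => B.sqv.tgt α.1)
    (fun f => ⟨B.sqv.id f, isGlob_of_eq (B.idh_src _) (B.idh_tgt _)⟩)
    (fun α β h => ⟨B.sqv.comp α.1 β.1, α.vcomp_isGlob β h⟩)
    (fun a => by simp) (fun a => by simp)
    (fun α β h => B.sqv.src_comp _ _ h)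
    (fun α β h => B.sqv.tgt_comp _ _ h)
    (fun α h => Subtype.ext (B.sqv.id_comp _))
    (fun α h => Subtype.ext (B.sqv.comp_id _))
    (fun α β γ h h' k k' => Subtype.ext (B.sqv.assoc _ _ _ h k))

variable {B}

theorem globHor_comp (α β : B.GlobSq) (h : B.sqh.tgt α.1 = B.sqh.src β.1) :
    (B.globHor.comp α β).1 = B.sqh.comp α.1 β.1 :=
  congrArg Subtype.val (show B.globHor.comp α β = ⟨B.sqh.comp α.1 β.1, α.2.hcomp β.2 h⟩ from
    dif_pos (congrArg B.ver.src h))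

theorem globVer_comp (α β : B.GlobSq) (h : B.sqv.tgt α.1 = B.sqv.src β.1) :
    (B.globVer.comp α β).1 = B.sqv.comp α.1 β.1 :=
  congrArg Subtype.val (show B.globVer.comp α β = ⟨B.sqv.comp α.1 β.1, α.vcomp_isGlob β h⟩ from
    dif_pos h)

/-- Vertical invertibility of a globular square may be tested in the double category, since an
inverse of a globular square is globular. -/
theorem isInv_globVer_iff (α : B.GlobSq) : B.globVer.IsInv α ↔ B.sqv.IsInv α.1 := by
  constructor
  · rintro ⟨β, h₁, h₂, h₃, h₄⟩
    exact ⟨β.1, h₁, h₂, (globVer_comp _ _ h₁.symm).symm.trans (congrArg Subtype.val h₃),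
      (globVer_comp _ _ h₂).symm.trans (congrArg Subtype.val h₄)⟩
  · rintro ⟨β, h₁, h₂, h₃, h₄⟩
    have e₁ : B.sqh.src β = B.ver.id (B.ver.src (B.sqh.src α.1)) := by
      have h := B.left_comp α.1 β h₁.symm
      have h₅ : B.ver.src (B.sqh.src β) = B.ver.src (B.sqh.src α.1) := by
        rw [← B.top_src, h₁, B.bot_src, α.tgt_left]
      rw [h₃, α.2.1, B.ver.id_comp_of _ _ h₅, B.idh_src, B.top_src] at h
      exact h.symm
    have e₂ : B.sqh.tgt β = B.ver.id (B.ver.src (B.sqh.tgt α.1)) := by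
      have h := B.right_comp α.1 β h₁.symm
      have h₅ : B.ver.src (B.sqh.tgt β) = B.ver.src (B.sqh.tgt α.1) := by
        rw [← B.top_tgt, h₁, B.bot_tgt, α.tgt_right]
      rw [h₃, α.2.2, B.ver.id_comp_of _ _ h₅, B.idh_tgt, B.top_tgt] at h
      exact h.symm
    exact ⟨⟨β, isGlob_of_eq e₁ e₂⟩, h₁, h₂, Subtype.ext ((globVer_comp α ⟨β, _⟩ h₁.symm).trans h₃),
      Subtype.ext ((globVer_comp ⟨β, _⟩ α h₂).trans h₄)⟩

/-- The 2-category of objects, horizontal morphisms and globular squares of a double category. -/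
noncomputable def globObj (B : DblCat.{u}) : TwoCat.{u} where
  Ob := B.Ob
  Hom := B.Hor
  Cell := B.GlobSq
  one := B.hor
  hor := B.globHor
  ver := B.globVer
  isFun_src := ⟨fun α => B.top_src _, fun α => B.top_tgt _,
    fun a => (B.top_id _).trans (congrArg _ (B.ver.src_id a)), fun α β h => by
      refine (congrArg B.sqv.src (globHor_comp α β (GlobSq.composable h))).trans ?_
      exact B.top_comp _ _ (GlobSq.composable h)⟩
  isFun_tgt := ⟨fun α => (B.bot_src _).trans α.tgt_left, fun α => (B.bot_tgt _).trans α.tgt_right,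
    fun a => (B.bot_id _).trans (congrArg _ (B.ver.tgt_id a)), fun α β h => by
      refine (congrArg B.sqv.tgt (globHor_comp α β (GlobSq.composable h))).trans ?_
      exact B.bot_comp _ _ (GlobSq.composable h)⟩
  isFun_id := ⟨fun f => (congrArg _ (B.idh_src f)).trans (B.ver.src_id _),
    fun f => (congrArg _ (B.idh_tgt f)).trans (B.ver.src_id _),
    fun a => Subtype.ext (B.idh_id a), fun f g h => Subtype.ext <| by
      refine (B.idh_comp f g h).trans (globHor_comp (B.globVer.id f) (B.globVer.id g) ?_).symm
      exact (B.idh_tgt f).trans ((congrArg _ h).trans (B.idh_src g).symm)⟩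
  interchange α β γ δ h₁ h₂ h₃ h₄ := by
    have h₃ : B.sqh.tgt α.1 = B.sqh.src γ.1 := GlobSq.composable h₃
    have h₄ : B.sqh.tgt β.1 = B.sqh.src δ.1 := GlobSq.composable h₄
    have k₁ := globVer_comp α β h₁
    have k₂ := globVer_comp γ δ h₂
    have k₃ := globHor_comp α γ h₃
    have k₄ := globHor_comp β δ h₄
    refine Subtype.ext ((globHor_comp _ _ ?_).trans (Eq.trans ?_ (globVer_comp _ _ ?_).symm))
    · rw [k₁, k₂, GlobSq.left_vcomp h₂, GlobSq.right_vcomp h₁, h₃]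
    · rw [k₁, k₂, k₃, k₄]
      exact B.interchange _ _ _ _ h₁ h₂ h₃ h₄
    · rw [k₃, k₄, B.bot_comp _ _ h₃, B.top_comp _ _ h₄]
      exact congrArg₂ _ h₁ h₂

theorem IsGlob.map {A : DblCat.{u}} (F : A ⟶ B) {α : A.Sq} (h : A.IsGlob α) :
    B.IsGlob (DblFunctor.sq F α) :=
  isGlob_of_eq (((F.isFun_sqh.src α).trans (congrArg _ h.1)).trans (F.isFun_ver.id _))
    (((F.isFun_sqh.tgt α).trans (congrArg _ h.2)).trans (F.isFun_ver.id _))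

/-- The functor from double categories to 2-categories which forgets all but the globular
squares. -/
noncomputable def glob : DblCat.{u} ⥤ TwoCat.{u} where
  obj := globObj
  map {A B} F :=
    { ob := F.ob
      hom := F.horm
      cell α := ⟨F.sq α.1, α.2.map F⟩
      isFun_one := F.isFun_hor
      isFun_hor := ⟨fun α => (congrArg _ (F.isFun_sqh.src _)).trans (F.isFun_ver.src _),
        fun α => (congrArg _ (F.isFun_sqh.tgt _)).trans (F.isFun_ver.src _),
        fun a => Subtype.ext ((F.isFun_sqh.id _).trans (congrArg _ (F.isFun_ver.id a))),
        fun α β h => Subtype.ext (by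
          have h : A.sqh.tgt α.1 = A.sqh.src β.1 := GlobSq.composable h
          refine (congrArg F.sq (globHor_comp α β h)).trans ((F.isFun_sqh.comp _ _ h).trans ?_)
          exact (globHor_comp (B := B) ⟨_, α.2.map F⟩ ⟨_, β.2.map F⟩
            (F.isFun_sqh.map_composable h)).symm)⟩
      isFun_ver := ⟨fun α => F.isFun_sqv.src _, fun α => F.isFun_sqv.tgt _,
        fun f => Subtype.ext (F.isFun_sqv.id f), fun α β h => Subtype.ext (by
          refine (congrArg F.sq (globVer_comp α β h)).trans ((F.isFun_sqv.comp _ _ h).trans ?_)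
          exact (globVer_comp (B := B) ⟨_, α.2.map F⟩ ⟨_, β.2.map F⟩
            (F.isFun_sqv.map_composable h)).symm)⟩ }

end DblCat

/-- Double functors out of a horizontal double category only see globular squares: `horEmb` is left
adjoint to `DblCat.glob`. -/
noncomputable def horGlobEquiv (A : TwoCat.{u}) (B : DblCat.{u}) :
    (horEmb.obj A ⟶ B) ≃ (A ⟶ DblCat.glob.obj B) where
  toFun F :=
    { ob := F.ob
      hom := F.horm
      cell α := ⟨F.sq α, DblCat.isGlob_of_eq ((F.isFun_sqh.src α).trans (F.isFun_ver.id _))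
        ((F.isFun_sqh.tgt α).trans (F.isFun_ver.id _))⟩
      isFun_one := F.isFun_hor
      isFun_hor := ⟨fun α => (congrArg _ (F.isFun_sqh.src α)).trans (F.isFun_ver.src _),
        fun α => (congrArg _ (F.isFun_sqh.tgt α)).trans (F.isFun_ver.src _),
        fun a => Subtype.ext ((F.isFun_sqh.id a).trans (congrArg _ (F.isFun_ver.id a))),
        fun α β h => Subtype.ext ((F.isFun_sqh.comp _ _ h).trans
          (DblCat.globHor_comp (B := B) ⟨F.sq α, _⟩ ⟨F.sq β, _⟩
            (F.isFun_sqh.map_composable h)).symm)⟩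
      isFun_ver := ⟨fun α => F.isFun_sqv.src _, fun α => F.isFun_sqv.tgt _,
        fun f => Subtype.ext (F.isFun_sqv.id f),
        fun α β h => Subtype.ext ((F.isFun_sqv.comp _ _ h).trans
          (DblCat.globVer_comp (B := B) ⟨F.sq α, _⟩ ⟨F.sq β, _⟩
            (F.isFun_sqv.map_composable h)).symm)⟩ }
  invFun G :=
    { ob := G.ob
      horm := G.hom
      verm a := B.ver.id (G.ob a)
      sq α := (G.cell α).1
      isFun_hor := G.isFun_one
      isFun_ver := ⟨fun a => B.ver.src_id _, fun a => B.ver.tgt_id _, fun a => rfl,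
        fun a b h => by obtain rfl : a = b := h; exact (B.ver.id_id _).symm⟩
      isFun_sqh := ⟨fun α => (G.cell α).2.1.trans (congrArg _ (G.isFun_hor.src α)),
        fun α => (G.cell α).2.2.trans (congrArg _ (G.isFun_hor.tgt α)),
        fun a => congrArg Subtype.val (G.isFun_hor.id a), fun α β h =>
          (congrArg Subtype.val (G.isFun_hor.comp α β h)).trans
            (DblCat.globHor_comp (B := B) (G.cell α) (G.cell β)
              (DblCat.GlobSq.composable (G.isFun_hor.map_composable h)))⟩
      isFun_sqv := ⟨G.isFun_ver.src, G.isFun_ver.tgt,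
        fun f => congrArg Subtype.val (G.isFun_ver.id f), fun α β h =>
          (congrArg Subtype.val (G.isFun_ver.comp α β h)).trans
            (DblCat.globVer_comp (B := B) (G.cell α) (G.cell β) (G.isFun_ver.map_composable h))⟩ }
  left_inv F := DblCat.hom_ext _ _ fun _ => rfl
  right_inv G := rfl

theorem horGlobEquiv_naturality {A A' : TwoCat.{u}} {B B' : DblCat.{u}} (a : A' ⟶ A) (b : B ⟶ B')
    (F : horEmb.obj A ⟶ B) :
    horGlobEquiv A' B' (horEmb.map a ≫ F ≫ b) = a ≫ horGlobEquiv A B F ≫ DblCat.glob.map b :=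
  rfl

/-! ### Horizontal double categories and the Gray tensor product -/

namespace DblCat

variable {B : DblCat.{u}}

/-- Composition in `glob` of squares known only up to equality. -/
theorem hcomp_val {α β : B.GlobSq} {a b : B.Sq} (hα : α.1 = a) (hβ : β.1 = b)
    (h : B.sqh.tgt a = B.sqh.src b) : ((glob.obj B).hor.comp α β).1 = B.sqh.comp a b := by
  subst hα hβ
  exact globHor_comp α β h

/-- See `hcomp_val`. -/
theorem vcomp_val {α β : B.GlobSq} {a b : B.Sq} (hα : α.1 = a) (hβ : β.1 = b)
    (h : B.sqv.tgt a = B.sqv.src b) : ((glob.obj B).ver.comp α β).1 = B.sqv.comp a b := by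
  subst hα hβ
  exact globVer_comp α β h

theorem glob_hcomp_val (α β : (glob.obj B).Cell)
    (h : (glob.obj B).hor.tgt α = (glob.obj B).hor.src β) :
    ((glob.obj B).hor.comp α β).1 = B.sqh.comp α.1 β.1 :=
  globHor_comp α β (GlobSq.composable h)

theorem glob_vcomp_val (α β : (glob.obj B).Cell)
    (h : (glob.obj B).ver.tgt α = (glob.obj B).ver.src β) :
    ((glob.obj B).ver.comp α β).1 = B.sqv.comp α.1 β.1 :=
  globVer_comp α β h

end DblCat

namespace HorTrans

variable {C : TwoCat.{u}} {B : DblCat.{u}}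

/-- The component of a transformation at a horizontal morphism, as a globular square. -/
def globNat {A : DblCat.{u}} (x : HorTrans A B) (h : A.Hor) : B.GlobSq :=
  ⟨x.nat h, DblCat.isGlob_of_eq (x.nat_left h) (x.nat_right h)⟩

open DblCat in
/-- A horizontal transformation between double functors on `horEmb.obj C` is a pseudonatural
transformation between 2-functors on `C`. -/
noncomputable def toLax (x : HorTrans (horEmb.obj C) B) : LaxTrans C (DblCat.glob.obj B) where
  dom := horGlobEquiv C B x.dom
  cod := horGlobEquiv C B x.cod
  app := x.app
  nat := x.globNat
  app_src := x.app_src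
  app_tgt := x.app_tgt
  nat_src := x.nat_top
  nat_tgt := x.nat_bot
  nat_id a := Subtype.ext (x.nat_id a)
  nat_comp := fun (h k : (horEmb.obj C).Hor) (e : (horEmb.obj C).hor.tgt h =
      (horEmb.obj C).hor.src k) =>
    Subtype.ext <| (x.nat_comp h k e).trans <| Eq.symm <|
      vcomp_val (hcomp_val rfl rfl (by simp [e])) (hcomp_val rfl rfl (by simp [e]))
        (by simp [e, CatOn.assoc])
  natural := fun (s : (horEmb.obj C).Sq) => Subtype.ext <| by
    have a₁ : x.appV ((horEmb.obj C).sqh.tgt s) = B.sqv.id (x.app (C.hor.tgt s)) := x.appV_id _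
    have a₂ : x.appV ((horEmb.obj C).sqh.src s) = B.sqv.id (x.app (C.hor.src s)) := x.appV_id _
    refine Eq.trans ?_ ((x.natural s).trans ?_)
    · exact vcomp_val (hcomp_val rfl a₁.symm (by simp)) rfl (by simp)
    · exact Eq.symm <| vcomp_val rfl (hcomp_val a₂.symm rfl (by simp)) (by simp)

theorem toLax_mem (x : HorTrans (horEmb.obj C) B) : TransClass.pseudo.mem x.toLax :=
  fun h => (DblCat.isInv_globVer_iff _).2 (x.nat_inv h)

open DblCat in
/-- The horizontal transformation given by a pseudonatural transformation. -/
noncomputable def ofLax (y : LaxTrans C (DblCat.glob.obj B)) (hy : TransClass.pseudo.mem y) :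
    HorTrans (horEmb.obj C) B where
  dom := (horGlobEquiv C B).symm y.dom
  cod := (horGlobEquiv C B).symm y.cod
  app := y.app
  appV a := B.sqv.id (y.app a)
  nat h := (y.nat h).1
  app_src := y.app_src
  app_tgt := y.app_tgt
  isFun_appV := ⟨fun a => B.sqv.src_id _, fun a => B.sqv.tgt_id _, fun a => rfl,
    fun a b h => by obtain rfl : a = b := h; exact (B.sqv.id_id _).symm⟩
  appV_left a := (B.idh_src _).trans (congrArg _ (y.app_src a))
  appV_right a := (B.idh_tgt _).trans (congrArg _ (y.app_tgt a))
  nat_top := y.nat_src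
  nat_bot := y.nat_tgt
  nat_left h := (y.nat h).2.1.trans (congrArg _ (y.nat_hsrc h))
  nat_right h := (y.nat h).2.2.trans (congrArg _ (y.nat_htgt h))
  nat_inv h := (DblCat.isInv_globVer_iff _).1 (hy h)
  nat_id a := congrArg Subtype.val (y.nat_id a)
  nat_comp := fun (h k : C.Hom) (e : C.one.tgt h = C.one.src k) => by
    have := congrArg Subtype.val (y.nat_comp h k e)
    rw [glob_vcomp_val, glob_hcomp_val, glob_hcomp_val] at this
    · exact this
    · simp [e]
    · simp [e]
    · simp [e, CatOn.assoc]
  natural := fun (s : C.Cell) => by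
    have := congrArg Subtype.val (y.natural s)
    rw [glob_vcomp_val, glob_hcomp_val, glob_vcomp_val, glob_hcomp_val] at this
    · exact this
    · simp
    · simp
    · simp
    · simp

end HorTrans

namespace DblMod

variable {A B : DblCat.{u}}

/-- A modification is globular if both of its vertical transformations are identities. -/
def IsGlob (m : DblMod A B) : Prop :=
  m.left = .idt m.left.dom ∧ m.right = .idt m.right.dom

namespace IsGlob

variable {m : DblMod A B}

theorem left_app (hm : m.IsGlob) (a : A.Ob) : m.left.app a = B.ver.id (m.top.dom.ob a) := by
  have h := congrArg (fun x : HorTrans A.tr B.tr => x.app a) hm.1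
  rw [m.left_dom] at h
  exact h

theorem right_app (hm : m.IsGlob) (a : A.Ob) : m.right.app a = B.ver.id (m.top.cod.ob a) := by
  have h := congrArg (fun x : HorTrans A.tr B.tr => x.app a) hm.2
  rw [m.right_dom] at h
  exact h

theorem left_appV (hm : m.IsGlob) (h : A.Hor) : m.left.appV h = B.sqv.id (m.top.dom.horm h) := by
  have h := congrArg (fun x : HorTrans A.tr B.tr => x.appV h) hm.1
  rw [m.left_dom] at h
  exact h

theorem right_appV (hm : m.IsGlob) (h : A.Hor) : m.right.appV h = B.sqv.id (m.top.cod.horm h) := by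
  have h := congrArg (fun x : HorTrans A.tr B.tr => x.appV h) hm.2
  rw [m.right_dom] at h
  exact h

theorem dom_eq (hm : m.IsGlob) : m.top.dom = m.bot.dom :=
  congrArg DblFunctor.tr (m.left_dom.symm.trans
    ((congrArg HorTrans.cod hm.1).symm.trans m.left_cod))

theorem cod_eq (hm : m.IsGlob) : m.top.cod = m.bot.cod :=
  congrArg DblFunctor.tr (m.right_dom.symm.trans
    ((congrArg HorTrans.cod hm.2).symm.trans m.right_cod))

theorem app_isGlob (hm : m.IsGlob) (a : A.Ob) : B.IsGlob (m.app a) :=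
  DblCat.isGlob_of_eq ((m.app_left a).trans (hm.left_app a))
    ((m.app_right a).trans (hm.right_app a))

end IsGlob

open DblCat in
/-- A globular modification between horizontal transformations of double functors on `horEmb.obj C`
is a modification between pseudonatural transformations. -/
noncomputable def toMod {C : TwoCat.{u}} (m : DblMod (horEmb.obj C) B) (hm : m.IsGlob) :
    Modification C (glob.obj B) where
  dom := m.top.toLax
  cod := m.bot.toLax
  app a := ⟨m.app a, hm.app_isGlob a⟩
  dom_dom := congrArg (horGlobEquiv C B) hm.dom_eq
  dom_cod := congrArg (horGlobEquiv C B) hm.cod_eq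
  app_src := m.app_top
  app_tgt := m.app_bot
  natural := fun (h : (horEmb.obj C).Hor) => Subtype.ext <| by
    have := m.natural_hor h
    rw [hm.left_appV, hm.right_appV] at this
    refine Eq.trans ?_ (this.trans ?_)
    · exact vcomp_val (hcomp_val rfl rfl (by simp [hm.left_app])) rfl
        (by simp [hm.left_app, hm.dom_eq])
    · exact Eq.symm <| vcomp_val rfl (hcomp_val rfl rfl (by simp [hm.right_app]))
        (by simp [hm.right_app])

end DblMod

namespace DblCat

variable {C : TwoCat.{u}} {B : DblCat.{u}}

/-- The modification of double functors given by a modification of pseudonatural transformations. -/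
noncomputable def ofMod (y : TransClass.pseudo.Md C (glob.obj B)) : DblMod (horEmb.obj C) B where
  top := .ofLax y.1.dom y.2.1
  bot := .ofLax y.1.cod y.2.2
  left := .idt (DblFunctor.tr ((horGlobEquiv C B).symm y.1.dom.dom))
  right := .idt (DblFunctor.tr ((horGlobEquiv C B).symm y.1.dom.cod))
  app a := (y.1.app a).1
  left_dom := rfl
  left_cod := congrArg (fun F => DblFunctor.tr ((horGlobEquiv C B).symm F)) y.1.dom_dom
  right_dom := rfl
  right_cod := congrArg (fun F => DblFunctor.tr ((horGlobEquiv C B).symm F)) y.1.dom_cod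
  app_top := y.1.app_src
  app_bot := y.1.app_tgt
  app_left a := (y.1.app a).2.1.trans (congrArg _ (y.1.app_hsrc a))
  app_right a := (y.1.app a).2.2.trans (congrArg _ (y.1.app_htgt a))
  natural_hor := fun (h : C.Hom) => by
    have := congrArg Subtype.val (y.1.natural h)
    rw [glob_vcomp_val, glob_hcomp_val, glob_vcomp_val, glob_hcomp_val] at this
    · exact this
    · simp
    · simp
    · simp
    · simp [y.1.dom_dom]
  natural_ver := fun (a : (horEmb.obj C).Ver) => by
    change B.sqh.comp (B.sqv.comp (B.sqv.id (y.1.dom.app a)) (y.1.app a).1)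
        (B.sqh.id (B.ver.id (y.1.dom.cod.ob a))) =
      B.sqh.comp (B.sqh.id (B.ver.id (y.1.dom.dom.ob a)))
        (B.sqv.comp (y.1.app a).1 (B.sqv.id (y.1.cod.app a)))
    rw [B.sqv.comp_id_of _ _ (y.1.app_tgt a), B.sqv.id_comp_of _ _ (y.1.app_src a),
      B.sqh.comp_id_of, B.sqh.id_comp_of]
    · exact (y.1.app a).2.1.trans (congrArg _ (y.1.app_hsrc a))
    · exact (y.1.app a).2.2.trans (congrArg _ (y.1.app_htgt a))

theorem toLax_comp (x y : HorTrans (horEmb.obj C) B) (e : x.cod = y.dom) :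
    (x.comp y e).toLax = x.toLax.comp y.toLax (congrArg (horGlobEquiv C B) e) := by
  refine LaxTrans.ext rfl rfl rfl (funext fun (h : (horEmb.obj C).Hor) => Subtype.ext ?_)
  exact Eq.symm <| vcomp_val (hcomp_val rfl rfl (by simp [e])) (hcomp_val rfl rfl (by simp [e]))
    (by simp [e, CatOn.assoc])

/-- Globular squares of double functors on `horEmb.obj C` correspond to modifications of 2-functors
on `C`. -/
noncomputable def globHorHom (C : TwoCat.{u}) (B : DblCat.{u}) :
    glob.obj (ihom (horEmb.obj C) B) ⟶ TransClass.pseudo.hom C (glob.obj B) where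
  ob F := horGlobEquiv C B F
  hom x := ⟨x.toLax, x.toLax_mem⟩
  cell m := ⟨m.1.toMod m.2, m.1.top.toLax_mem, m.1.bot.toLax_mem⟩
  isFun_one := ⟨fun _ => rfl, fun _ => rfl, fun F => rfl, fun x y e => by
    have e : x.cod = y.dom := e
    refine Eq.trans ?_ (TransClass.catOne_comp _ _ (congrArg (horGlobEquiv C B) e)).symm
    refine Subtype.ext (Eq.trans ?_ (toLax_comp x y e))
    exact congrArg HorTrans.toLax (HorTrans.cat_comp x y e)⟩
  isFun_hor := ⟨fun m => congrArg (fun F => horGlobEquiv C B (DblFunctor.tr F)) m.1.left_dom.symm,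
    fun m => congrArg (fun F => horGlobEquiv C B (DblFunctor.tr F)) m.1.right_dom.symm,
    fun F => Subtype.ext (Modification.ext rfl rfl (funext fun a => Subtype.ext (B.idh_id _).symm)),
    fun m n e => by
    have e : m.1.right = n.1.left := GlobSq.composable (B := ihom (horEmb.obj C) B) e
    have e₁ := DblMod.top_cod_eq e
    have e₂ := DblMod.bot_cod_eq e
    refine Eq.trans ?_ (TransClass.catHor_comp _ _ (congrArg (horGlobEquiv C B) e₁)).symm
    have h : ((glob.obj (ihom (horEmb.obj C) B)).hor.comp m n).1 = m.1.hcomp n.1 e :=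
      (globHor_comp m n e).trans (DblMod.catH_comp _ _ e)
    refine Subtype.ext (Modification.ext ?_ ?_ (funext fun a => Subtype.ext ?_))
    · exact (congrArg (fun z : DblMod (horEmb.obj C) B => z.top.toLax) h).trans (toLax_comp _ _ e₁)
    · exact (congrArg (fun z : DblMod (horEmb.obj C) B => z.bot.toLax) h).trans (toLax_comp _ _ e₂)
    · refine (congrArg (fun z : DblMod (horEmb.obj C) B => z.app a) h).trans ?_
      refine Eq.symm <| hcomp_val rfl rfl ?_
      exact (m.1.app_right a).trans ((congrArg (fun z => HorTrans.app z a) e).trans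
        (n.1.app_left a).symm)⟩
  isFun_ver := ⟨fun m => rfl, fun m => rfl,
    fun F => Subtype.ext (Modification.ext rfl rfl rfl), fun m n e => by
    have e : m.1.bot = n.1.top := e
    refine Eq.trans ?_ (TransClass.catVer_comp _ _ (congrArg HorTrans.toLax e)).symm
    have h : ((glob.obj (ihom (horEmb.obj C) B)).ver.comp m n).1 =
        (DblMod.hcomp (DblMod.tr m.1) (DblMod.tr n.1) e).tr :=
      (globVer_comp m n e).trans (DblMod.catV_comp _ _ e)
    refine Subtype.ext (Modification.ext ?_ ?_ (funext fun a => Subtype.ext ?_))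
    · exact (congrArg (fun z : DblMod (horEmb.obj C) B => z.top.toLax) h).trans rfl
    · exact (congrArg (fun z : DblMod (horEmb.obj C) B => z.bot.toLax) h).trans rfl
    · refine (congrArg (fun z : DblMod (horEmb.obj C) B => z.app a) h).trans ?_
      refine Eq.symm <| vcomp_val rfl rfl ?_
      exact (m.1.app_bot a).trans ((congrArg (fun z => HorTrans.app z a) e).trans
        (n.1.app_top a).symm)⟩

theorem toLax_injective {x y : HorTrans (horEmb.obj C) B} (h : x.toLax = y.toLax) : x = y := by
  refine HorTrans.ext_cells (fun a => ?_) (fun a => ?_) (fun a => ?_) (fun a => ?_)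
  · exact congrArg (fun z : LaxTrans C (glob.obj B) => (z.dom.cell a).1) h
  · exact congrArg (fun z : LaxTrans C (glob.obj B) => (z.cod.cell a).1) h
  · refine (x.appV_id a).trans (Eq.trans ?_ (y.appV_id a).symm)
    exact congrArg (fun z : LaxTrans C (glob.obj B) => B.sqv.id (z.app a)) h
  · exact congrArg (fun z : LaxTrans C (glob.obj B) => (z.nat a).1) h

theorem globHorHom_bijective (C : TwoCat.{u}) (B : DblCat.{u}) :
    Function.Bijective (TwoFunctor.cell (globHorHom C B)) := by
  refine ⟨fun m n h => ?_, fun y => ?_⟩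
  · have h : m.1.toMod m.2 = n.1.toMod n.2 := congrArg Subtype.val h
    have ht : m.1.top = n.1.top := toLax_injective (congrArg Modification.dom h)
    have hb : m.1.bot = n.1.bot := toLax_injective (congrArg Modification.cod h)
    refine Subtype.ext (DblMod.ext ht hb ?_ ?_ (funext fun a => ?_))
    · refine m.2.1.trans (Eq.trans (congrArg HorTrans.idt ?_) n.2.1.symm)
      exact m.1.left_dom.trans
        ((congrArg (fun z => DblFunctor.tr (HorTrans.dom z)) ht).trans n.1.left_dom.symm)
    · refine m.2.2.trans (Eq.trans (congrArg HorTrans.idt ?_) n.2.2.symm)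
      exact m.1.right_dom.trans
        ((congrArg (fun z => DblFunctor.tr (HorTrans.cod z)) ht).trans n.1.right_dom.symm)
    · exact congrArg (fun z : Modification C (glob.obj B) => (z.app a).1) h
  · exact ⟨⟨ofMod y, rfl, rfl⟩, rfl⟩

theorem globHorHom_naturality {C C' : TwoCat.{0}} {B B' : DblCat.{0}} (c : C' ⟶ C) (b : B ⟶ B') :
    glob.map (ihomMap (horEmb.map c) b) ≫ globHorHom C' B' =
      globHorHom C B ≫ TransClass.pseudo.homMap c (glob.map b) :=
  rfl

end DblCat

/-! ### Vertical transformations and icons -/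

namespace TwoCat

variable (B : TwoCat.{u})

/-- Horizontal composition expressed by whiskering and vertical composition. -/
theorem whisker_exch (a b : B.Cell) (h : B.hor.tgt a = B.hor.src b) :
    B.ver.comp (B.hor.comp (B.ver.id (B.ver.src a)) b) (B.hor.comp a (B.ver.id (B.ver.tgt b))) =
      B.hor.comp a b := by
  rw [← B.interchange _ _ _ _ (by simp) (by simp) (by simp [h]) (by simp [h])]
  simp

theorem whisker_exch' (a b : B.Cell) (h : B.hor.tgt a = B.hor.src b) :
    B.ver.comp (B.hor.comp a (B.ver.id (B.ver.src b))) (B.hor.comp (B.ver.id (B.ver.tgt a)) b) =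
      B.hor.comp a b := by
  rw [← B.interchange _ _ _ _ (by simp) (by simp) (by simp [h]) (by simp [h])]
  simp

theorem hor_id_hcomp (a : B.Cell) (f : B.Hom) {o : B.Ob} (hf : f = B.one.id o)
    (h : B.hor.src a = o) : B.hor.comp (B.ver.id f) a = a := by
  rw [hf, B.id_id, B.hor.id_comp_of _ _ h]

theorem hcomp_hor_id (a : B.Cell) (f : B.Hom) {o : B.Ob} (hf : f = B.one.id o)
    (h : B.hor.tgt a = o) : B.hor.comp a (B.ver.id f) = a := by
  rw [hf, B.id_id, B.hor.comp_id_of _ _ h]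

/-- If the target of `b` is an identity 1-cell, only one of the two 2-cells has to be
whiskered to express their horizontal composite. -/
theorem whisker_vcomp (a b : B.Cell) {o : B.Ob} (ha : B.hor.tgt a = o) (h : B.hor.src b = o)
    (hb : B.ver.tgt b = B.one.id o) :
    B.ver.comp (B.hor.comp (B.ver.id (B.ver.src a)) b) a = B.hor.comp a b := by
  rw [← B.whisker_exch a b (ha.trans h.symm), B.hcomp_hor_id a _ hb ha]

/-- The variant of `whisker_vcomp` for a 2-cell `b` whose source is an identity 1-cell. -/
theorem vcomp_whisker (a b : B.Cell) {o : B.Ob} (ha : B.hor.src a = o) (h : B.hor.tgt b = o)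
    (hb : B.ver.src b = B.one.id o) :
    B.ver.comp a (B.hor.comp b (B.ver.id (B.ver.tgt a))) = B.hor.comp b a := by
  rw [← B.whisker_exch b a (h.trans ha.symm), hb, B.hor_id_hcomp a _ rfl ha]

/-- The Eckmann-Hilton argument: the vertical composite of a 2-cell into an identity 1-cell and a
2-cell out of it is also their horizontal composite. -/
theorem vcomp_eq_hcomp (a b : B.Cell) {o : B.Ob} (ha : B.hor.tgt a = o) (hb : B.hor.src b = o)
    (ha' : B.ver.tgt a = B.one.id o) (hb' : B.ver.src b = B.one.id o) :
    B.ver.comp a b = B.hor.comp a b := by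
  rw [← B.whisker_exch' a b (ha.trans hb.symm), B.hcomp_hor_id a _ hb' ha,
    B.hor_id_hcomp b _ ha' hb]

/-- The other half of the Eckmann-Hilton argument, with the factors in the opposite order. -/
theorem vcomp_eq_hcomp_swap (a b : B.Cell) {o : B.Ob} (ha : B.hor.src a = o) (hb : B.hor.tgt b = o)
    (ha' : B.ver.tgt a = B.one.id o) (hb' : B.ver.src b = B.one.id o) :
    B.ver.comp a b = B.hor.comp b a := by
  rw [← B.vcomp_whisker a b ha hb hb', B.hcomp_hor_id b _ ha' hb]

end TwoCat

theorem DblFunctor.verm_eq_ob {E D : TwoCat.{u}} (F : horEmb.obj E ⟶ horEmb.obj D) :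
    F.verm = F.ob :=
  funext F.isFun_ver.id

/-- Double functors between horizontal double categories are 2-functors: the horizontal embedding is
fully faithful. -/
def horFull (E D : TwoCat.{u}) : (horEmb.obj E ⟶ horEmb.obj D) ≃ (E ⟶ D) where
  toFun F :=
    ⟨F.ob, F.horm, F.sq, F.isFun_hor, F.verm_eq_ob ▸ F.isFun_sqh, F.isFun_sqv⟩
  invFun G := horEmb.map G
  left_inv _ := DblCat.hom_ext _ _ fun _ => rfl
  right_inv _ := rfl

/-- The 2-functor underlying a double functor between transposes of horizontal double categories. -/
def verFull {E D : TwoCat.{u}} (F : (horEmb.obj E).tr ⟶ (horEmb.obj D).tr) : E ⟶ D :=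
  horFull E D (DblFunctor.tr F)

namespace HorTrans

variable {E D : TwoCat.{u}}

section

variable (x : HorTrans (horEmb.obj E).tr (horEmb.obj D).tr)

theorem app_eq_dom (a : E.Ob) : x.app a = x.dom.ob a := x.app_src a

theorem app_eq_cod (a : E.Ob) : x.app a = x.cod.ob a := x.app_tgt a

theorem dom_ob_eq_cod_ob (a : E.Ob) : x.dom.ob a = x.cod.ob a :=
  (x.app_eq_dom a).symm.trans (x.app_eq_cod a)

theorem nat_eq_id (a : E.Ob) : x.nat a = D.hor.id (x.dom.ob a) :=
  (x.nat_id a).trans (congrArg D.hor.id (x.app_eq_dom a))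

theorem src_appV (h : E.Hom) : D.ver.src (x.appV h) = x.dom.verm h := x.appV_left h

theorem tgt_appV (h : E.Hom) : D.ver.tgt (x.appV h) = x.cod.verm h := x.appV_right h

theorem hsrc_appV (h : E.Hom) : D.hor.src (x.appV h) = x.dom.ob (E.one.src h) :=
  (x.isFun_appV.src h).trans (x.app_eq_dom _)

theorem htgt_appV (h : E.Hom) : D.hor.tgt (x.appV h) = x.dom.ob (E.one.tgt h) :=
  (x.isFun_appV.tgt h).trans (x.app_eq_dom _)

theorem natural_appV (s : E.Cell) :
    D.ver.comp (x.dom.sq s) (x.appV (E.ver.tgt s)) =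
      D.ver.comp (x.appV (E.ver.src s)) (x.cod.sq s) := by
  have h := x.natural s
  have h₁ : D.ver.tgt (x.dom.sq s) = D.ver.src (x.appV (E.ver.tgt s)) :=
    (x.dom.isFun_sqh.tgt s).trans (x.src_appV _).symm
  have h₂ : D.ver.tgt (x.appV (E.ver.src s)) = D.ver.src (x.cod.sq s) :=
    (x.tgt_appV _).trans (x.cod.isFun_sqh.src s).symm
  refine Eq.trans (Eq.symm ?_) (h.trans ?_)
  · refine (congrArg (D.hor.comp _) (x.nat_eq_id (E.hor.tgt s))).trans (D.hor.comp_id_of _ _ ?_)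
    exact (D.htgt_comp _ _ h₁).trans ((x.dom.isFun_sqv.tgt s).trans (x.dom.isFun_hor.id _))
  · refine (congrArg (D.hor.comp · _) (x.nat_eq_id (E.hor.src s))).trans (D.hor.id_comp_of _ _ ?_)
    exact (D.hsrc_comp _ _ h₂).trans ((x.hsrc_appV _).trans (congrArg _ (E.src_src s)))

/-- A vertical transformation between double functors of horizontal double categories is an icon:
its components at objects are vertical morphisms, hence identities, and what remains is its
components at horizontal morphisms. -/
def toIcon : LaxTrans E D where
  dom := verFull x.dom
  cod := verFull x.cod
  app a := D.one.id (x.dom.ob a)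
  nat h := x.appV h
  app_src a := D.one.src_id _
  app_tgt a := (D.one.tgt_id _).trans (x.dom_ob_eq_cod_ob a)
  nat_src h := (x.src_appV h).trans (D.one.comp_id_of _ _ (x.dom.isFun_ver.tgt h)).symm
  nat_tgt h := (x.tgt_appV h).trans (D.one.id_comp_of _ _
    ((x.cod.isFun_ver.src h).trans (x.dom_ob_eq_cod_ob _).symm)).symm
  nat_id a := (x.isFun_appV.id a).trans
    ((congrArg D.hor.id (x.app_eq_dom a)).trans (D.id_id _).symm)
  nat_comp h k e := by
    have h₁ := D.whisker_exch (x.appV h) (x.appV k)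
      ((x.htgt_appV h).trans ((congrArg _ e).trans (x.hsrc_appV k).symm))
    rw [src_appV, tgt_appV] at h₁
    exact (x.isFun_appV.comp h k e).trans h₁.symm
  natural s := by
    have h₁ := D.hcomp_hor_id _ _ rfl ((verFull x.dom).isFun_hor.tgt s)
    have h₂ := D.hor_id_hcomp _ _ rfl
      (((verFull x.cod).isFun_hor.src s).trans (x.dom_ob_eq_cod_ob _).symm)
    exact (congrArg (D.ver.comp · _) h₁).trans
      ((x.natural_appV s).trans (congrArg (D.ver.comp _) h₂).symm)

theorem toIcon_mem : TransClass.icon.mem x.toIcon := fun _ => rfl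

end

end HorTrans

namespace LaxTrans

variable {E D : TwoCat.{u}} {y : LaxTrans E D}

theorem dom_ob_eq_cod_ob_of_icon (hy : TransClass.icon.mem y) (a : E.Ob) :
    y.dom.ob a = y.cod.ob a := by
  have hy : y.app a = D.one.id (y.dom.ob a) := hy a
  rw [← y.app_tgt, hy, D.one.tgt_id]

theorem src_nat_of_icon (hy : TransClass.icon.mem y) (h : E.Hom) :
    D.ver.src (y.nat h) = y.dom.hom h := by
  have hy : ∀ a, y.app a = D.one.id (y.dom.ob a) := hy
  rw [y.nat_src, hy, D.one.comp_id_of _ _ (y.dom.isFun_one.tgt h)]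

theorem tgt_nat_of_icon (hy : TransClass.icon.mem y) (h : E.Hom) :
    D.ver.tgt (y.nat h) = y.cod.hom h := by
  have hc := dom_ob_eq_cod_ob_of_icon hy
  have hy : ∀ a, y.app a = D.one.id (y.dom.ob a) := hy
  rw [y.nat_tgt, hy, hc, D.one.id_comp_of _ _ (y.cod.isFun_one.src h)]

end LaxTrans

namespace HorTrans

variable {E D : TwoCat.{u}}

/-- The vertical transformation given by an icon. -/
def ofIcon (y : LaxTrans E D) (hy : TransClass.icon.mem y) :
    HorTrans (horEmb.obj E).tr (horEmb.obj D).tr :=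
  have hy : ∀ a, y.app a = D.one.id (y.dom.ob a) := hy
  have hc := LaxTrans.dom_ob_eq_cod_ob_of_icon hy
  have hs := LaxTrans.src_nat_of_icon hy
  have ht := LaxTrans.tgt_nat_of_icon hy
  { dom := DblFunctor.tr (horEmb.map y.dom)
    cod := DblFunctor.tr (horEmb.map y.cod)
    app := y.dom.ob
    appV := y.nat
    nat := fun a => D.hor.id (y.dom.ob a)
    app_src := fun a => rfl
    app_tgt := hc
    isFun_appV := ⟨fun h => y.nat_hsrc h, fun h => (y.nat_htgt h).trans (hc _).symm,
      fun a => (y.nat_id a).trans ((congrArg D.ver.id (hy a)).trans (D.id_id _)),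
      fun (h k : E.Hom) (e : E.one.tgt h = E.one.src k) => by
        have h₁ := D.whisker_exch (y.nat h) (y.nat k) (by simp [hc, e])
        rw [hs, ht] at h₁
        exact (y.nat_comp h k e).trans h₁⟩
    appV_left := hs
    appV_right := ht
    nat_top := fun a => D.hor.src_id _
    nat_bot := fun a => D.hor.tgt_id _
    nat_left := fun a => D.src_id _
    nat_right := fun a => (D.tgt_id _).trans (congrArg D.one.id (hc a))
    nat_inv := fun a => CatOn.isInv_id _ _
    nat_id := fun a => rfl
    nat_comp := fun (a b : E.Ob) (e : a = b) => by
      subst e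
      have h₁ : D.ver.comp (D.hor.id (y.dom.ob a)) (D.hor.id (y.dom.ob a)) =
          D.hor.id (y.dom.ob a) := by rw [← D.id_id, D.ver.id_id]
      have h₂ : D.ver.comp (D.hor.id (y.dom.ob a)) (D.hor.id (y.cod.ob a)) =
          D.hor.id (y.dom.ob a) := by rw [← hc, h₁]
      exact ((D.hor.id_id _).symm.trans (congrArg₂ D.hor.comp h₁.symm h₂.symm))
    natural := fun (s : E.Cell) => by
      have h₁ := y.natural s
      rw [D.hcomp_hor_id _ _ (hy _) (TwoFunctor.hor_tgt _ s), D.hor_id_hcomp _ _ (hy _)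
        ((TwoFunctor.hor_src _ s).trans (hc _).symm)] at h₁
      refine (D.hor.comp_id_of _ _ ?_).trans (h₁.trans (D.hor.id_comp_of _ _ ?_).symm)
      · change D.hor.tgt (D.ver.comp (y.dom.cell s) (y.nat (E.ver.tgt s))) = y.dom.ob (E.hor.tgt s)
        rw [D.htgt_comp _ _ (by simp [hs])]
        simp [hc]
      · change D.hor.src (D.ver.comp (y.nat (E.ver.src s)) (y.cod.cell s)) = y.dom.ob (E.hor.src s)
        rw [D.hsrc_comp _ _ (by simp [ht])]
        simp [hc] }

theorem toIcon_ofIcon (y : LaxTrans E D) (hy : TransClass.icon.mem y) :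
    (ofIcon y hy).toIcon = y :=
  LaxTrans.ext rfl rfl (funext fun a => (hy a).symm) rfl

theorem toIcon_injective {x y : HorTrans (horEmb.obj E).tr (horEmb.obj D).tr}
    (h : x.toIcon = y.toIcon) : x = y := by
  have h₁ : x.dom = y.dom :=
    congrArg DblFunctor.tr ((horFull E D).injective (congrArg LaxTrans.dom h))
  refine HorTrans.ext h₁
    (congrArg DblFunctor.tr ((horFull E D).injective (congrArg LaxTrans.cod h)))
    (funext fun a => ?_) (congrArg LaxTrans.nat h) (funext fun a => ?_)
  · exact (x.app_eq_dom a).trans ((congrArg (fun F => DblFunctor.ob F a) h₁).trans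
      (y.app_eq_dom a).symm)
  · exact (x.nat_eq_id a).trans ((congrArg (fun F => D.hor.id (DblFunctor.ob F a)) h₁).trans
      (y.nat_eq_id a).symm)

theorem toIcon_comp (x y : HorTrans (horEmb.obj E).tr (horEmb.obj D).tr) (e : x.cod = y.dom) :
    (x.comp y e).toIcon =
      x.toIcon.comp y.toIcon (congrArg verFull e) := by
  have he : ∀ a, y.dom.ob a = x.dom.ob a := fun a =>
    (congrArg (fun F => DblFunctor.ob F a) e.symm).trans (x.dom_ob_eq_cod_ob a).symm
  refine LaxTrans.ext rfl rfl (funext fun a => ?_) (funext fun h => ?_)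
  · refine ((congrArg (D.one.comp (D.one.id (x.dom.ob a)))
      (congrArg D.one.id (he a))).trans (D.one.id_id _)).symm
  · refine (congrArg₂ D.ver.comp ?_ ?_).symm
    · exact D.hcomp_hor_id _ _ rfl ((x.htgt_appV h).trans (he _).symm)
    · exact D.hor_id_hcomp _ _ rfl ((y.hsrc_appV h).trans (he _))

end HorTrans

theorem DblMod.IsGlob.left_nat {A B : DblCat.{u}} {m : DblMod A B} (hm : m.IsGlob) (u : A.Ver) :
    m.left.nat u = B.sqh.id (m.top.dom.verm u) := by
  have h := congrArg (fun x : HorTrans A.tr B.tr => x.nat u) hm.1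
  rw [m.left_dom] at h
  exact h

theorem DblMod.IsGlob.right_nat {A B : DblCat.{u}} {m : DblMod A B} (hm : m.IsGlob) (u : A.Ver) :
    m.right.nat u = B.sqh.id (m.top.cod.verm u) := by
  have h := congrArg (fun x : HorTrans A.tr B.tr => x.nat u) hm.2
  rw [m.right_dom] at h
  exact h

/-- Naturality of a globular modification with respect to vertical morphisms. -/
theorem DblMod.IsGlob.vcomp_app {A B : DblCat.{u}} {m : DblMod A B} (hm : m.IsGlob) (u : A.Ver) :
    B.sqv.comp (m.top.appV u) (m.app (A.ver.tgt u)) =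
      B.sqv.comp (m.app (A.ver.src u)) (m.bot.appV u) := by
  have h := m.natural_ver u
  rw [hm.left_nat, hm.right_nat, B.sqh.comp_id_of, B.sqh.id_comp_of] at h
  · exact h
  · simp [hm.left_app, hm.dom_eq]
  · simp [hm.right_app]

namespace DblMod

variable {E D : TwoCat.{u}} (m : DblMod (horEmb.obj E).tr (horEmb.obj D).tr)

theorem src_app (hm : m.IsGlob) (a : E.Ob) : D.ver.src (m.app a) = D.one.id (m.top.dom.ob a) :=
  (m.app_left a).trans (hm.left_app a)

theorem tgt_app (hm : m.IsGlob) (a : E.Ob) : D.ver.tgt (m.app a) = D.one.id (m.top.cod.ob a) :=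
  (m.app_right a).trans (hm.right_app a)

theorem hsrc_app (a : E.Ob) : D.hor.src (m.app a) = m.top.dom.ob a :=
  (m.app_top a).trans (m.top.app_eq_dom a)

theorem htgt_app (a : E.Ob) : D.hor.tgt (m.app a) = m.bot.dom.ob a :=
  (m.app_bot a).trans (m.bot.app_eq_dom a)

/-- A modification between vertical transformations is a modification between icons, in the
opposite direction. -/
def toIconMod (hm : m.IsGlob) : Modification E D where
  dom := m.bot.toIcon
  cod := m.top.toIcon
  app a := m.app a
  dom_dom := congrArg verFull hm.dom_eq.symm
  dom_cod := congrArg verFull hm.cod_eq.symm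
  app_src a := (m.src_app hm a).trans (by rw [hm.dom_eq]; rfl)
  app_tgt a := (m.tgt_app hm a).trans (congrArg D.one.id (m.top.dom_ob_eq_cod_ob a).symm)
  natural h := by
    have h₁ := D.whisker_vcomp (m.top.appV h) (m.app (E.one.tgt h)) (m.top.htgt_appV h)
      (m.hsrc_app _) ((m.tgt_app hm _).trans (congrArg _ (m.top.dom_ob_eq_cod_ob _).symm))
    have h₂ := D.vcomp_whisker (m.bot.appV h) (m.app (E.one.src h)) (m.bot.hsrc_appV h)
      (m.htgt_app _) ((m.src_app hm _).trans (by rw [hm.dom_eq]))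
    rw [m.top.src_appV, hm.dom_eq] at h₁
    rw [m.bot.tgt_appV] at h₂
    exact h₁.trans ((hm.vcomp_app h).trans h₂.symm)

end DblMod

namespace DblCat

variable {E D : TwoCat.{u}}

/-- In the internal hom between two horizontal double categories, the squares with identity
horizontal sides correspond to the modifications of icons. Such squares are composed along double
functors by the vertical composition of `D`, and along vertical transformations by its horizontal
composition, whereas it is the other way round for modifications of icons. Since the components are
2-cells between identity 1-cells, the Eckmann-Hilton argument identifies the two. The 2-cells of the
target are reversed because the naturality of a square (`DblMod.IsGlob.vcomp_app`) is that of a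
modification from its right side to its left side. -/
noncomputable def globVerHom (E D : TwoCat.{u}) :
    glob.obj (ihom (horEmb.obj E) (horEmb.obj D)).tr ⟶
      TwoCat.co.obj (TransClass.icon.hom E D) where
  ob F := horFull E D F
  hom x := ⟨HorTrans.toIcon x, x.toIcon_mem⟩
  cell m := ⟨(DblMod.tr m.1).toIconMod m.2, HorTrans.toIcon_mem _, HorTrans.toIcon_mem _⟩
  isFun_one := ⟨fun _ => rfl, fun _ => rfl, fun F => rfl, fun x y e => by
    have e : x.cod = y.dom := (DblFunctor.trEquiv _ _).injective e
    refine Eq.trans ?_ (TransClass.catOne_comp _ _ (congrArg verFull e)).symm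
    refine Subtype.ext (Eq.trans ?_ (HorTrans.toIcon_comp x y e))
    exact congrArg HorTrans.toIcon (HorTrans.cat_comp x y e)⟩
  isFun_hor := ⟨fun m => (congrArg verFull (DblMod.IsGlob.dom_eq (m := m.1.tr) m.2).symm).trans
      (congrArg (horFull E D) m.1.tr.left_dom.symm),
    fun m => (congrArg verFull (DblMod.IsGlob.cod_eq (m := m.1.tr) m.2).symm).trans
      (congrArg (horFull E D) m.1.tr.right_dom.symm),
    fun F => Subtype.ext (Modification.ext rfl rfl rfl), fun m n e => by
    have e : m.1.bot = n.1.top :=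
      GlobSq.composable (B := (ihom (horEmb.obj E) (horEmb.obj D)).tr) e
    have e₁ := DblMod.top_cod_eq (m := m.1.tr) (n := n.1.tr) e
    have e₂ := DblMod.bot_cod_eq (m := m.1.tr) (n := n.1.tr) e
    refine Eq.trans ?_ (TransClass.catHor_comp _ _ (congrArg verFull e₂)).symm
    have h : ((glob.obj (ihom (horEmb.obj E) (horEmb.obj D)).tr).hor.comp m n).1 =
        (DblMod.hcomp (DblMod.tr m.1) (DblMod.tr n.1) e).tr :=
      (globHor_comp m n e).trans (DblMod.catV_comp _ _ e)
    refine Subtype.ext (Modification.ext ?_ ?_ (funext fun a => ?_))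
    · exact (congrArg (fun z : DblMod (horEmb.obj E) (horEmb.obj D) => z.right.toIcon) h).trans
        (HorTrans.toIcon_comp _ _ e₂)
    · exact (congrArg (fun z : DblMod (horEmb.obj E) (horEmb.obj D) => z.left.toIcon) h).trans
        (HorTrans.toIcon_comp _ _ e₁)
    · refine (congrArg (fun z : DblMod (horEmb.obj E) (horEmb.obj D) => z.app a) h).trans ?_
      refine D.vcomp_eq_hcomp (m.1.app a) (n.1.app a) (o := n.1.left.dom.ob a) ?_ ?_ ?_ ?_
      · have h₁ : m.1.right.dom.ob a = n.1.left.dom.ob a :=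
          (m.1.right.dom_ob_eq_cod_ob a).trans ((congrArg
            (fun z : (horEmb.obj E).tr ⟶ (horEmb.obj D).tr => DblFunctor.ob z a) e₂).trans
            (congrArg (fun z => DblFunctor.ob z a) (DblMod.IsGlob.dom_eq (m := n.1.tr) n.2)).symm)
        exact (m.1.tr.htgt_app a).trans h₁
      · exact n.1.tr.hsrc_app a
      · exact (m.1.tr.tgt_app m.2 a).trans (congrArg D.one.id <|
          (congrArg (fun z => DblFunctor.ob z a) e₁).trans rfl)
      · exact n.1.tr.src_app n.2 a⟩
  isFun_ver := ⟨fun m => rfl, fun m => rfl,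
    fun x => Subtype.ext (Modification.ext rfl rfl (funext fun a =>
      (congrArg D.hor.id (HorTrans.app_eq_dom x a)).trans (D.id_id _).symm)), fun m n e => by
    have e : m.1.right = n.1.left := e
    refine Eq.trans ?_ (TransClass.catVer_comp _ _ (congrArg HorTrans.toIcon e.symm)).symm
    have h : ((glob.obj (ihom (horEmb.obj E) (horEmb.obj D)).tr).ver.comp m n).1 =
        m.1.hcomp n.1 e :=
      (globVer_comp m n e).trans (DblMod.catH_comp _ _ e)
    refine Subtype.ext (Modification.ext ?_ ?_ (funext fun a => ?_))
    · exact (congrArg (fun z : DblMod (horEmb.obj E) (horEmb.obj D) => z.right.toIcon) h).trans rfl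
    · exact (congrArg (fun z : DblMod (horEmb.obj E) (horEmb.obj D) => z.left.toIcon) h).trans rfl
    · refine (congrArg (fun z : DblMod (horEmb.obj E) (horEmb.obj D) => z.app a) h).trans ?_
      refine Eq.symm <| D.vcomp_eq_hcomp_swap (n.1.app a) (m.1.app a)
        (o := n.1.left.dom.ob a) ?_ ?_ ?_ ?_
      · exact n.1.tr.hsrc_app a
      · exact (m.1.tr.htgt_app a).trans (congrArg
          (fun z : HorTrans (horEmb.obj E).tr (horEmb.obj D).tr => z.dom.ob a) e)
      · exact (n.1.tr.tgt_app n.2 a).trans (congrArg D.one.id (HorTrans.dom_ob_eq_cod_ob _ a).symm)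
      · have h₁ : m.1.left.dom = n.1.left.dom :=
          (DblMod.IsGlob.dom_eq (m := m.1.tr) m.2).trans (congrArg HorTrans.dom e)
        exact (m.1.tr.src_app m.2 a).trans
          (congrArg (fun z => D.one.id (DblFunctor.ob z a)) h₁)⟩

end DblCat

/-- Naturality of a modification between icons, in terms of horizontal composition only. This is the
form in which naturality appears in a double category of double functors. -/
theorem Modification.hcomp_app_of_icon {E D : TwoCat.{u}} (y : Modification E D)
    (hx : TransClass.icon.mem y.dom) (hz : TransClass.icon.mem y.cod) (h : E.Hom) :
    D.hor.comp (y.cod.nat h) (y.app (E.one.tgt h)) =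
      D.hor.comp (y.app (E.one.src h)) (y.dom.nat h) := by
  have hx' := LaxTrans.dom_ob_eq_cod_ob_of_icon hx
  have hz' := LaxTrans.dom_ob_eq_cod_ob_of_icon hz
  have hd : ∀ a, y.dom.dom.ob a = y.cod.dom.ob a := fun a => by rw [y.dom_dom]
  have h₁ := D.whisker_vcomp (y.cod.nat h) (y.app (E.one.tgt h))
    (o := y.cod.dom.ob (E.one.tgt h)) (by simp [hz']) (by simp [hd]) ((y.app_tgt _).trans (hz _))
  have h₂ := D.vcomp_whisker (y.dom.nat h) (y.app (E.one.src h))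
    (o := y.dom.dom.ob (E.one.src h)) (by simp) (by simp [hx']) ((y.app_src _).trans (hx _))
  rw [LaxTrans.src_nat_of_icon hz, ← y.dom_dom] at h₁
  rw [LaxTrans.tgt_nat_of_icon hx] at h₂
  exact h₁.symm.trans ((y.natural h).trans h₂)

namespace DblCat

variable {E D : TwoCat.{u}}

/-- The modification of double functors given by a modification of icons. It is written for the
transposes, where the icons are its top and bottom sides and the other two sides are identities. -/
def ofIconMod (y : Modification E D) (hx : TransClass.icon.mem y.dom)
    (hz : TransClass.icon.mem y.cod) : DblMod (horEmb.obj E).tr (horEmb.obj D).tr :=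
  have hx' := LaxTrans.dom_ob_eq_cod_ob_of_icon hx
  have hz' := LaxTrans.dom_ob_eq_cod_ob_of_icon hz
  have hd : ∀ a, y.dom.dom.ob a = y.cod.dom.ob a := fun a => by rw [y.dom_dom]
  have hs : ∀ a, D.ver.src (y.app a) = D.one.id (y.cod.dom.ob a) := fun a =>
    (y.app_src a).trans ((hx a).trans (congrArg D.one.id (hd a)))
  have ht : ∀ a, D.ver.tgt (y.app a) = D.one.id (y.cod.cod.ob a) := fun a =>
    (y.app_tgt a).trans ((hz a).trans (congrArg D.one.id (hz' a)))
  { top := .ofIcon y.cod hz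
    bot := .ofIcon y.dom hx
    left := .idt (horEmb.map y.cod.dom)
    right := .idt (horEmb.map y.cod.cod)
    app := y.app
    left_dom := rfl
    left_cod := congrArg horEmb.map y.dom_dom.symm
    right_dom := rfl
    right_cod := congrArg horEmb.map y.dom_cod.symm
    app_top := fun a => (y.app_hsrc a).trans (hd a)
    app_bot := fun a => (y.app_htgt a).trans (hx' a).symm
    app_left := hs
    app_right := ht
    natural_hor := fun (a : E.Ob) => by
      change D.hor.comp (D.ver.comp (D.hor.id (y.cod.dom.ob a)) (y.app a))
          (D.hor.id (y.dom.dom.ob a)) =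
        D.hor.comp (D.hor.id (y.cod.dom.ob a))
          (D.ver.comp (y.app a) (D.hor.id (y.cod.cod.ob a)))
      rw [← D.id_id (y.cod.dom.ob a), ← D.id_id (y.cod.cod.ob a), D.ver.id_comp_of _ _ (hs a),
        D.ver.comp_id_of _ _ (ht a), D.hor.comp_id_of _ _ (by simp [hx']), D.id_id,
        D.hor.id_comp_of _ _ (by simp [hd])]
    natural_ver := fun (h : E.Hom) => by
      have hc := fun a => (hx' a).symm.trans (hd a)
      have h₁ : D.ver.tgt (D.hor.comp (y.cod.nat h) (y.app (E.one.tgt h))) = y.cod.cod.hom h := by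
        rw [D.tgt_comp _ _ (by simp [← hz', hd]), LaxTrans.tgt_nat_of_icon hz, ht,
          D.one.comp_id_of _ _ (by simp)]
      have h₂ : D.ver.src (D.hor.comp (y.app (E.one.src h)) (y.dom.nat h)) = y.cod.dom.hom h := by
        rw [D.src_comp _ _ (by simp [hc, hd]), LaxTrans.src_nat_of_icon hx, hs, y.dom_dom,
          D.one.id_comp_of _ _ (by simp)]
      exact (D.ver.comp_id_of _ _ h₁).trans
        ((y.hcomp_app_of_icon hx hz h).trans (D.ver.id_comp_of _ _ h₂).symm) }

theorem globVerHom_bijective (E D : TwoCat.{u}) :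
    Function.Bijective (TwoFunctor.cell (globVerHom E D)) := by
  refine ⟨fun m n h => ?_, fun y => ?_⟩
  · have h : (DblMod.tr m.1).toIconMod m.2 = (DblMod.tr n.1).toIconMod n.2 :=
      congrArg Subtype.val h
    have hl : m.1.left = n.1.left := HorTrans.toIcon_injective (congrArg Modification.cod h)
    have hr : m.1.right = n.1.right := HorTrans.toIcon_injective (congrArg Modification.dom h)
    refine Subtype.ext (DblMod.ext ?_ ?_ hl hr (funext fun a => ?_))
    · refine m.2.1.trans (Eq.trans (congrArg HorTrans.idt ?_) n.2.1.symm)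
      exact m.1.tr.left_dom.trans
        ((congrArg (fun z => DblFunctor.tr (HorTrans.dom z)) hl).trans n.1.tr.left_dom.symm)
    · refine m.2.2.trans (Eq.trans (congrArg HorTrans.idt ?_) n.2.2.symm)
      exact m.1.tr.right_dom.trans
        ((congrArg (fun z => DblFunctor.tr (HorTrans.cod z)) hl).trans n.1.tr.right_dom.symm)
    · exact congrArg (fun z : Modification E D => z.app a) h
  · refine ⟨⟨(ofIconMod (E := E) (D := D) y.1 y.2.1 y.2.2).tr, rfl, rfl⟩,
      Subtype.ext (Modification.ext ?_ ?_ rfl)⟩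
    · exact HorTrans.toIcon_ofIcon (E := E) (D := D) y.1.dom y.2.1
    · exact HorTrans.toIcon_ofIcon (E := E) (D := D) y.1.cod y.2.2

theorem globVerHom_naturality {E E' D D' : TwoCat.{0}} (e : E' ⟶ E) (d : D ⟶ D') :
    glob.map (DblFunctor.tr (ihomMap (horEmb.map e) (horEmb.map d))) ≫ globVerHom E' D' =
      globVerHom E D ≫ TwoCat.co.map (TransClass.icon.homMap e d) := by
  refine TwoCat.hom_ext _ _ fun m => Subtype.ext (Modification.ext ?_ ?_ rfl)
  · refine LaxTrans.ext_cells (fun _ => rfl) (fun _ => rfl) (fun _ => rfl)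
  · refine LaxTrans.ext_cells (fun _ => rfl) (fun _ => rfl) (fun _ => rfl)

end DblCat

/-! ### The comparison of the tensor products and the isomorphism -/

/-- 2-functors between 2-categories with reversed 2-cells. -/
def coEquiv (A B : TwoCat.{u}) : (TwoCat.co.obj A ⟶ TwoCat.co.obj B) ≃ (A ⟶ B) where
  toFun F := TwoCat.co.map F
  invFun F := TwoCat.co.map F
  left_inv _ := rfl
  right_inv _ := rfl

theorem DblCat.ihomFunctor_map_app {A A' : DblCat.{0}} (a : A' ⟶ A) {B B' : DblCat.{0}}
    (b : B ⟶ B') :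
    (ihomFunctor.obj (op A)).map b ≫ (ihomFunctor.map a.op).app B' = ihomMap a b :=
  DblCat.hom_ext _ _ fun _ => rfl

theorem TransClass.homFunctor_map_app (P : TransClass.{0}) {A A' : TwoCat.{0}} (a : A' ⟶ A)
    {B B' : TwoCat.{0}} (b : B ⟶ B') :
    (P.homFunctor.obj (op A)).map b ≫ (P.homFunctor.map a.op).app B' = P.homMap a b :=
  TwoCat.hom_ext _ _ fun _ => rfl

instance (C : TwoCat.{0}) (B : DblCat.{0}) : IsIso (DblCat.globHorHom C B) :=
  TwoCat.isIso_of_bijective _ (DblCat.globHorHom_bijective C B)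

instance (E D : TwoCat.{0}) : IsIso (DblCat.globVerHom E D) :=
  TwoCat.isIso_of_bijective _ (DblCat.globVerHom_bijective E D)

/-- Morphisms out of a tensor product of horizontal double categories. -/
noncomputable def tensorHorHorEquiv (A C : TwoCat.{0}) (B : DblCat.{0}) :
    (tensorDbl.obj (horEmb.obj A, horEmb.obj C) ⟶ B) ≃
      (A ⟶ TransClass.pseudo.hom C (DblCat.glob.obj B)) :=
  (tensorHomEquiv DblCat.ihomFunctor (horEmb.obj A) (horEmb.obj C) B).trans <|
    (horGlobEquiv A (DblCat.ihom (horEmb.obj C) B)).trans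
      (asIso (DblCat.globHorHom C B)).homToEquiv

theorem tensorHorHorEquiv_naturality {A A' C C' : TwoCat.{0}} {B B' : DblCat.{0}} (a : A' ⟶ A)
    (c : C' ⟶ C) (b : B ⟶ B') (f : tensorDbl.obj (horEmb.obj A, horEmb.obj C) ⟶ B) :
    tensorHorHorEquiv A' C' B'
        (tensorDbl.map ((horEmb.map a, horEmb.map c) :
          (horEmb.obj A', horEmb.obj C') ⟶ (horEmb.obj A, horEmb.obj C)) ≫ f ≫ b) =
      a ≫ tensorHorHorEquiv A C B f ≫ TransClass.pseudo.homMap c (DblCat.glob.map b) := by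
  have h := tensorHomEquiv_naturality DblCat.ihomFunctor (horEmb.map a) (horEmb.map c) b f
  rw [DblCat.ihomFunctor_map_app] at h
  refine (congrArg (fun z => horGlobEquiv A' (DblCat.ihom (horEmb.obj C') B') z ≫
    DblCat.globHorHom C' B') h).trans ?_
  refine (congrArg (· ≫ DblCat.globHorHom C' B') (horGlobEquiv_naturality a
    (DblCat.ihomMap (horEmb.map c) b) _)).trans ?_
  rw [Category.assoc, Category.assoc, DblCat.globHorHom_naturality]
  rfl

/-- Morphisms out of the horizontal double category of a Gray tensor product. -/
noncomputable def horTensorPsEquiv (A C : TwoCat.{0}) (B : DblCat.{0}) :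
    (horEmb.obj (tensorPs.obj (A, C)) ⟶ B) ≃
      (A ⟶ TransClass.pseudo.hom C (DblCat.glob.obj B)) :=
  (horGlobEquiv _ B).trans (tensorHomEquiv TransClass.pseudo.homFunctor A C (DblCat.glob.obj B))

theorem horTensorPsEquiv_naturality {A A' C C' : TwoCat.{0}} {B B' : DblCat.{0}} (a : A' ⟶ A)
    (c : C' ⟶ C) (b : B ⟶ B') (f : horEmb.obj (tensorPs.obj (A, C)) ⟶ B) :
    horTensorPsEquiv A' C' B'
        (horEmb.map (tensorPs.map ((a, c) : (A', C') ⟶ (A, C))) ≫ f ≫ b) =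
      a ≫ horTensorPsEquiv A C B f ≫ TransClass.pseudo.homMap c (DblCat.glob.map b) := by
  have h := tensorHomEquiv_naturality TransClass.pseudo.homFunctor a c (DblCat.glob.map b)
    (horGlobEquiv _ B f)
  rw [TransClass.homFunctor_map_app] at h
  exact h

/-- The horizontal embedding preserves the Gray tensor product. -/
noncomputable def horTensorIso : horEmb.prod horEmb ⋙ tensorDbl ≅ tensorPs ⋙ horEmb :=
  natIsoOfHomEquiv
    (fun j B => (tensorHorHorEquiv j.1 j.2 B).trans (horTensorPsEquiv j.1 j.2 B).symm)
    fun {i j} f {B B'} b φ => (horTensorPsEquiv i.1 i.2 B').injective <| by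
      refine (Equiv.apply_symm_apply _ _).trans ?_
      refine (tensorHorHorEquiv_naturality f.1 f.2 b φ).trans ?_
      refine Eq.trans ?_ (horTensorPsEquiv_naturality f.1 f.2 b _).symm
      exact congrArg (fun z => f.1 ≫ z ≫ _) (Equiv.apply_symm_apply _ _).symm

/-- Morphisms out of the reflection of the tensor product of a vertical and a horizontal double
category. -/
noncomputable def leftTensorVerHorEquiv (B E D : TwoCat.{0}) :
    (horLeft.obj (tensorDbl.obj (verEmb.obj B, horEmb.obj E)) ⟶ D) ≃
      (B ⟶ TransClass.icon.hom E D) :=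
  ((Adjunction.ofIsRightAdjoint horEmb).homEquiv _ D).trans <|
    (tensorHomEquiv DblCat.ihomFunctor (verEmb.obj B) (horEmb.obj E) (horEmb.obj D)).trans <|
    (DblFunctor.trEquiv (verEmb.obj B) (DblCat.ihom (horEmb.obj E) (horEmb.obj D))).symm.trans <|
    (horGlobEquiv (TwoCat.co.obj B) (DblCat.ihom (horEmb.obj E) (horEmb.obj D)).tr).trans <|
    (asIso (DblCat.globVerHom E D)).homToEquiv.trans (coEquiv B (TransClass.icon.hom E D))

theorem leftTensorVerHorEquiv_naturality {B B' E E' D D' : TwoCat.{0}} (b : B' ⟶ B) (e : E' ⟶ E)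
    (d : D ⟶ D') (f : horLeft.obj (tensorDbl.obj (verEmb.obj B, horEmb.obj E)) ⟶ D) :
    leftTensorVerHorEquiv B' E' D'
        (horLeft.map (tensorDbl.map ((verEmb.map b, horEmb.map e) :
          (verEmb.obj B', horEmb.obj E') ⟶ (verEmb.obj B, horEmb.obj E))) ≫ f ≫ d) =
      b ≫ leftTensorVerHorEquiv B E D f ≫ TransClass.icon.homMap e d := by
  have h₀ : (Adjunction.ofIsRightAdjoint horEmb).homEquiv _ D'
      (horLeft.map (tensorDbl.map ((verEmb.map b, horEmb.map e) :
          (verEmb.obj B', horEmb.obj E') ⟶ (verEmb.obj B, horEmb.obj E))) ≫ f ≫ d) =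
      tensorDbl.map ((verEmb.map b, horEmb.map e) :
          (verEmb.obj B', horEmb.obj E') ⟶ (verEmb.obj B, horEmb.obj E)) ≫
        (Adjunction.ofIsRightAdjoint horEmb).homEquiv _ D f ≫ horEmb.map d :=
    ((Adjunction.ofIsRightAdjoint horEmb).homEquiv_naturality_left _ _).trans
      (congrArg _ ((Adjunction.ofIsRightAdjoint horEmb).homEquiv_naturality_right _ _))
  have h := tensorHomEquiv_naturality DblCat.ihomFunctor (verEmb.map b) (horEmb.map e)
    (horEmb.map d) ((Adjunction.ofIsRightAdjoint horEmb).homEquiv _ D f)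
  rw [DblCat.ihomFunctor_map_app] at h
  have h₁ := (congrArg _ h₀).trans h
  refine (congrArg (fun z => TwoCat.co.map (horGlobEquiv (TwoCat.co.obj B')
    (DblCat.ihom (horEmb.obj E') (horEmb.obj D')).tr (DblFunctor.tr z) ≫
    DblCat.globVerHom E' D')) h₁).trans ?_
  have h₂ := congrArg (fun z => TwoCat.co.map (TwoCat.co.map b ≫ horGlobEquiv (TwoCat.co.obj B)
    (DblCat.ihom (horEmb.obj E) (horEmb.obj D)).tr (DblFunctor.tr
    (tensorHomEquiv DblCat.ihomFunctor (verEmb.obj B) (horEmb.obj E) (horEmb.obj D)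
      ((Adjunction.ofIsRightAdjoint horEmb).homEquiv _ D f))) ≫ z))
    (DblCat.globVerHom_naturality e d)
  exact h₂

/-- The reflection of the tensor product of a vertical and a horizontal double category is the icon
tensor product. -/
noncomputable def leftTensorIso : verEmb.prod horEmb ⋙ tensorDbl ⋙ horLeft ≅ tensorIc :=
  natIsoOfHomEquiv (fun j D => (leftTensorVerHorEquiv j.1 j.2 D).trans
      (tensorHomEquiv TransClass.icon.homFunctor j.1 j.2 D).symm)
    fun {i j} f {D D'} d φ => (tensorHomEquiv TransClass.icon.homFunctor i.1 i.2 D').injective <| by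
      refine (Equiv.apply_symm_apply _ _).trans ?_
      refine (leftTensorVerHorEquiv_naturality f.1 f.2 d φ).trans ?_
      refine Eq.trans ?_ (tensorHomEquiv_naturality TransClass.icon.homFunctor f.1 f.2 d _).symm
      rw [TransClass.homFunctor_map_app]
      exact congrArg (fun z => f.1 ≫ z ≫ _) (Equiv.apply_symm_apply _ _).symm

/-- The two sides agree on representables before the Kan extension. -/
noncomputable def dblSimplexIso : dblSimplex ⋙ horLeft ≅ twoSimplex :=
  have e : (projI ⋙ Osim ⋙ horEmb).prod' (projK ⋙ Otilde ⋙ horEmb) ⋙ tensorDbl ≅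
      (projI ⋙ Osim).prod' (projK ⋙ Otilde) ⋙ tensorPs ⋙ horEmb :=
    Functor.isoWhiskerLeft ((projI ⋙ Osim).prod' (projK ⋙ Otilde)) horTensorIso
  Functor.isoWhiskerRight ((prodFunctorToFunctorProd _ _ _).mapIso
      ((Iso.refl (projJ ⋙ Osim ⋙ verEmb)).prod e)) (tensorDbl ⋙ horLeft) ≪≫
    Functor.isoWhiskerLeft
      ((projJ ⋙ Osim).prod' ((projI ⋙ Osim).prod' (projK ⋙ Otilde) ⋙ tensorPs)) leftTensorIso

theorem mainTheorem8 : Nonempty (yoneda ⋙ dblRealization ⋙ horLeft ≅ twoSimplex) := by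
  -- A pointwise left Kan extension along the fully faithful Yoneda embedding is an extension.
  have : IsIso (yoneda.leftKanExtensionUnit dblSimplex) :=
    (yoneda.isPointwiseLeftKanExtensionOfIsLeftKanExtension _
      (yoneda.leftKanExtensionUnit dblSimplex)).isIso_hom
  exact ⟨Functor.isoWhiskerRight (asIso (yoneda.leftKanExtensionUnit dblSimplex)).symm horLeft ≪≫
    dblSimplexIso⟩
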